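/- Let $0\le d\le 8$ and let $\Gamma_1,\dots,\Gamma_d$ be Hermitian matrices on the unitary space $V=\mathbb C^{2^{[d/2]}}$ with $\Gamma_a\Gamma_b+\Gamma_b\Gamma_a=2\delta_{ab}$. Let $A\subseteq V$ be one of the following sets of spinors: for even $d=2n$, the Weyl spinors $\{\varepsilon:\Gamma_*\varepsilon=s\varepsilon\}$, $s=1$ or $s=-1$, $\Gamma_*=(-i)^n\Gamma_1\cdots\Gamma_{2n}$, where for $d=8$ one also requires $\varepsilon$ to be Majorana; for $d=7$, the Majorana spinors; for the other odd $d$, $A=V$. Here the Majorana spinors are the fixed points of an antilinear map $C$ on $V$ with $C^2=1$ that commutes with all $\Gamma_a\Gamma_b$. A field strength is a finite family $F=(F^k)$ of real skew-symmetric $d\times d$ matrices (its components along a basis of the gauge algebra). Let $W$ be the complex span of all spinors $\varepsilon\in A$ with $\sum_{a,b}F^k_{ab}\Gamma_a\Gamma_b\varepsilon=0$ for every $k$, and let $\Omega$ be the orthogonal projector of $V$ onto $W$. The system of BPS equations defined by $\Omega$ is the linear system $\sum_{a,b}F_{ab}\Gamma_a\Gamma_b\,\Omega=0$ in real skew-symmetric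 matrices $F$, and its supersymmetry fraction is the number $\nu$ with $\operatorname{tr}\Omega=\nu\,2^{[d/2]}$. Two systems are equivalent if their solution sets are carried into each other by $F\mapsto RFR^{T}$ for some $R\in O(d)$. Theorem. (i) For each $d\le 8$ and each supersymmetry fraction $\nu$ that occurs in dimension $d$ there is, up to equivalence, exactly one system of BPS equations (whatever the choice of $\Gamma_a$, of $A$ and of the field strength). (ii) The same uniqueness holds for the systems $\sum_{a,b}F_{ab}\Gamma_a\Gamma_b\,\Omega=0$ defined by arbitrary orthogonal projectors $\Omega$ whose range is spanned by spinors in $A$: any two such systems with the same $d\le 8$ and the same $\nu$, each of which has a solution $F\ne0$, are equivalent. -/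

import Mathlib

noncomputable section

namespace BPS

/-- The spinor space `V` of dimension `2 ^ [d / 2]`, with its standard Hermitian form. -/
abbrev Spinor (d : ℕ) : Type := Fin (2 ^ (d / 2)) → ℂ

/-- Linear operators on the spinor space, as matrices. -/
abbrev SpinorMatrix (d : ℕ) : Type := Matrix (Fin (2 ^ (d / 2))) (Fin (2 ^ (d / 2))) ℂ

/-- Gamma matrices of Euclidean `ℝ^d`: Hermitian matrices on the spinor space that satisfy the
Clifford relations `Γ_a Γ_b + Γ_b Γ_a = 2 δ_ab`. -/
def IsGammaSystem {d : ℕ} (Γ : Fin d → SpinorMatrix d) : Prop :=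
  (∀ a, (Γ a).IsHermitian) ∧
    ∀ a b, Γ a * Γ b + Γ b * Γ a = if a = b then 2 else 0

/-- The chirality operator `Γ_* = (-i)^n Γ_1 ⋯ Γ_{2n}`, used for `d = 2n`. -/
def chirality {d : ℕ} (Γ : Fin d → SpinorMatrix d) : SpinorMatrix d :=
  (-Complex.I) ^ (d / 2) • (List.ofFn Γ).prod

/-- The spinors of chirality `s` (Weyl spinors, for `s = 1` or `s = -1`). -/
def weylSpinors {d : ℕ} (Γ : Fin d → SpinorMatrix d) (s : ℂ) : Set (Spinor d) :=
  {ε | (chirality Γ).mulVec ε = s • ε}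

/-- A real structure on the spinor representation: an antilinear involution of the spinor space
that commutes with all `Γ_a Γ_b`, hence with the action of the spin group. -/
def IsRealStructure {d : ℕ} (Γ : Fin d → SpinorMatrix d)
    (C : Spinor d →ₛₗ[starRingEnd ℂ] Spinor d) : Prop :=
  (∀ ε, C (C ε) = ε) ∧
    ∀ a b ε, C ((Γ a * Γ b).mulVec ε) = (Γ a * Γ b).mulVec (C ε)

/-- The Majorana spinors of a real structure. -/
def majoranaSpinors {d : ℕ} (C : Spinor d →ₛₗ[starRingEnd ℂ] Spinor d) : Set (Spinor d) :=
  {ε | C ε = ε}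

/-- The spaces of spinors from which the supersymmetry parameter `ε` may be taken: Majorana-Weyl
spinors for `d = 8`, Majorana spinors for `d = 7`, Weyl spinors (of either chirality) for the
other even `d`, all spinors for the other odd `d`. -/
def IsParameterSpace {d : ℕ} (Γ : Fin d → SpinorMatrix d) (A : Set (Spinor d)) : Prop :=
  if d = 8 then
    ∃ C, IsRealStructure Γ C ∧ ∃ s : ℂ, (s = 1 ∨ s = -1) ∧ A = weylSpinors Γ s ∩ majoranaSpinors C
  else if d = 7 then
    ∃ C, IsRealStructure Γ C ∧ A = majoranaSpinors C
  else if Even d then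
    ∃ s : ℂ, (s = 1 ∨ s = -1) ∧ A = weylSpinors Γ s
  else
    A = Set.univ

/-- The matrix `F_ab Γ_ab` (sum over `a` and `b`). -/
def fieldMatrix {d : ℕ} (Γ : Fin d → SpinorMatrix d) (F : Matrix (Fin d) (Fin d) ℝ) :
    SpinorMatrix d :=
  ∑ a, ∑ b, (F a b : ℂ) • (Γ a * Γ b)

/-- The unbroken supersymmetries of a field strength `F` with components `F^k` along a basis of
the gauge algebra: the spinors `ε` in `A` with `F^k_ab Γ_ab ε = 0` for all `k`. -/
def zeroSpinors {d m : ℕ} (Γ : Fin d → SpinorMatrix d) (A : Set (Spinor d))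
    (F : Fin m → Matrix (Fin d) (Fin d) ℝ) : Set (Spinor d) :=
  {ε | ε ∈ A ∧ ∀ k, (fieldMatrix Γ (F k)).mulVec ε = 0}

/-- `Ω` is the orthogonal (Hermitian) projector of the spinor space onto `W`. -/
def IsProjectorOnto {d : ℕ} (Ω : SpinorMatrix d) (W : Submodule ℂ (Spinor d)) : Prop :=
  Ω.IsHermitian ∧ Ω * Ω = Ω ∧ LinearMap.range Ω.mulVecLin = W

/-- The solutions of the BPS equations `F_ab Γ_ab Ω = 0` in skew-symmetric matrices `F`. -/
def solutions {d : ℕ} (Γ : Fin d → SpinorMatrix d) (Ω : SpinorMatrix d) :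
    Set (Matrix (Fin d) (Fin d) ℝ) :=
  {F | F.transpose = -F ∧ fieldMatrix Γ F * Ω = 0}

/-- `S` is the set of solutions of the equations `F_ab Γ_ab Ω = 0` for a Hermitian projector `Ω`
with `tr Ω = ν 2^[d/2]` whose range `W` is spanned by spinors of the required type (in the
Majorana case: `Ω` is a real symmetric matrix with respect to the real structure). -/
def IsProjectorSystem (d : ℕ) (ν : ℝ) (S : Set (Matrix (Fin d) (Fin d) ℝ)) : Prop :=
  ∃ Γ : Fin d → SpinorMatrix d, IsGammaSystem Γ ∧
    ∃ A, IsParameterSpace Γ A ∧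
      ∃ (W : Submodule ℂ (Spinor d)) (Ω : SpinorMatrix d),
        W = Submodule.span ℂ (A ∩ W) ∧ IsProjectorOnto Ω W ∧
          Ω.trace = ((ν * 2 ^ (d / 2) : ℝ) : ℂ) ∧ S = solutions Γ Ω

/-- `S` is the set of solutions of a system of BPS equations in dimension `d` with fraction `ν`
of unbroken supersymmetry: `Ω` projects onto the space `W` (spanned by) all the zero spinors of
some field strength, and `tr Ω = ν 2^[d/2]`. -/
def IsBPSSystem (d : ℕ) (ν : ℝ) (S : Set (Matrix (Fin d) (Fin d) ℝ)) : Prop :=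
  ∃ Γ : Fin d → SpinorMatrix d, IsGammaSystem Γ ∧
    ∃ A, IsParameterSpace Γ A ∧
      ∃ (m : ℕ) (F : Fin m → Matrix (Fin d) (Fin d) ℝ), (∀ k, (F k).transpose = -F k) ∧
        ∃ Ω : SpinorMatrix d,
          IsProjectorOnto Ω (Submodule.span ℂ (zeroSpinors Γ A F)) ∧
            Ω.trace = ((ν * 2 ^ (d / 2) : ℝ) : ℂ) ∧ S = solutions Γ Ω

/-- The fractions of unbroken supersymmetry that occur in dimension `d`. -/
def supersymmetryFractions (d : ℕ) : Set ℝ :=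
  {ν | ∃ S, IsBPSSystem d ν S}

/-- Two systems are equivalent if their solutions agree after an orthogonal change of basis of
`ℝ^d`, which acts on field strengths by `F ↦ R F R⁻¹ = R F Rᵀ`. -/
def Equivalent {d : ℕ} (S T : Set (Matrix (Fin d) (Fin d) ℝ)) : Prop :=
  ∃ R ∈ Matrix.orthogonalGroup (Fin d) ℝ, T = (fun F => R * F * R.transpose) '' S

end BPS

end

noncomputable section

open Module Matrix

namespace BPS

/-! The solution set depends only on the range $W$ of $\Omega$: it is the annihilator of $W$ in
$\mathfrak{so}(d)$, and $\nu$ fixes $n=\dim_{\mathbb C}W$. It remains to bring the annihilators of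
all $n$-dimensional spaces of admissible spinors to one normal form by a rotation
(`equivalent_of_canonical`).

For $d=5,6,7$ the relevant spinors form a real 8-dimensional space $X$ with seven anticommuting
complex structures $B_a$ such that $B_aB_b=-\Gamma_a\Gamma_b$ for $a,b\le d$. For $d=5,6$ the
spinors are $\mathbb C^4$ with a quaternionic structure $J$, and $B_6$ (counting from 0) is
multiplication by $i$, so that complex subspaces are $B_6$-stable. Given $e\ne0$ in $W$, every
spinor is uniquely $te+v\cdot e$ with $v\in\mathbb R^7$. Hence $W$ becomes $\mathbb Re$ plus a space
$U$ of vectors, and $F$ kills $W$ iff $F\cdot e=0$ (so $F\in\mathfrak g_2$) and $FU=0$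
(`IsClifford.act_cl_eq_zero`). The spinor $e$ defines a cross product by $u\cdot v\cdot e=(u\times
v)\cdot e$ for $u\perp v$; kernels of such $F$ are closed under it, and orthonormal $u,v$ extend to
a standard octonion basis (`IsClifford.exists_adapted`). So $\dim U=0,1$ give one orbit each, $U$
containing orthonormal $u,v$ and contained in $\langle u,v,u\times v\rangle$ gives one more, and any
larger $U$ forces $F=0$. For $d<7$ the matrices are padded by zeros and the rotations are kept fixed
on the missing coordinates.

For $d=8$ triality is used: pairing an orthonormal basis of Majorana-Weyl spinors with its last
member gives seven anticommuting complex structures on the vector space $\mathbb R^8$, which in a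
suitable frame are octonion multiplications up to one sign. The annihilator of the first $n$ basis
spinors then depends on $n$ only. For $d=4$ the solutions are the (anti-)self-dual matrices,
exchanged by a reflection; for $d\le3$ and $n>0$ there are only zero solutions.

The dimension $n$ fails to decide between the normal form and $\{0\}$ only for $(d,n)=(7,4)$ and
$(5,2)$. In (ii) zero systems are excluded by hypothesis. In (i), a zero solution set would force
the field strength itself to vanish, hence $W$ to be the span of all of $A$, of dimension 8 or 4
(`IsBPSSystem.exists_span_eq`). -/

/-! ### Reduction to annihilators of spaces of spinors -/

theorem equivalent_of_canonical {d : ℕ} {S T : Set (Matrix (Fin d) (Fin d) ℝ)}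
    {K : Set (Matrix (Fin d) (Fin d) ℝ)} {R Q : Matrix (Fin d) (Fin d) ℝ}
    (hR : R ∈ orthogonalGroup (Fin d) ℝ) (hQ : Q ∈ orthogonalGroup (Fin d) ℝ)
    (hS : ∀ F, F ∈ S ↔ R * F * Rᵀ ∈ K) (hT : ∀ F, F ∈ T ↔ Q * F * Qᵀ ∈ K) : Equivalent S T := by
  have hR1 : R * Rᵀ = 1 := (mem_orthogonalGroup_iff _ _).1 hR
  have hR2 : Rᵀ * R = 1 := (mem_orthogonalGroup_iff' _ _).1 hR
  have hQ1 : Q * Qᵀ = 1 := (mem_orthogonalGroup_iff _ _).1 hQ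
  have hQ2 : Qᵀ * Q = 1 := (mem_orthogonalGroup_iff' _ _).1 hQ
  refine ⟨Qᵀ * R, mul_mem ((mem_orthogonalGroup_iff _ _).2 (by simpa using hQ2)) hR, ?_⟩
  ext F
  simp only [Set.mem_image]
  constructor
  · intro hF
    refine ⟨Rᵀ * (Q * F * Qᵀ) * R, ?_, ?_⟩
    · rw [hS]
      have : R * (Rᵀ * (Q * F * Qᵀ) * R) * Rᵀ = (R * Rᵀ) * (Q * F * Qᵀ) * (R * Rᵀ) := by
        simp only [mul_assoc]
      rwa [this, hR1, one_mul, mul_one, ← hT]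
    · have : Qᵀ * R * (Rᵀ * (Q * F * Qᵀ) * R) * (Qᵀ * R)ᵀ =
          Qᵀ * (R * Rᵀ) * Q * F * (Qᵀ * (R * Rᵀ) * Q) := by
        simp only [mul_assoc, transpose_mul, transpose_transpose]
      rw [this, hR1, mul_one, hQ2, one_mul, mul_one]
  · rintro ⟨G, hG, rfl⟩
    rw [hT]
    have : Q * (Qᵀ * R * G * (Qᵀ * R)ᵀ) * Qᵀ = (Q * Qᵀ) * (R * G * Rᵀ) * (Q * Qᵀ) := by
      simp only [mul_assoc, transpose_mul, transpose_transpose]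
    rwa [this, hQ1, one_mul, mul_one, ← hS]

theorem Equivalent.refl {d : ℕ} (S : Set (Matrix (Fin d) (Fin d) ℝ)) : Equivalent S S :=
  equivalent_of_canonical (K := S) (one_mem _) (one_mem _) (by simp) (by simp)

/-- The skew-symmetric matrices that annihilate all spinors in `W`. -/
def annihilator {d : ℕ} (Γ : Fin d → SpinorMatrix d) (W : Submodule ℂ (Spinor d)) :
    Set (Matrix (Fin d) (Fin d) ℝ) :=
  {F | Fᵀ = -F ∧ ∀ x ∈ W, fieldMatrix Γ F *ᵥ x = 0}

theorem solutions_eq_annihilator {d : ℕ} (Γ : Fin d → SpinorMatrix d)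
    {W : Submodule ℂ (Spinor d)} {Ω : SpinorMatrix d} (h : IsProjectorOnto Ω W) :
    solutions Γ Ω = annihilator Γ W := by
  obtain ⟨-, -, rfl⟩ := h
  ext F
  simp only [solutions, annihilator, Set.mem_ofPred_eq, LinearMap.mem_range,
    forall_exists_index, forall_apply_eq_imp_iff, mulVecLin_apply, mulVec_mulVec]
  refine and_congr_right fun _ => ⟨fun h v => by rw [h, zero_mulVec], fun h => ?_⟩
  ext i j
  simpa using congrFun (h (Pi.single j 1)) i

theorem trace_eq_finrank {d : ℕ} {W : Submodule ℂ (Spinor d)} {Ω : SpinorMatrix d}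
    (h : IsProjectorOnto Ω W) : Ω.trace = finrank ℂ W := by
  obtain ⟨-, h2, rfl⟩ := h
  have hi : IsIdempotentElem Ω.mulVecLin := by
    change Ω.mulVecLin ∘ₗ Ω.mulVecLin = _
    rw [← mulVecLin_mul, h2]
  rw [← (LinearMap.IsIdempotentElem.isProj_range _ hi).trace]
  exact (trace_toLin'_eq Ω).symm

/-- `S` is defined by gamma matrices, a parameter space `A` and an `n`-dimensional space spanned by
elements of `A`. -/
def IsSystem (d n : ℕ) (S : Set (Matrix (Fin d) (Fin d) ℝ)) : Prop :=
  ∃ Γ : Fin d → SpinorMatrix d, IsGammaSystem Γ ∧ ∃ A, IsParameterSpace Γ A ∧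
    ∃ W : Submodule ℂ (Spinor d), W = Submodule.span ℂ (A ∩ W) ∧ finrank ℂ W = n ∧
      S = annihilator Γ W

theorem IsProjectorSystem.exists_isSystem {d : ℕ} {ν : ℝ} {S : Set (Matrix (Fin d) (Fin d) ℝ)}
    (h : IsProjectorSystem d ν S) : ∃ n : ℕ, (n : ℝ) = ν * 2 ^ (d / 2) ∧ IsSystem d n S := by
  obtain ⟨Γ, hΓ, A, hA, W, Ω, hW, hΩ, htr, rfl⟩ := h
  refine ⟨finrank ℂ W, ?_, Γ, hΓ, A, hA, W, hW, rfl, solutions_eq_annihilator Γ hΩ⟩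
  rw [trace_eq_finrank hΩ] at htr
  exact_mod_cast htr

/-- The span of the zero spinors is spanned by elements of `A` by construction, so the
classification behind (ii) also serves (i). -/
theorem IsBPSSystem.isProjectorSystem {d : ℕ} {ν : ℝ} {S : Set (Matrix (Fin d) (Fin d) ℝ)}
    (h : IsBPSSystem d ν S) : IsProjectorSystem d ν S := by
  obtain ⟨Γ, hΓ, A, hA, m, F, -, Ω, hΩ, htr, rfl⟩ := h
  refine ⟨Γ, hΓ, A, hA, _, Ω, le_antisymm ?_ ?_, hΩ, htr, rfl⟩
  · exact Submodule.span_mono fun x hx => ⟨hx.1, Submodule.subset_span hx⟩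
  · exact Submodule.span_le.2 Set.inter_subset_right

/-- Each component $F^k$ is itself a solution of the equations it defines. If zero is the only
solution, then all $F^k$ vanish and every element of `A` is a zero spinor. -/
theorem IsBPSSystem.exists_span_eq {d : ℕ} {ν : ℝ} {S : Set (Matrix (Fin d) (Fin d) ℝ)}
    (h : IsBPSSystem d ν S) (hS : ¬ ∃ F ∈ S, F ≠ 0) :
    ∃ Γ : Fin d → SpinorMatrix d, IsGammaSystem Γ ∧ ∃ A, IsParameterSpace Γ A ∧
      (finrank ℂ (Submodule.span ℂ A) : ℝ) = ν * 2 ^ (d / 2) := by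
  obtain ⟨Γ, hΓ, A, hA, m, F, hF, Ω, hΩ, htr, rfl⟩ := h
  refine ⟨Γ, hΓ, A, hA, ?_⟩
  push Not at hS
  have hF0 : ∀ k, F k = 0 := fun k => by
    apply hS
    rw [solutions_eq_annihilator Γ hΩ]
    refine ⟨hF k, fun x hx => ?_⟩
    induction hx using Submodule.span_induction with
    | mem x hx => exact hx.2 k
    | zero => simp
    | add x y _ _ hx hy => rw [mulVec_add, hx, hy, add_zero]
    | smul c x _ hx => rw [mulVec_smul, hx, smul_zero]
  have hz : zeroSpinors Γ A F = A := by
    ext x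
    simp [zeroSpinors, hF0, fieldMatrix]
  rw [hz] at hΩ
  rw [trace_eq_finrank hΩ] at htr
  exact_mod_cast htr

theorem zero_mem_annihilator {d : ℕ} (Γ : Fin d → SpinorMatrix d) (W : Submodule ℂ (Spinor d)) :
    (0 : Matrix (Fin d) (Fin d) ℝ) ∈ annihilator Γ W :=
  ⟨by simp, by simp [fieldMatrix]⟩

/-! ### Real Clifford modules with seven generators -/

variable {X : Type*} [AddCommGroup X] [Module ℝ X]

/-- Seven anticommuting complex structures on a real vector space. -/
def IsClifford (B : Fin 7 → X →ₗ[ℝ] X) : Prop :=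
  ∀ a b x, B a (B b x) + B b (B a x) = if a = b then (-2 : ℝ) • x else 0

/-- Clifford multiplication by a vector. -/
def cl (B : Fin 7 → X →ₗ[ℝ] X) : (Fin 7 → ℝ) →ₗ[ℝ] X →ₗ[ℝ] X := Fintype.linearCombination ℝ B

theorem cl_apply (B : Fin 7 → X →ₗ[ℝ] X) (v : Fin 7 → ℝ) (x : X) :
    cl B v x = ∑ a, v a • B a x := by
  simp [cl, Fintype.linearCombination_apply]

@[simp] theorem cl_single (B : Fin 7 → X →ₗ[ℝ] X) (a : Fin 7) : cl B (Pi.single a 1) = B a := by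
  simp [cl]

theorem IsClifford.sq {B : Fin 7 → X →ₗ[ℝ] X} (hB : IsClifford B) (a : Fin 7) (x : X) :
    B a (B a x) = -x := by
  have h := hB a a x
  rw [if_pos rfl] at h
  have : (2 : ℝ) • B a (B a x) = (2 : ℝ) • -x := by
    rw [two_smul, h]; module
  exact smul_right_injective X (two_ne_zero' ℝ) this

theorem IsClifford.anti {B : Fin 7 → X →ₗ[ℝ] X} (hB : IsClifford B) {a b : Fin 7} (h : a ≠ b)
    (x : X) : B a (B b x) = -B b (B a x) := by
  have := hB a b x
  rw [if_neg h] at this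
  exact eq_neg_of_add_eq_zero_left this

theorem IsClifford.cl_cl {B : Fin 7 → X →ₗ[ℝ] X} (hB : IsClifford B) (u v : Fin 7 → ℝ) (x : X) :
    cl B u (cl B v x) + cl B v (cl B u x) = (-2 * (u ⬝ᵥ v)) • x := by
  have h2 : ∀ u v, cl B u (cl B v x) = ∑ a, ∑ b, (v a * u b) • B b (B a x) := fun u v => by
    simp only [cl_apply, map_sum, map_smul, Finset.smul_sum, smul_smul]
  have h1 : cl B u (cl B v x) = ∑ a, ∑ b, (u a * v b) • B a (B b x) := by
    rw [h2, Finset.sum_comm]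
    simp only [mul_comm]
  rw [h1, h2, ← Finset.sum_add_distrib]
  simp only [← Finset.sum_add_distrib, ← smul_add, hB _ _ x, smul_ite, smul_zero,
    Finset.sum_ite_eq, Finset.mem_univ, if_true, smul_smul, dotProduct, ← Finset.sum_smul,
    Finset.mul_sum]
  congr 1
  exact Finset.sum_congr rfl fun _ _ => by ring

theorem IsClifford.cl_self {B : Fin 7 → X →ₗ[ℝ] X} (hB : IsClifford B) (u : Fin 7 → ℝ) (x : X) :
    cl B u (cl B u x) = (-(u ⬝ᵥ u)) • x := by
  have h := hB.cl_cl u u x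
  have : (2 : ℝ) • cl B u (cl B u x) = (2 : ℝ) • (-(u ⬝ᵥ u)) • x := by
    rw [two_smul, h, smul_smul]; congr 1; ring
  exact smul_right_injective X (two_ne_zero' ℝ) this

theorem IsClifford.cl_anti {B : Fin 7 → X →ₗ[ℝ] X} (hB : IsClifford B) {u v : Fin 7 → ℝ}
    (h : u ⬝ᵥ v = 0) (x : X) : cl B u (cl B v x) = -cl B v (cl B u x) := by
  have := hB.cl_cl u v x
  rw [h, mul_zero, zero_smul] at this
  exact eq_neg_of_add_eq_zero_left this

/-- An inner product for which Clifford multiplication is skew-symmetric. -/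
structure IsInvariantForm (B : Fin 7 → X →ₗ[ℝ] X) (g : LinearMap.BilinForm ℝ X) : Prop where
  symm : ∀ x y, g x y = g y x
  pos : ∀ x, x ≠ 0 → 0 < g x x
  skew : ∀ a x y, g (B a x) y = -g x (B a y)

theorem exists_posDef_form [FiniteDimensional ℝ X] :
    ∃ g : LinearMap.BilinForm ℝ X, (∀ x y, g x y = g y x) ∧ ∀ x, x ≠ 0 → 0 < g x x := by
  let b := finBasis ℝ X
  refine ⟨∑ i, LinearMap.BilinForm.linMulLin (b.coord i) (b.coord i), fun x y => ?_,
    fun x hx => ?_⟩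
  · simp [LinearMap.sum_apply, LinearMap.BilinForm.linMulLin_apply, mul_comm]
  · have h0 : ∀ i, 0 ≤ b.coord i x * b.coord i x := fun i => mul_self_nonneg _
    simp only [LinearMap.sum_apply, LinearMap.BilinForm.linMulLin_apply]
    refine lt_of_le_of_ne (Finset.sum_nonneg fun i _ => h0 i) fun h => hx ?_
    have := (Finset.sum_eq_zero_iff_of_nonneg fun i _ => h0 i).1 h.symm
    refine b.ext_elem fun i => ?_
    simpa using this i (Finset.mem_univ i)

theorem IsClifford.exists_invariantForm [FiniteDimensional ℝ X] {B : Fin 7 → X →ₗ[ℝ] X}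
    (hB : IsClifford B) : ∃ g, IsInvariantForm B g := by
  -- Averaging over one generator at a time: $g+g(B_c\cdot,B_c\cdot)$ is $B_c$-invariant because
  -- $B_c^2=-1$, and it keeps the earlier invariances because $B_a$ and $B_c$ anticommute.
  have key : ∀ n : ℕ, ∃ g : LinearMap.BilinForm ℝ X, (∀ x y, g x y = g y x) ∧
      (∀ x, x ≠ 0 → 0 < g x x) ∧ ∀ a : Fin 7, a.val < n → ∀ x y, g (B a x) (B a y) = g x y := by
    intro n
    induction n with
    | zero =>
      obtain ⟨g, h1, h2⟩ := exists_posDef_form (X := X)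
      exact ⟨g, h1, h2, by simp⟩
    | succ n ih =>
      obtain ⟨g, h1, h2, h3⟩ := ih
      by_cases hn : n < 7
      · let c : Fin 7 := ⟨n, hn⟩
        refine ⟨g + g.compl₁₂ (B c) (B c), fun x y => ?_, fun x hx => ?_, fun a ha x y => ?_⟩
        · simp [h1 x, h1 (B c x)]
        · have : 0 ≤ g (B c x) (B c x) := by
            by_cases h : B c x = 0
            · simp [h]
            · exact (h2 _ h).le
          simpa using add_pos_of_pos_of_nonneg (h2 x hx) this
        · simp only [LinearMap.add_apply, LinearMap.compl₁₂_apply]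
          by_cases hac : a = c
          · subst hac
            rw [hB.sq, hB.sq]; simp [add_comm]
          · have : a.val < n := by
              have : a.val ≠ n := fun h => hac (Fin.ext h)
              omega
            rw [hB.anti (Ne.symm hac) x, hB.anti (Ne.symm hac) y, h3 a this]
            simp [h3 a this]
      · exact ⟨g, h1, h2, fun a _ => h3 a (by omega)⟩
  obtain ⟨g, h1, h2, h3⟩ := key 7
  refine ⟨g, h1, h2, fun a x y => ?_⟩
  rw [← h3 a a.2 (B a x) y, hB.sq]; simp

section Form

variable {B : Fin 7 → X →ₗ[ℝ] X} {g : LinearMap.BilinForm ℝ X}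

theorem IsInvariantForm.cl_skew (hg : IsInvariantForm B g) (u : Fin 7 → ℝ) (x y : X) :
    g (cl B u x) y = -g x (cl B u y) := by
  simp [cl_apply, LinearMap.sum_apply, hg.skew]

theorem IsInvariantForm.form_cl_self (hg : IsInvariantForm B g) (u : Fin 7 → ℝ) (x : X) :
    g x (cl B u x) = 0 := by
  have := hg.cl_skew u x x
  rw [hg.symm] at this
  linarith

theorem IsInvariantForm.form_cl_cl (hB : IsClifford B) (hg : IsInvariantForm B g)
    (u v : Fin 7 → ℝ) (x : X) : g (cl B u x) (cl B v x) = (u ⬝ᵥ v) * g x x := by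
  have h1 := hg.cl_skew u x (cl B v x)
  have h2 := hg.cl_skew v x (cl B u x)
  have h3 := congrArg (g x) (hB.cl_cl u v x)
  rw [hg.symm] at h2
  simp only [map_add, map_smul, smul_eq_mul] at h3
  linarith

theorem IsInvariantForm.form_cl_same (hB : IsClifford B) (hg : IsInvariantForm B g)
    (u : Fin 7 → ℝ) (x y : X) : g (cl B u x) (cl B u y) = (u ⬝ᵥ u) * g x y := by
  rw [hg.cl_skew, hB.cl_self]; simp

/-- If $v\cdot e=-te$, applying $v$ again gives $t^2=-|v|^2$. -/
theorem IsClifford.cl_eq_smul {B : Fin 7 → X →ₗ[ℝ] X} (hB : IsClifford B) {e : X} (he : e ≠ 0)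
    {v : Fin 7 → ℝ} {t : ℝ} (h : t • e + cl B v e = 0) : t = 0 ∧ v = 0 := by
  have h1 : cl B v e = (-t) • e := by
    rw [neg_smul]; exact eq_neg_of_add_eq_zero_right h
  have h2 := hB.cl_self v e
  rw [h1, map_smul, h1, smul_smul] at h2
  have h3 := smul_left_injective ℝ he h2
  have h0 : 0 ≤ v ⬝ᵥ v := by
    simpa [dotProduct] using Finset.sum_nonneg fun i _ => mul_self_nonneg (v i)
  have ht : t = 0 := by nlinarith [mul_self_nonneg t]
  refine ⟨ht, dotProduct_self_eq_zero.1 ?_⟩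
  rw [ht] at h3; linarith

theorem IsClifford.cl_injective (hB : IsClifford B) {e : X} (he : e ≠ 0)
    {v w : Fin 7 → ℝ} (h : cl B v e = cl B w e) : v = w := by
  refine sub_eq_zero.1 (hB.cl_eq_smul he (t := 0) (v := v - w) ?_).2
  simp [h]

/-- The map $(t,v)\mapsto te+v\cdot e$ is injective between spaces of dimension $1+7$ and $8$. This
is what identifies spinors with octonions once $e$ is chosen. -/
theorem IsClifford.exists_eq [FiniteDimensional ℝ X] (hX : finrank ℝ X = 8)
    (hB : IsClifford B) {e : X} (he : e ≠ 0) (x : X) :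
    ∃ (t : ℝ) (v : Fin 7 → ℝ), x = t • e + cl B v e := by
  let f : (ℝ × (Fin 7 → ℝ)) →ₗ[ℝ] X :=
    (LinearMap.toSpanSingleton ℝ X e).coprod ((LinearMap.applyₗ e).comp (cl B))
  have hf : ∀ t v, f (t, v) = t • e + cl B v e := fun t v => by simp [f]
  have hinj : Function.Injective f := by
    refine (injective_iff_map_eq_zero f).2 fun ⟨t, v⟩ h => ?_
    rw [hf] at h
    obtain ⟨h1, h2⟩ := hB.cl_eq_smul he h
    rw [h1, h2]; rfl
  have hsurj := (LinearMap.injective_iff_surjective_of_finrank_eq_finrank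
    (by rw [hX]; simp)).1 hinj
  obtain ⟨⟨t, v⟩, h⟩ := hsurj x
  exact ⟨t, v, by rw [← hf, h]⟩

/-- The component of $u\cdot v\cdot e$ along $e$ is measured by $g(e,u\cdot v\cdot e)=-g(u\cdot
e,v\cdot e)=-\langle u,v\rangle g(e,e)=0$. The vector $w$ is the cross product $u\times v$ defined
by $e$. -/
theorem IsClifford.exists_cross [FiniteDimensional ℝ X] (hX : finrank ℝ X = 8)
    (hB : IsClifford B) {e : X} (he : e ≠ 0) {u v : Fin 7 → ℝ} (h : u ⬝ᵥ v = 0) :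
    ∃ w, cl B u (cl B v e) = cl B w e := by
  obtain ⟨g, hg⟩ := hB.exists_invariantForm
  obtain ⟨t, w, hw⟩ := hB.exists_eq hX he (cl B u (cl B v e))
  have h1 := congrArg (g e) hw
  have h2 := hg.cl_skew u e (cl B v e)
  rw [hg.form_cl_cl hB, h, zero_mul, hw] at h2
  simp only [map_add, map_smul, hg.form_cl_self, smul_eq_mul] at h2
  have ht : t = 0 := by
    have := (hg.pos e he).ne'
    simpa [this] using h2
  exact ⟨w, by rw [hw, ht, zero_smul, zero_add]⟩

end Form

/-! ### Octonionic frames -/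

/-- `B` and `e` satisfy the relations of a standard basis of the octonions. -/
structure Adapted (B : Fin 7 → X →ₗ[ℝ] X) (e : X) : Prop where
  rel₄ : B 6 (B 5 e) = B 4 e
  rel₂ : B 6 (B 3 e) = B 2 e
  rel₁ : B 5 (B 3 e) = B 1 e
  rel₀ : B 4 (B 3 e) = B 0 e

/-- The generators in a rotated frame, whose vectors are the rows of `R`. -/
def rot (B : Fin 7 → X →ₗ[ℝ] X) (R : Matrix (Fin 7) (Fin 7) ℝ) (a : Fin 7) : X →ₗ[ℝ] X :=
  cl B (R a)

theorem IsClifford.isClifford_rot {B : Fin 7 → X →ₗ[ℝ] X} (hB : IsClifford B)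
    {R : Matrix (Fin 7) (Fin 7) ℝ} (hR : R * Rᵀ = 1) : IsClifford (rot B R) := by
  intro a b x
  have h : R a ⬝ᵥ R b = (1 : Matrix (Fin 7) (Fin 7) ℝ) a b := by rw [← hR]; rfl
  change cl B (R a) (cl B (R b) x) + cl B (R b) (cl B (R a) x) = _
  rw [hB.cl_cl, h, one_apply]
  split_ifs <;> simp

/-- Cayley-Dickson doubling: $u_6,u_5,u_4$ are the imaginary units of a quaternion subalgebra, and
$u_2,u_1,u_0$ are their products with a further unit $u_3$. All orthogonality relations are read off
from inner products of the spinors $u_i\cdot e$, using that Clifford multiplication by a unit vector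
is an isometry. -/
theorem IsClifford.exists_adapted [FiniteDimensional ℝ X] (hX : finrank ℝ X = 8)
    {B : Fin 7 → X →ₗ[ℝ] X} (hB : IsClifford B) {e : X} (he : e ≠ 0)
    {u₆ u₅ u₄ u₃ : Fin 7 → ℝ} (h66 : u₆ ⬝ᵥ u₆ = 1) (h55 : u₅ ⬝ᵥ u₅ = 1) (h33 : u₃ ⬝ᵥ u₃ = 1)
    (h65 : u₆ ⬝ᵥ u₅ = 0) (h63 : u₆ ⬝ᵥ u₃ = 0) (h53 : u₅ ⬝ᵥ u₃ = 0)
    (hu₄ : cl B u₆ (cl B u₅ e) = cl B u₄ e) (h43 : u₄ ⬝ᵥ u₃ = 0) :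
    ∃ R : Matrix (Fin 7) (Fin 7) ℝ, R * Rᵀ = 1 ∧ R 6 = u₆ ∧ R 5 = u₅ ∧ R 4 = u₄ ∧ R 3 = u₃ ∧
      Adapted (rot B R) e := by
  obtain ⟨g, hg⟩ := hB.exists_invariantForm
  obtain ⟨u₂, hu₂⟩ := hB.exists_cross hX he h63
  obtain ⟨u₁, hu₁⟩ := hB.exists_cross hX he h53
  obtain ⟨u₀, hu₀⟩ := hB.exists_cross hX he h43
  have hge := hg.pos e he
  have dot : ∀ {u v : Fin 7 → ℝ} {t : ℝ}, g (cl B u e) (cl B v e) = t * g e e → u ⬝ᵥ v = t := by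
    intro u v t h
    rw [hg.form_cl_cl hB] at h
    exact mul_right_cancel₀ hge.ne' h
  have dot0 : ∀ {u v : Fin 7 → ℝ}, g (cl B u e) (cl B v e) = 0 → u ⬝ᵥ v = 0 := by
    intro u v h
    exact dot (by rw [h, zero_mul])
  have c65 := hB.cl_anti h65
  have c63 := hB.cl_anti h63
  have c53 := hB.cl_anti h53
  have s6 : ∀ x, cl B u₆ (cl B u₆ x) = -x := fun x => by rw [hB.cl_self, h66]; simp
  have s5 : ∀ x, cl B u₅ (cl B u₅ x) = -x := fun x => by rw [hB.cl_self, h55]; simp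
  have same : ∀ {u : Fin 7 → ℝ}, u ⬝ᵥ u = 1 → ∀ x y, g (cl B u x) (cl B u y) = g x y := by
    intro u hu x y
    rw [hg.form_cl_same hB, hu, one_mul]
  have h44 : u₄ ⬝ᵥ u₄ = 1 := dot (by rw [← hu₄, same h66, same h55, one_mul])
  have h64 : u₆ ⬝ᵥ u₄ = 0 := dot0 (by rw [← hu₄, same h66, hg.form_cl_self])
  have h54 : u₅ ⬝ᵥ u₄ = 0 :=
    dot0 (by rw [← hu₄, c65, map_neg, same h55, hg.form_cl_self, neg_zero])
  have c64 := hB.cl_anti h64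
  have c54 := hB.cl_anti h54
  have c43 := hB.cl_anti h43
  have e64 : cl B u₆ (cl B u₄ e) = -cl B u₅ e := by rw [← hu₄, s6]
  have e54 : cl B u₅ (cl B u₄ e) = cl B u₆ e := by rw [← hu₄, c65, map_neg, s5, neg_neg]
  have z63 : g (cl B u₆ e) (cl B u₃ e) = 0 := by rw [hg.form_cl_cl hB, h63, zero_mul]
  have z53 : g (cl B u₅ e) (cl B u₃ e) = 0 := by rw [hg.form_cl_cl hB, h53, zero_mul]
  have z43 : g (cl B u₄ e) (cl B u₃ e) = 0 := by rw [hg.form_cl_cl hB, h43, zero_mul]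
  have z65 : g (cl B u₆ e) (cl B u₅ e) = 0 := by rw [hg.form_cl_cl hB, h65, zero_mul]
  have z64 : g (cl B u₆ e) (cl B u₄ e) = 0 := by rw [hg.form_cl_cl hB, h64, zero_mul]
  have z54 : g (cl B u₅ e) (cl B u₄ e) = 0 := by rw [hg.form_cl_cl hB, h54, zero_mul]
  have h22 : u₂ ⬝ᵥ u₂ = 1 := dot (by rw [← hu₂, same h66, same h33, one_mul])
  have h11 : u₁ ⬝ᵥ u₁ = 1 := dot (by rw [← hu₁, same h55, same h33, one_mul])
  have h00 : u₀ ⬝ᵥ u₀ = 1 := dot (by rw [← hu₀, same h44, same h33, one_mul])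
  have h62 : u₆ ⬝ᵥ u₂ = 0 := dot0 (by rw [← hu₂, same h66, hg.form_cl_self])
  have h32 : u₃ ⬝ᵥ u₂ = 0 :=
    dot0 (by rw [← hu₂, c63, map_neg, same h33, hg.form_cl_self, neg_zero])
  have h52 : u₅ ⬝ᵥ u₂ = 0 :=
    dot0 (by rw [← hu₂, ← neg_eq_zero, ← hg.cl_skew, hu₄, z43])
  have h42 : u₄ ⬝ᵥ u₂ = 0 := dot0 (by rw [← hu₂, ← hu₄, same h66, z53])
  have h51 : u₅ ⬝ᵥ u₁ = 0 := dot0 (by rw [← hu₁, same h55, hg.form_cl_self])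
  have h31 : u₃ ⬝ᵥ u₁ = 0 :=
    dot0 (by rw [← hu₁, c53, map_neg, same h33, hg.form_cl_self, neg_zero])
  have h61 : u₆ ⬝ᵥ u₁ = 0 :=
    dot0 (by rw [← hu₁, ← neg_eq_zero, ← hg.cl_skew, ← neg_eq_zero, ← LinearMap.neg_apply,
      ← map_neg, ← c65, hu₄, z43])
  have h41 : u₄ ⬝ᵥ u₁ = 0 :=
    dot0 (by rw [← hu₁, ← hu₄, c65, map_neg, LinearMap.neg_apply, same h55, z63, neg_zero])
  have h21 : u₂ ⬝ᵥ u₁ = 0 :=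
    dot0 (by rw [← hu₂, ← hu₁, c63, c53, map_neg, map_neg, LinearMap.neg_apply, same h33, z65,
      neg_zero, neg_zero])
  have h40 : u₄ ⬝ᵥ u₀ = 0 := dot0 (by rw [← hu₀, same h44, hg.form_cl_self])
  have h30 : u₃ ⬝ᵥ u₀ = 0 :=
    dot0 (by rw [← hu₀, c43, map_neg, same h33, hg.form_cl_self, neg_zero])
  have h60 : u₆ ⬝ᵥ u₀ = 0 :=
    dot0 (by rw [← hu₀, ← neg_eq_zero, ← hg.cl_skew, ← neg_eq_zero, ← LinearMap.neg_apply,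
      ← map_neg, ← c64, e64, map_neg, LinearMap.neg_apply, z53, neg_zero])
  have h50 : u₅ ⬝ᵥ u₀ = 0 :=
    dot0 (by rw [← hu₀, ← neg_eq_zero, ← hg.cl_skew, ← neg_eq_zero, ← LinearMap.neg_apply,
      ← map_neg, ← c54, e54, z63])
  have h20 : u₂ ⬝ᵥ u₀ = 0 :=
    dot0 (by rw [← hu₂, ← hu₀, c63, c43, map_neg, map_neg, LinearMap.neg_apply, same h33, z64,
      neg_zero, neg_zero])
  have h10 : u₁ ⬝ᵥ u₀ = 0 :=
    dot0 (by rw [← hu₁, ← hu₀, c53, c43, map_neg, map_neg, LinearMap.neg_apply, same h33, z54,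
      neg_zero, neg_zero])
  refine ⟨of ![u₀, u₁, u₂, u₃, u₄, u₅, u₆], ?_, rfl, rfl, rfl, rfl, hu₄, hu₂, hu₁, hu₀⟩
  have comm : ∀ {u v : Fin 7 → ℝ}, u ⬝ᵥ v = 0 → v ⬝ᵥ u = 0 := fun h => by rwa [dotProduct_comm]
  ext a b
  change ![u₀, u₁, u₂, u₃, u₄, u₅, u₆] a ⬝ᵥ ![u₀, u₁, u₂, u₃, u₄, u₅, u₆] b = _
  fin_cases a <;> fin_cases b <;> first | assumption | (apply comm; assumption)

/-- Signs in the multiplication table of the octonions. -/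
def octSign : Matrix (Fin 7) (Fin 7) ℝ :=
  !![0, 1, -1, -1, 1, 1, -1; -1, 0, 1, -1, -1, 1, 1; 1, -1, 0, -1, 1, -1, 1;
    1, 1, 1, 0, -1, -1, -1; -1, 1, -1, 1, 0, -1, 1; -1, -1, 1, 1, 1, 0, -1;
    1, -1, -1, 1, -1, 1, 0]

/-- Products of distinct units in the multiplication table of the octonions. -/
def octThird : Matrix (Fin 7) (Fin 7) (Fin 7) :=
  !![0, 6, 5, 4, 3, 2, 1; 6, 0, 4, 5, 2, 3, 0; 5, 4, 0, 6, 1, 0, 3; 4, 5, 6, 0, 0, 1, 2;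
    3, 2, 1, 0, 0, 6, 5; 2, 3, 0, 1, 6, 0, 4; 1, 0, 3, 2, 5, 4, 0]

/-- By the adapted relations $B_4e,B_2e,B_1e,B_0e$ are words in $B_6,B_5,B_3$ applied to $e$. Moving
generators inward until they meet $e$, and ordering the words, therefore computes every product. -/
theorem Adapted.mul_apply {B : Fin 7 → X →ₗ[ℝ] X} (hB : IsClifford B) {e : X} (h : Adapted B e)
    {a b : Fin 7} (hab : a ≠ b) : B a (B b e) = octSign a b • B (octThird a b) e := by
  have r4 := h.rel₄.symm
  have r2 := h.rel₂.symm
  have r1 := h.rel₁.symm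
  have a56 := hB.anti (show (5 : Fin 7) ≠ 6 by decide)
  have a36 := hB.anti (show (3 : Fin 7) ≠ 6 by decide)
  have a35 := hB.anti (show (3 : Fin 7) ≠ 5 by decide)
  have a46 := hB.anti (show (4 : Fin 7) ≠ 6 by decide)
  have a45 := hB.anti (show (4 : Fin 7) ≠ 5 by decide)
  have a43 := hB.anti (show (4 : Fin 7) ≠ 3 by decide)
  have a26 := hB.anti (show (2 : Fin 7) ≠ 6 by decide)
  have a25 := hB.anti (show (2 : Fin 7) ≠ 5 by decide)
  have a23 := hB.anti (show (2 : Fin 7) ≠ 3 by decide)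
  have a16 := hB.anti (show (1 : Fin 7) ≠ 6 by decide)
  have a15 := hB.anti (show (1 : Fin 7) ≠ 5 by decide)
  have a13 := hB.anti (show (1 : Fin 7) ≠ 3 by decide)
  have a06 := hB.anti (show (0 : Fin 7) ≠ 6 by decide)
  have a05 := hB.anti (show (0 : Fin 7) ≠ 5 by decide)
  have a03 := hB.anti (show (0 : Fin 7) ≠ 3 by decide)
  have s6 := hB.sq 6
  have s5 := hB.sq 5
  have s3 := hB.sq 3
  have r0 : B 0 e = -B 6 (B 5 (B 3 e)) := by
    rw [← h.rel₀, a43, ← h.rel₄, a36, a35]; simp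
  revert hab
  fin_cases a <;> fin_cases b <;> intro hab <;>
    first
    | exact absurd rfl hab
    | (simp only [octSign, octThird, of_apply, cons_val, Fin.mk_zero, Fin.mk_one, Fin.reduceFinMk,
        Fin.isValue, one_smul, neg_smul, r4, r2, r1, r0, a56, a36, a35, a46, a45, a43,
        a26, a25, a23, a16, a15, a13, a06, a05, a03, s6, s5, s3, map_neg, neg_neg])

/-! ### The spin action and stabilizers of spinors and vectors -/

variable {X : Type*} [AddCommGroup X] [Module ℝ X]

/-- The action of a matrix on a Clifford module. -/
def act (B : Fin 7 → X →ₗ[ℝ] X) (F : Matrix (Fin 7) (Fin 7) ℝ) (x : X) : X :=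
  ∑ a, ∑ b, F a b • B a (B b x)

theorem sum_conj_smul {M m n : Type*} [AddCommGroup M] [Module ℝ M] [Fintype m] [Fintype n]
    (P : Matrix m n ℝ) (F : Matrix n n ℝ) (f : m → m → M) :
    ∑ a, ∑ b, (P * F * Pᵀ) a b • f a b = ∑ c, ∑ d, F c d • ∑ a, ∑ b, (P a c * P b d) • f a b := by
  have h : ∀ a b, (P * F * Pᵀ) a b = ∑ c, ∑ d, P a c * F c d * P b d := by
    intro a b
    simp only [Matrix.mul_apply, transpose_apply, Finset.sum_mul]
    rw [Finset.sum_comm]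
  simp only [h, Finset.sum_smul, Finset.smul_sum, smul_smul]
  calc _ = ∑ a, ∑ c, ∑ b, ∑ d, (P a c * F c d * P b d) • f a b :=
        Finset.sum_congr rfl fun a _ => Finset.sum_comm
    _ = ∑ c, ∑ a, ∑ b, ∑ d, (P a c * F c d * P b d) • f a b := Finset.sum_comm
    _ = ∑ c, ∑ a, ∑ d, ∑ b, (P a c * F c d * P b d) • f a b :=
        Finset.sum_congr rfl fun c _ => Finset.sum_congr rfl fun a _ => Finset.sum_comm
    _ = ∑ c, ∑ d, ∑ a, ∑ b, (P a c * F c d * P b d) • f a b :=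
        Finset.sum_congr rfl fun c _ => Finset.sum_comm
    _ = _ := by
        refine Finset.sum_congr rfl fun c _ => Finset.sum_congr rfl fun d _ =>
          Finset.sum_congr rfl fun a _ => Finset.sum_congr rfl fun b _ => ?_
        congr 1; ring

theorem act_rot (B : Fin 7 → X →ₗ[ℝ] X) {R : Matrix (Fin 7) (Fin 7) ℝ} (hR : R * Rᵀ = 1)
    (F : Matrix (Fin 7) (Fin 7) ℝ) (x : X) : act (rot B R) (R * F * Rᵀ) x = act B F x := by
  have hR' : Rᵀ * R = 1 := mul_eq_one_comm.1 hR
  have h1 : ∀ c y, ∑ a, R a c • rot B R a y = B c y := by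
    intro c y
    have h : ∀ b, ∑ a, R a c * R a b = (1 : Matrix (Fin 7) (Fin 7) ℝ) c b := by
      intro b; rw [← hR']; rfl
    simp only [rot, cl_apply, Finset.smul_sum, smul_smul]
    rw [Finset.sum_comm]
    simp only [← Finset.sum_smul, h, one_apply, ite_smul, one_smul, zero_smul, Finset.sum_ite_eq,
      Finset.mem_univ, if_true]
  rw [act, sum_conj_smul]
  refine Finset.sum_congr rfl fun c _ => Finset.sum_congr rfl fun d _ => ?_
  congr 1
  simp only [← h1 c, ← h1 d x, map_sum, map_smul, Finset.smul_sum, smul_smul]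

/-- Spin action and rotation of vectors are compatible: $[B_aB_b,v]=2v_aB_b-2v_bB_a$, and after
contraction with a skew $F$ both terms contribute $-2\,Fv$. -/
theorem IsClifford.act_cl {B : Fin 7 → X →ₗ[ℝ] X} (hB : IsClifford B)
    {F : Matrix (Fin 7) (Fin 7) ℝ} (hF : Fᵀ = -F) (v : Fin 7 → ℝ) (x : X) :
    act B F (cl B v x) = cl B v (act B F x) - (4 : ℝ) • cl B (F *ᵥ v) x := by
  have hs : ∀ a b, F b a = -F a b := fun a b => congrFun (congrFun hF a) b
  have h1 : ∀ a b, B a (B b (cl B v x)) =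
      cl B v (B a (B b x)) + ((2 * v a) • B b x - (2 * v b) • B a x) := by
    intro a b
    have h2 := hB.cl_cl (Pi.single b 1) v x
    have h3 := hB.cl_cl (Pi.single a 1) v (B b x)
    simp only [cl_single, single_one_dotProduct] at h2 h3
    rw [eq_sub_of_add_eq h2, map_sub, map_smul, eq_sub_of_add_eq h3]
    module
  have h4 : cl B (F *ᵥ v) x = ∑ a, ∑ b, (F a b * v b) • B a x := by
    rw [cl_apply]
    simp only [mulVec, dotProduct, Finset.sum_smul]
  have h5 : ∑ a, ∑ b, (F a b * v a) • B b x = -∑ a, ∑ b, (F a b * v b) • B a x := by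
    rw [Finset.sum_comm, ← Finset.sum_neg_distrib]
    refine Finset.sum_congr rfl fun a _ => ?_
    rw [← Finset.sum_neg_distrib]
    refine Finset.sum_congr rfl fun b _ => ?_
    rw [hs, neg_mul, neg_smul]
  have h6 : act B F (cl B v x) = cl B v (act B F x) +
      ((2 : ℝ) • ∑ a, ∑ b, (F a b * v a) • B b x - (2 : ℝ) • ∑ a, ∑ b, (F a b * v b) • B a x) := by
    simp only [act, h1, map_sum, map_smul, Finset.smul_sum, ← Finset.sum_sub_distrib,
      ← Finset.sum_add_distrib]
    refine Finset.sum_congr rfl fun a _ => Finset.sum_congr rfl fun b _ => ?_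
    module
  rw [h6, h5, h4]
  module

/-- The matrices that annihilate `e` and the vectors in `U`. -/
def stabilizer (B : Fin 7 → X →ₗ[ℝ] X) (e : X) (U : Submodule ℝ (Fin 7 → ℝ)) :
    Set (Matrix (Fin 7) (Fin 7) ℝ) :=
  {F | Fᵀ = -F ∧ act B F e = 0 ∧ ∀ u ∈ U, F *ᵥ u = 0}

theorem IsClifford.act_cl_eq_zero {B : Fin 7 → X →ₗ[ℝ] X} (hB : IsClifford B) {e : X}
    (he : e ≠ 0) {F : Matrix (Fin 7) (Fin 7) ℝ} (hF : Fᵀ = -F) (h : act B F e = 0)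
    (v : Fin 7 → ℝ) : act B F (cl B v e) = 0 ↔ F *ᵥ v = 0 := by
  rw [hB.act_cl hF, h, map_zero, zero_sub, neg_eq_zero, smul_eq_zero]
  constructor
  · rintro (h | h)
    · norm_num at h
    · exact hB.cl_injective he (by rw [h, map_zero, LinearMap.zero_apply])
  · intro h; right; rw [h, map_zero, LinearMap.zero_apply]

/-- If $F$ kills $e$, it acts as a derivation of the cross product defined by $e$, so its kernel is
closed under that product. -/
theorem IsClifford.mulVec_cross {B : Fin 7 → X →ₗ[ℝ] X} (hB : IsClifford B) {e : X}
    (he : e ≠ 0) {F : Matrix (Fin 7) (Fin 7) ℝ} (hF : Fᵀ = -F) (h : act B F e = 0)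
    {u v w : Fin 7 → ℝ} (huv : cl B u (cl B v e) = cl B w e) (hu : F *ᵥ u = 0)
    (hv : F *ᵥ v = 0) : F *ᵥ w = 0 := by
  rw [← hB.act_cl_eq_zero he hF h, ← huv, hB.act_cl hF, (hB.act_cl_eq_zero he hF h v).2 hv, hu]
  simp

/-- The standard stabilizers of a spinor and `j` vectors. -/
def model (j : ℕ) : Set (Matrix (Fin 7) (Fin 7) ℝ) :=
  {F | Fᵀ = -F ∧
    (∀ k, ∑ a, ∑ b, (if octThird a b = k then F a b * octSign a b else 0) = 0) ∧
    (1 ≤ j → F *ᵥ Pi.single 6 1 = 0) ∧ (2 ≤ j → F *ᵥ Pi.single 5 1 = 0)}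

/-- $F\cdot e$ is expanded in the independent spinors $B_ke$ by the octonion table. The diagonal
entries of `octThird` are fillers: there `octSign` and $F$ both vanish. -/
theorem Adapted.act_eq_zero {B : Fin 7 → X →ₗ[ℝ] X} (hB : IsClifford B) {e : X} (he : e ≠ 0)
    (h : Adapted B e) {F : Matrix (Fin 7) (Fin 7) ℝ} (hF : Fᵀ = -F) :
    act B F e = 0 ↔
      ∀ k, ∑ a, ∑ b, (if octThird a b = k then F a b * octSign a b else 0) = 0 := by
  have h1 : act B F e = cl B (fun k => ∑ a, ∑ b,
      (if octThird a b = k then F a b * octSign a b else 0)) e := by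
    rw [cl_apply]
    simp only [Finset.sum_smul, ite_smul, zero_smul]
    rw [Finset.sum_comm]
    refine Finset.sum_congr rfl fun a _ => ?_
    rw [Finset.sum_comm]
    refine Finset.sum_congr rfl fun b _ => ?_
    rw [Finset.sum_ite_eq, if_pos (Finset.mem_univ _)]
    by_cases hab : a = b
    · subst hab
      have : F a a = 0 := by
        have : F a a = -F a a := congrFun (congrFun hF a) a
        linarith
      simp [this]
    · rw [h.mul_apply hB hab, smul_smul]
  rw [h1]
  constructor
  · intro h2 k
    exact congrFun (hB.cl_injective he (w := 0) (by simpa using h2)) k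
  · intro h2
    have : (fun k => ∑ a, ∑ b, (if octThird a b = k then F a b * octSign a b else 0)) =
        (0 : Fin 7 → ℝ) := funext h2
    rw [this]; simp

theorem conj_mem_model {B : Fin 7 → X →ₗ[ℝ] X} (hB : IsClifford B) {e : X} (he : e ≠ 0)
    {R : Matrix (Fin 7) (Fin 7) ℝ} (hR : R * Rᵀ = 1) (h : Adapted (rot B R) e) (j : ℕ)
    (F : Matrix (Fin 7) (Fin 7) ℝ) :
    R * F * Rᵀ ∈ model j ↔ Fᵀ = -F ∧ act B F e = 0 ∧ (1 ≤ j → F *ᵥ R 6 = 0) ∧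
      (2 ≤ j → F *ᵥ R 5 = 0) := by
  have hR' : Rᵀ * R = 1 := mul_eq_one_comm.1 hR
  have hinv : ∀ {n : ℕ} (G H : Matrix (Fin 7) (Fin n) ℝ), R * G = R * H ↔ G = H := by
    refine fun G H => ⟨fun h => ?_, fun h => by rw [h]⟩
    rw [← Matrix.one_mul G, ← Matrix.one_mul H, ← hR', Matrix.mul_assoc, h, Matrix.mul_assoc]
  have hinvr : ∀ (G H : Matrix (Fin 7) (Fin 7) ℝ), G * Rᵀ = H * Rᵀ ↔ G = H := by
    refine fun G H => ⟨fun h => ?_, fun h => by rw [h]⟩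
    rw [← Matrix.mul_one G, ← Matrix.mul_one H, ← hR', ← Matrix.mul_assoc, h, Matrix.mul_assoc]
  have hsk : (R * F * Rᵀ)ᵀ = -(R * F * Rᵀ) ↔ Fᵀ = -F := by
    rw [transpose_mul, transpose_mul, transpose_transpose, ← Matrix.mul_assoc, ← Matrix.neg_mul,
      hinvr, ← Matrix.mul_neg, hinv]
  have hcol : ∀ i, (R * F * Rᵀ) *ᵥ Pi.single i 1 = 0 ↔ F *ᵥ R i = 0 := by
    intro i
    have h1 : Rᵀ *ᵥ Pi.single i 1 = R i := by ext k; simp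
    rw [← mulVec_mulVec, h1, ← mulVec_mulVec]
    refine ⟨fun h => ?_, fun h => by rw [h, mulVec_zero]⟩
    rw [← one_mulVec (F *ᵥ R i), ← hR', ← mulVec_mulVec, h, mulVec_zero]
  simp only [model, Set.mem_ofPred_eq, hsk, hcol]
  refine and_congr_right fun hF => and_congr_left fun _ => ?_
  rw [← h.act_eq_zero (hB.isClifford_rot hR) he (hsk.2 hF), act_rot B hR]

/-- Fewer than $\dim U$ linear conditions leave a nonzero vector of $U$, which is then normalized.
-/
theorem exists_unit_orthogonal (U : Submodule ℝ (Fin 7 → ℝ)) {k : ℕ} (s : Fin k → Fin 7 → ℝ)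
    (h : k < finrank ℝ U) : ∃ u ∈ U, u ⬝ᵥ u = 1 ∧ ∀ i, s i ⬝ᵥ u = 0 := by
  have hk := LinearMap.ker_ne_bot_of_finrank_lt
    (f := (Matrix.mulVecLin (of s)).comp U.subtype) (by simpa using h)
  obtain ⟨⟨u, huU⟩, hu, hu0⟩ := Submodule.exists_mem_ne_zero_of_ne_bot hk
  have hu0' : u ≠ 0 := fun h => hu0 (Subtype.ext h)
  have hpos : 0 < u ⬝ᵥ u := by
    refine lt_of_le_of_ne ?_ fun h => hu0' (dotProduct_self_eq_zero.1 h.symm)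
    simpa [dotProduct] using Finset.sum_nonneg fun i _ => mul_self_nonneg (u i)
  refine ⟨(Real.sqrt (u ⬝ᵥ u))⁻¹ • u, U.smul_mem _ huU, ?_, fun i => ?_⟩
  · rw [smul_dotProduct, dotProduct_smul, smul_eq_mul, smul_eq_mul, ← mul_assoc, ← mul_inv,
      Real.mul_self_sqrt hpos.le, inv_mul_cancel₀ hpos.ne']
  · rw [dotProduct_smul]
    have : s i ⬝ᵥ u = 0 := congrFun hu i
    rw [this, smul_zero]

section Stabilizer

variable [FiniteDimensional ℝ X] {B : Fin 7 → X →ₗ[ℝ] X} {e : X}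

theorem IsClifford.exists_frame (hX : finrank ℝ X = 8) (hB : IsClifford B) (he : e ≠ 0)
    {u v w : Fin 7 → ℝ} (hu : u ⬝ᵥ u = 1) (hv : v ⬝ᵥ v = 1) (huv : u ⬝ᵥ v = 0)
    (hw : cl B u (cl B v e) = cl B w e) (U : Submodule ℝ (Fin 7 → ℝ)) (hU : 3 < finrank ℝ U) :
    ∃ R : Matrix (Fin 7) (Fin 7) ℝ, R * Rᵀ = 1 ∧ R 6 = u ∧ R 5 = v ∧ R 4 = w ∧ R 3 ∈ U ∧
      Adapted (BPS.rot B R) e := by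
  obtain ⟨z, hzU, hz, hz'⟩ := exists_unit_orthogonal U ![u, v, w] hU
  obtain ⟨R, h1, h2, h3, h4, h5, h6⟩ :=
    hB.exists_adapted hX he hu hv hz huv (hz' 0) (hz' 1) hw (hz' 2)
  exact ⟨R, h1, h2, h3, h4, h5 ▸ hzU, h6⟩

theorem IsClifford.finrank_span_cross (hX : finrank ℝ X = 8) (hB : IsClifford B) (he : e ≠ 0)
    {u v w : Fin 7 → ℝ} (hu : u ⬝ᵥ u = 1) (hv : v ⬝ᵥ v = 1) (huv : u ⬝ᵥ v = 0)
    (hw : cl B u (cl B v e) = cl B w e) : finrank ℝ (Submodule.span ℝ {u, v, w}) = 3 := by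
  obtain ⟨R, hR, h6, h5, h4, -, -⟩ := hB.exists_frame hX he hu hv huv hw ⊤ (by simp)
  have hli : LinearIndependent ℝ R.row :=
    linearIndependent_rows_iff_isUnit.2 (isUnit_iff_exists_inv.2 ⟨_, hR⟩)
  have hinj : Function.Injective ![(6 : Fin 7), 5, 4] := by decide
  have h := finrank_span_eq_card (hli.comp _ hinj)
  have hr : Set.range (R.row ∘ ![(6 : Fin 7), 5, 4]) = {u, v, w} := by
    have : R.row ∘ ![(6 : Fin 7), 5, 4] = ![u, v, w] := by
      funext i
      fin_cases i
      exacts [h6, h5, h4]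
    rw [this]
    simp only [Matrix.range_cons, Matrix.range_empty, Set.union_empty, Set.singleton_union]
  rw [hr] at h
  simpa using h

/-- Killing $u$ and $v$ entails killing $w=u\times v$, so every $U$ between $\langle u,v\rangle$ and
$\langle u,v,w\rangle$ has the same stabilizer. -/
theorem IsClifford.stabilizer_two (hX : finrank ℝ X = 8) (hB : IsClifford B) (he : e ≠ 0)
    {U : Submodule ℝ (Fin 7 → ℝ)} {u v w : Fin 7 → ℝ} (hu : u ⬝ᵥ u = 1) (hv : v ⬝ᵥ v = 1)
    (huv : u ⬝ᵥ v = 0) (huU : u ∈ U) (hvU : v ∈ U) (hw : cl B u (cl B v e) = cl B w e)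
    (hU : U ≤ Submodule.span ℝ {u, v, w}) :
    ∃ R : Matrix (Fin 7) (Fin 7) ℝ, R * Rᵀ = 1 ∧ R 6 = u ∧ R 5 = v ∧
      ∀ F, F ∈ stabilizer B e U ↔ R * F * Rᵀ ∈ model 2 := by
  obtain ⟨R, hR, h6, h5, -, -, had⟩ := hB.exists_frame hX he hu hv huv hw ⊤ (by simp)
  refine ⟨R, hR, h6, h5, fun F => ?_⟩
  rw [conj_mem_model hB he hR had, h6, h5]
  refine and_congr_right fun hF => and_congr_right fun hFe =>
    ⟨fun h => ⟨fun _ => h u huU, fun _ => h v hvU⟩, fun h x hx => ?_⟩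
  have hFu := h.1 one_le_two
  have hFv := h.2 le_rfl
  have hle : Submodule.span ℝ {u, v, w} ≤ LinearMap.ker F.mulVecLin := by
    rw [Submodule.span_le]
    rintro y (rfl | rfl | rfl)
    · exact hFu
    · exact hFv
    · exact hB.mulVec_cross he hF hFe hw hFu hFv
  exact hle (hU hx)

theorem IsClifford.stabilizer_one (hX : finrank ℝ X = 8) (hB : IsClifford B) (he : e ≠ 0)
    {U : Submodule ℝ (Fin 7 → ℝ)} {u : Fin 7 → ℝ} (hu : u ⬝ᵥ u = 1)
    (hU : U = Submodule.span ℝ {u}) :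
    ∃ R : Matrix (Fin 7) (Fin 7) ℝ, R * Rᵀ = 1 ∧ R 6 = u ∧
      ∀ F, F ∈ stabilizer B e U ↔ R * F * Rᵀ ∈ model 1 := by
  obtain ⟨v, -, hv, huv⟩ := exists_unit_orthogonal ⊤ ![u] (by simp)
  obtain ⟨w, hw⟩ := hB.exists_cross hX he (huv 0)
  obtain ⟨R, hR, h6, h5, -, -, had⟩ := hB.exists_frame hX he hu hv (huv 0) hw ⊤ (by simp)
  refine ⟨R, hR, h6, fun F => ?_⟩
  rw [conj_mem_model hB he hR had, h6, hU]
  refine and_congr_right fun hF => and_congr_right fun hFe =>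
    ⟨fun h => ⟨fun _ => h u (Submodule.mem_span_singleton_self u), by simp⟩, fun h x hx => ?_⟩
  obtain ⟨t, rfl⟩ := Submodule.mem_span_singleton.1 hx
  rw [mulVec_smul, h.1 le_rfl, smul_zero]

theorem IsClifford.stabilizer_zero (hX : finrank ℝ X = 8) (hB : IsClifford B) (he : e ≠ 0)
    {U : Submodule ℝ (Fin 7 → ℝ)} (hU : U = ⊥) :
    ∃ R : Matrix (Fin 7) (Fin 7) ℝ, R * Rᵀ = 1 ∧
      ∀ F, F ∈ stabilizer B e U ↔ R * F * Rᵀ ∈ model 0 := by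
  obtain ⟨u, -, hu, -⟩ := exists_unit_orthogonal ⊤ (Fin.elim0 : Fin 0 → Fin 7 → ℝ) (by simp)
  obtain ⟨v, -, hv, huv⟩ := exists_unit_orthogonal ⊤ ![u] (by simp)
  obtain ⟨w, hw⟩ := hB.exists_cross hX he (huv 0)
  obtain ⟨R, hR, h6, h5, -, -, had⟩ := hB.exists_frame hX he hu hv (huv 0) hw ⊤ (by simp)
  refine ⟨R, hR, fun F => ?_⟩
  rw [conj_mem_model hB he hR had, hU]
  refine and_congr_right fun hF => and_congr_right fun hFe => ⟨by simp, fun _ x hx => ?_⟩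
  rw [(Submodule.mem_bot ℝ).1 hx, mulVec_zero]

/-- The kernel of $F$ contains $u,v,u\times v$ and something outside their span, hence also a unit
vector orthogonal to the three. Cross products of these four vectors fill $\mathbb R^7$. -/
theorem IsClifford.stabilizer_eq_zero (hX : finrank ℝ X = 8) (hB : IsClifford B) (he : e ≠ 0)
    {U : Submodule ℝ (Fin 7 → ℝ)} {u v w : Fin 7 → ℝ} (hu : u ⬝ᵥ u = 1) (hv : v ⬝ᵥ v = 1)
    (huv : u ⬝ᵥ v = 0) (huU : u ∈ U) (hvU : v ∈ U) (hw : cl B u (cl B v e) = cl B w e)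
    (hU : ¬ U ≤ Submodule.span ℝ {u, v, w}) {F : Matrix (Fin 7) (Fin 7) ℝ}
    (hF : F ∈ stabilizer B e U) : F = 0 := by
  obtain ⟨hF, hFe, hFU⟩ := hF
  have cross : ∀ {u v w}, cl B u (cl B v e) = cl B w e → F *ᵥ u = 0 → F *ᵥ v = 0 → F *ᵥ w = 0 :=
    fun h => hB.mulVec_cross he hF hFe h
  have hFw := cross hw (hFU u huU) (hFU v hvU)
  let K := LinearMap.ker F.mulVecLin
  have hUK : U ≤ K := fun x hx => hFU x hx
  have hK : 3 < finrank ℝ K := by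
    rw [← hB.finrank_span_cross hX he hu hv huv hw]
    refine Submodule.finrank_lt_finrank_of_lt (lt_of_le_of_ne ?_ fun h => hU (h ▸ hUK))
    rw [Submodule.span_le]
    rintro y (rfl | rfl | rfl)
    exacts [hFU _ huU, hFU _ hvU, hFw]
  obtain ⟨R, hR, h6, h5, h4, h3, had⟩ := hB.exists_frame hX he hu hv huv hw K hK
  have k6 : F *ᵥ R 6 = 0 := by rw [h6]; exact hFU u huU
  have k5 : F *ᵥ R 5 = 0 := by rw [h5]; exact hFU v hvU
  have k4 : F *ᵥ R 4 = 0 := by rw [h4]; exact hFw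
  have k3 : F *ᵥ R 3 = 0 := h3
  have k2 := cross had.rel₂ k6 k3
  have k1 := cross had.rel₁ k5 k3
  have k0 := cross had.rel₀ k4 k3
  have hall : ∀ i, F *ᵥ R i = 0 := by
    intro i
    fin_cases i <;> assumption
  have : F * Rᵀ = 0 := by
    ext a i
    exact congrFun (hall i) a
  rw [← Matrix.mul_one F, ← mul_eq_one_comm.1 hR, ← Matrix.mul_assoc, this, Matrix.zero_mul]

end Stabilizer

/-! ### Padding to seven dimensions and canonical forms -/

/-- The isometric embedding of `ℝ^d` in `ℝ^7` along the first coordinates. -/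
def pad (d : ℕ) : Matrix (Fin 7) (Fin d) ℝ := of fun a i => if a.val = i.val then 1 else 0

theorem pad_transpose_mul_pad {d : ℕ} (hd : d ≤ 7) : (pad d)ᵀ * pad d = 1 := by
  ext i j
  have : ∀ (i : Fin d) (a : Fin 7), a.val = i.val ↔ a = Fin.castLE hd i := fun i a => by
    simp [Fin.ext_iff]
  simp only [Matrix.mul_apply, pad, transpose_apply, of_apply, this, one_apply, mul_ite, mul_one,
    mul_zero]
  rw [Finset.sum_ite_eq' Finset.univ (Fin.castLE hd j), if_pos (Finset.mem_univ _)]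
  simp only [Fin.castLE_inj, eq_comm]

theorem pad_mul_pad_transpose {d : ℕ} :
    pad d * (pad d)ᵀ = diagonal fun a : Fin 7 => if a.val < d then 1 else 0 := by
  ext a b
  simp only [Matrix.mul_apply, pad, transpose_apply, of_apply, diagonal_apply]
  by_cases ha : a.val < d
  · have : ∀ i : Fin d, a.val = i.val ↔ i = ⟨a.val, ha⟩ := fun i => by
      rw [Fin.ext_iff]; exact eq_comm
    simp only [this, ha, ite_mul, one_mul, zero_mul, if_true]
    rw [Finset.sum_ite_eq' Finset.univ, if_pos (Finset.mem_univ _)]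
    simp only [← Fin.ext_iff, eq_comm]
  · have : ∀ i : Fin d, a.val ≠ i.val := fun i h => ha (h ▸ i.2)
    simp [this, ha]

/-- `S` is conjugate to the standard model of rank `j` under rotations that fix the last basis
vectors of `ℝ^7`. -/
def HasForm (j : ℕ) {d : ℕ} (S : Set (Matrix (Fin d) (Fin d) ℝ)) : Prop :=
  ∃ R : Matrix (Fin 7) (Fin 7) ℝ, R * Rᵀ = 1 ∧
    (∀ a : Fin 7, d ≤ a.val → R *ᵥ Pi.single a 1 = Pi.single a 1) ∧
    ∀ F, F ∈ S ↔ R * (pad d * F * (pad d)ᵀ) * Rᵀ ∈ model j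

/-- With $R$ and $Q$ both fixing the missing coordinates, $Q^TR$ commutes with the projection onto
$\mathbb R^d$ and restricts to an element of $O(d)$. This is why `HasForm` demands more than
conjugacy in seven dimensions. -/
theorem HasForm.equivalent {j d : ℕ} (hd : d ≤ 7) {S T : Set (Matrix (Fin d) (Fin d) ℝ)}
    (hS : HasForm j S) (hT : HasForm j T) : Equivalent S T := by
  obtain ⟨R, hR, hRf, hS⟩ := hS
  obtain ⟨Q, hQ, hQf, hT⟩ := hT
  have hR' : Rᵀ * R = 1 := mul_eq_one_comm.1 hR
  have hQ' : Qᵀ * Q = 1 := mul_eq_one_comm.1 hQ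
  have hI := pad_transpose_mul_pad hd
  let P := Qᵀ * R
  have hP : P * Pᵀ = 1 := by
    simp only [P, transpose_mul, transpose_transpose, Matrix.mul_assoc]
    rw [← Matrix.mul_assoc R, hR, Matrix.one_mul, hQ']
  have hP' : Pᵀ * P = 1 := mul_eq_one_comm.1 hP
  have hPf : ∀ a : Fin 7, d ≤ a.val → P *ᵥ Pi.single a 1 = Pi.single a 1 := by
    intro a ha
    rw [← mulVec_mulVec, hRf a ha, ← hQf a ha, mulVec_mulVec, hQ', one_mulVec, hQf a ha]
  have hPf' : ∀ a : Fin 7, d ≤ a.val → Pᵀ *ᵥ Pi.single a 1 = Pi.single a 1 := by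
    intro a ha
    conv_lhs => rw [← hPf a ha]
    rw [mulVec_mulVec, hP', one_mulVec]
  have hcomm : pad d * ((pad d)ᵀ * P) = P * (pad d * (pad d)ᵀ) := by
    rw [← Matrix.mul_assoc, pad_mul_pad_transpose]
    ext a b
    rw [diagonal_mul, mul_diagonal]
    have h1 : d ≤ b.val → P a b = if a = b then 1 else 0 := fun h => by
      have := congrFun (hPf b h) a
      simpa [Pi.single_apply] using this
    have h2 : d ≤ a.val → P a b = if a = b then 1 else 0 := fun h => by
      have := congrFun (hPf' a h) b
      simpa [Pi.single_apply, eq_comm] using this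
    by_cases ha : a.val < d <;> by_cases hb : b.val < d
    · simp [ha, hb]
    · have : a ≠ b := fun h => hb (h ▸ ha)
      simp [ha, hb, h1 (not_lt.1 hb), this]
    · have : a ≠ b := fun h => ha (h ▸ hb)
      simp [ha, hb, h2 (not_lt.1 ha), this]
    · simp [ha, hb]
  let p := (pad d)ᵀ * P * pad d
  have hp1 : pad d * p = P * pad d := by
    calc pad d * p = pad d * ((pad d)ᵀ * P) * pad d := by simp only [p, Matrix.mul_assoc]
      _ = P * (pad d * ((pad d)ᵀ * pad d)) := by rw [hcomm]; simp only [Matrix.mul_assoc]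
      _ = P * pad d := by rw [hI, Matrix.mul_one]
  have hp2 : p * pᵀ = 1 := by
    have h : pᵀ * p = 1 := by
      calc pᵀ * p = pᵀ * ((pad d)ᵀ * pad d) * p := by rw [hI, Matrix.mul_one]
        _ = (pad d * p)ᵀ * (pad d * p) := by simp only [transpose_mul, Matrix.mul_assoc]
        _ = (pad d)ᵀ * (Pᵀ * P) * pad d := by
          rw [hp1]; simp only [transpose_mul, Matrix.mul_assoc]
        _ = 1 := by rw [hP', Matrix.mul_one, hI]
    exact mul_eq_one_comm.1 h
  refine equivalent_of_canonical (R := p) (Q := 1) (K := T)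
    ((mem_orthogonalGroup_iff _ _).2 hp2) (one_mem _) (fun F => ?_) (by simp)
  have : Q * (pad d * (p * F * pᵀ) * (pad d)ᵀ) * Qᵀ = R * (pad d * F * (pad d)ᵀ) * Rᵀ := by
    have h1 : Q * (pad d * (p * F * pᵀ) * (pad d)ᵀ) * Qᵀ =
        Q * (pad d * p) * F * (Q * (pad d * p))ᵀ := by
      simp only [transpose_mul, Matrix.mul_assoc]
    have h2 : Q * (pad d * p) = R * pad d := by
      rw [hp1]
      simp only [P]
      rw [← Matrix.mul_assoc, ← Matrix.mul_assoc, hQ, Matrix.one_mul]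
    rw [h1, h2]
    simp only [transpose_mul, Matrix.mul_assoc]
  rw [hS, hT, this]

/-! ### Annihilators of subspaces for seven, six and five dimensions -/

variable {X : Type*} [AddCommGroup X] [Module ℝ X]

/-- The vectors that map `e` into `W` by Clifford multiplication. -/
def vectors (B : Fin 7 → X →ₗ[ℝ] X) (e : X) (W : Submodule ℝ X) : Submodule ℝ (Fin 7 → ℝ) :=
  W.comap ((LinearMap.applyₗ e).comp (cl B))

theorem mem_vectors {B : Fin 7 → X →ₗ[ℝ] X} {e : X} {W : Submodule ℝ X} {v : Fin 7 → ℝ} :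
    v ∈ vectors B e W ↔ cl B v e ∈ W := by simp [vectors]

/-- For $e\in W$ one has $W=\mathbb Re\oplus U\cdot e$, where $U$ consists of the vectors that map
$e$ into $W$. -/
theorem IsClifford.finrank_vectors [FiniteDimensional ℝ X] (hX : finrank ℝ X = 8) {B : Fin 7 → X →ₗ[ℝ] X}
    (hB : IsClifford B) {e : X} (he : e ≠ 0) {W : Submodule ℝ X} (heW : e ∈ W) :
    finrank ℝ W = finrank ℝ (vectors B e W) + 1 := by
  let f : (ℝ × vectors B e W) →ₗ[ℝ] W :=
    (LinearMap.toSpanSingleton ℝ W ⟨e, heW⟩).coprod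
      (((LinearMap.applyₗ e).comp (cl B)).restrict fun _ hv => hv)
  have hf : ∀ t v, (f (t, v) : X) = t • e + cl B v e := fun t v => by simp [f]; rfl
  have hinj : Function.Injective f := by
    refine (injective_iff_map_eq_zero f).2 fun ⟨t, v⟩ h => ?_
    have h' := congrArg (Subtype.val) h
    rw [hf] at h'
    obtain ⟨h1, h2⟩ := hB.cl_eq_smul he h'
    rw [h1, Subtype.ext (p := (· ∈ vectors B e W)) (a2 := 0) h2]; rfl
  have hsurj : Function.Surjective f := by
    rintro ⟨x, hx⟩
    obtain ⟨t, v, rfl⟩ := hB.exists_eq hX he x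
    have hv : v ∈ vectors B e W := by
      rw [mem_vectors]
      simpa using W.sub_mem hx (W.smul_mem t heW)
    exact ⟨(t, ⟨v, hv⟩), Subtype.ext (hf _ _)⟩
  have := (LinearEquiv.ofBijective f ⟨hinj, hsurj⟩).finrank_eq
  rw [finrank_prod, finrank_self] at this
  omega

/-- `S` consists of the matrices that annihilate a subspace `W` of a Clifford module. -/
def IsAnnihilator {d : ℕ} (B : Fin 7 → X →ₗ[ℝ] X) (W : Submodule ℝ X)
    (S : Set (Matrix (Fin d) (Fin d) ℝ)) : Prop :=
  ∀ F, F ∈ S ↔ Fᵀ = -F ∧ ∀ x ∈ W, act B (pad d * F * (pad d)ᵀ) x = 0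

/-- A padded matrix kills the missing basis vectors in any case, so these may be adjoined to the
vectors coming from $W$. The enlarged $U$ is what the stabilizer lemmas for $\mathbb R^7$ are
applied to. -/
theorem IsAnnihilator.mem_iff [FiniteDimensional ℝ X] (hX : finrank ℝ X = 8) {d : ℕ} (hd : d ≤ 7)
    {B : Fin 7 → X →ₗ[ℝ] X} (hB : IsClifford B) {W : Submodule ℝ X}
    {S : Set (Matrix (Fin d) (Fin d) ℝ)} (hS : IsAnnihilator B W S) {e : X} (he : e ≠ 0)
    (heW : e ∈ W) {U : Submodule ℝ (Fin 7 → ℝ)}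
    (hU : U = vectors B e W ⊔ Submodule.span ℝ {v | ∃ a : Fin 7, d ≤ a.val ∧ v = Pi.single a 1})
    (F : Matrix (Fin d) (Fin d) ℝ) : F ∈ S ↔ pad d * F * (pad d)ᵀ ∈ stabilizer B e U := by
  have hI := pad_transpose_mul_pad hd
  have hsk : (pad d * F * (pad d)ᵀ)ᵀ = -(pad d * F * (pad d)ᵀ) ↔ Fᵀ = -F := by
    constructor
    · intro h
      have h2 := congrArg (fun G : Matrix (Fin 7) (Fin 7) ℝ => (pad d)ᵀ * G * pad d) h
      have h3 : ∀ G : Matrix (Fin d) (Fin d) ℝ, (pad d)ᵀ * (pad d * G * (pad d)ᵀ) * pad d = G := by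
        intro G
        calc _ = ((pad d)ᵀ * pad d) * G * ((pad d)ᵀ * pad d) := by simp only [Matrix.mul_assoc]
          _ = G := by rw [hI, Matrix.one_mul, Matrix.mul_one]
      have h4 : (pad d * F * (pad d)ᵀ)ᵀ = pad d * Fᵀ * (pad d)ᵀ := by
        simp only [transpose_mul, transpose_transpose, Matrix.mul_assoc]
      have h5 : -(pad d * F * (pad d)ᵀ) = pad d * (-F) * (pad d)ᵀ := by
        rw [Matrix.mul_neg, Matrix.neg_mul]
      simp only [h4, h5, h3] at h2
      exact h2
    · intro h
      simp only [transpose_mul, transpose_transpose, h, Matrix.mul_neg, Matrix.neg_mul,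
        Matrix.mul_assoc]
  have hker : ∀ a : Fin 7, d ≤ a.val → (pad d * F * (pad d)ᵀ) *ᵥ Pi.single a 1 = 0 := by
    intro a ha
    have : (pad d)ᵀ *ᵥ Pi.single a 1 = 0 := by
      ext i
      have : a.val ≠ i.val := fun h => absurd i.2 (by omega)
      simp [pad, this]
    rw [← mulVec_mulVec, this, mulVec_zero]
  rw [hS, stabilizer, Set.mem_ofPred_eq, hsk]
  refine and_congr_right fun hF => ⟨fun h => ⟨h e heW, ?_⟩, fun h x hx => ?_⟩
  · have hle : U ≤ LinearMap.ker (pad d * F * (pad d)ᵀ).mulVecLin := by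
      rw [hU, sup_le_iff, Submodule.span_le]
      refine ⟨fun v hv => ?_, ?_⟩
      · exact (hB.act_cl_eq_zero he (hsk.2 hF) (h e heW) v).1 (h _ (mem_vectors.1 hv))
      · rintro _ ⟨a, ha, rfl⟩
        exact hker a ha
    exact fun u hu => hle hu
  · obtain ⟨t, v, rfl⟩ := hB.exists_eq hX he x
    have hv : v ∈ vectors B e W := by
      rw [mem_vectors]
      simpa using W.sub_mem hx (W.smul_mem t heW)
    have h1 := (hB.act_cl_eq_zero he (hsk.2 hF) h.1 v).2
      (h.2 v (hU ▸ Submodule.mem_sup_left hv))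
    have h2 : act B (pad d * F * (pad d)ᵀ) (t • e + cl B v e) =
        t • act B (pad d * F * (pad d)ᵀ) e + act B (pad d * F * (pad d)ᵀ) (cl B v e) := by
      simp only [act, map_add, map_smul, smul_add, Finset.sum_add_distrib, Finset.smul_sum,
        smul_comm t]
    rw [h2, h1, h.1, smul_zero, add_zero]

theorem hasForm_of_stabilizer {d j : ℕ} {B : Fin 7 → X →ₗ[ℝ] X} {e : X}
    {U : Submodule ℝ (Fin 7 → ℝ)} {S : Set (Matrix (Fin d) (Fin d) ℝ)}
    (hS : ∀ F, F ∈ S ↔ pad d * F * (pad d)ᵀ ∈ stabilizer B e U)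
    {R : Matrix (Fin 7) (Fin 7) ℝ} (hR : R * Rᵀ = 1)
    (hfix : ∀ a : Fin 7, d ≤ a.val → R a = Pi.single a 1)
    (h : ∀ F, F ∈ stabilizer B e U ↔ R * F * Rᵀ ∈ model j) : HasForm j S := by
  refine ⟨R, hR, fun a ha => ?_, fun F => by rw [hS, h]⟩
  rw [← hfix a ha]
  ext b
  have : (R *ᵥ R a) b = (R * Rᵀ) b a := rfl
  rw [this, hR, hfix a ha, one_apply, Pi.single_apply]

/-- A subspace that contains three or more independent vectors is annihilated by a standard model or
by nothing. -/
theorem IsClifford.stabilizer_dichotomy [FiniteDimensional ℝ X] (hX : finrank ℝ X = 8) {d : ℕ} (hd5 : 5 ≤ d) (hd : d ≤ 7)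
    {B : Fin 7 → X →ₗ[ℝ] X} (hB : IsClifford B) {e : X} (he : e ≠ 0)
    {U : Submodule ℝ (Fin 7 → ℝ)} {S : Set (Matrix (Fin d) (Fin d) ℝ)}
    (hS : ∀ F, F ∈ S ↔ pad d * F * (pad d)ᵀ ∈ stabilizer B e U) {u v w : Fin 7 → ℝ}
    (hu : u ⬝ᵥ u = 1) (hv : v ⬝ᵥ v = 1) (huv : u ⬝ᵥ v = 0) (huU : u ∈ U) (hvU : v ∈ U)
    (hw : cl B u (cl B v e) = cl B w e) (hu6 : d ≤ 6 → u = Pi.single 6 1)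
    (hv5 : d ≤ 5 → v = Pi.single 5 1) :
    (U ≤ Submodule.span ℝ {u, v, w} ∧ HasForm 2 S) ∨
      (¬ U ≤ Submodule.span ℝ {u, v, w} ∧ ∀ F ∈ S, F = 0) := by
  by_cases hU : U ≤ Submodule.span ℝ {u, v, w}
  · obtain ⟨R, hR, h6, h5, h⟩ := hB.stabilizer_two hX he hu hv huv huU hvU hw hU
    refine Or.inl ⟨hU, hasForm_of_stabilizer hS hR (fun a ha => ?_) h⟩
    have h7 := a.2
    obtain h | h : a = 5 ∨ a = 6 := by omega
    · subst h; rw [h5]; exact hv5 ha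
    · subst h; rw [h6]; exact hu6 ha
  · refine Or.inr ⟨hU, fun F hF => ?_⟩
    have h0 := hB.stabilizer_eq_zero hX he hu hv huv huU hvU hw hU ((hS F).1 hF)
    have hI := pad_transpose_mul_pad hd
    calc F = ((pad d)ᵀ * pad d) * F * ((pad d)ᵀ * pad d) := by
          rw [hI, Matrix.one_mul, Matrix.mul_one]
      _ = (pad d)ᵀ * (pad d * F * (pad d)ᵀ) * pad d := by simp only [Matrix.mul_assoc]
      _ = 0 := by rw [h0, Matrix.mul_zero, Matrix.zero_mul]

variable {X : Type*} [AddCommGroup X] [Module ℝ X] [FiniteDimensional ℝ X]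

theorem finrank_span_triple_le (u v w : Fin 7 → ℝ) :
    finrank ℝ (Submodule.span ℝ {u, v, w}) ≤ 3 := by
  classical
  have h := finrank_span_finset_le_card (R := ℝ) ({u, v, w} : Finset (Fin 7 → ℝ))
  have := Finset.card_le_three (a := u) (b := v) (c := w)
  push_cast at h
  exact h.trans this

theorem span_single_eq_bot {d : ℕ} (hd : d = 7) :
    Submodule.span ℝ {v : Fin 7 → ℝ | ∃ a : Fin 7, d ≤ a.val ∧ v = Pi.single a 1} = ⊥ := by
  rw [Submodule.span_eq_bot]
  rintro _ ⟨a, ha, -⟩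
  omega

/-- The dependence of the annihilator of a subspace of a Clifford module on its dimension, for
seven-dimensional matrices. -/
theorem IsAnnihilator.form_seven (hX : finrank ℝ X = 8) {B : Fin 7 → X →ₗ[ℝ] X}
    (hB : IsClifford B) {W : Submodule ℝ X} {S : Set (Matrix (Fin 7) (Fin 7) ℝ)}
    (hS : IsAnnihilator B W S) {n : ℕ} (hn : finrank ℝ W = n) (h0 : n ≠ 0) :
    (n ≤ 3 ∧ HasForm (n - 1) S) ∨ (n = 4 ∧ HasForm 2 S) ∨ (4 ≤ n ∧ ∀ F ∈ S, F = 0) := by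
  have hW : W ≠ ⊥ := by rintro rfl; simp at hn; omega
  obtain ⟨e, heW, he⟩ := Submodule.exists_mem_ne_zero_of_ne_bot hW
  have hfr := hB.finrank_vectors hX he heW
  have hm := hS.mem_iff hX le_rfl hB he heW (U := vectors B e W) (by
    rw [span_single_eq_bot rfl, sup_bot_eq])
  have hfix : ∀ {R : Matrix (Fin 7) (Fin 7) ℝ} (a : Fin 7), 7 ≤ a.val → R a = Pi.single a 1 :=
    fun a ha => by omega
  rw [hn] at hfr
  by_cases h1 : n = 1
  · obtain ⟨R, hR, h⟩ := hB.stabilizer_zero hX he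
      (U := vectors B e W) (Submodule.finrank_eq_zero.1 (by omega))
    subst h1
    exact Or.inl ⟨by norm_num, hasForm_of_stabilizer hm hR hfix h⟩
  obtain ⟨u, huU, hu, -⟩ := exists_unit_orthogonal (vectors B e W)
    (Fin.elim0 : Fin 0 → Fin 7 → ℝ) (by omega)
  have hu0 : u ≠ 0 := by rintro rfl; simp at hu
  by_cases h2 : n = 2
  · have hspan : vectors B e W = Submodule.span ℝ {u} := by
      symm
      apply Submodule.eq_of_le_of_finrank_le
      · rwa [Submodule.span_singleton_le_iff_mem]
      · rw [finrank_span_singleton hu0]; omega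
    obtain ⟨R, hR, -, h⟩ := hB.stabilizer_one hX he hu hspan
    subst h2
    exact Or.inl ⟨by norm_num, hasForm_of_stabilizer hm hR hfix h⟩
  obtain ⟨v, hvU, hv, huv⟩ := exists_unit_orthogonal (vectors B e W) ![u] (by omega)
  obtain ⟨w, hw⟩ := hB.exists_cross hX he (huv 0)
  have hdich := hB.stabilizer_dichotomy hX (by norm_num) le_rfl he hm hu hv (huv 0) huU hvU hw
    (by norm_num) (by norm_num)
  by_cases h3 : n = 3
  · have hspan : vectors B e W = Submodule.span ℝ {u, v} := by
      have hli : LinearIndependent ℝ ![u, v] := by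
        rw [LinearIndependent.pair_iff]
        intro s t hst
        have huv0 := huv 0
        have h1 := congrArg (fun x => u ⬝ᵥ x) hst
        have h2 := congrArg (fun x => v ⬝ᵥ x) hst
        have huv1 : v ⬝ᵥ u = 0 := by rw [dotProduct_comm]; exact huv0
        have huv0' : u ⬝ᵥ v = 0 := huv0
        simp only [dotProduct_add, dotProduct_smul, hu, hv, huv0', huv1, dotProduct_zero,
          smul_eq_mul] at h1 h2
        constructor <;> linarith
      symm
      apply Submodule.eq_of_le_of_finrank_le
      · rw [Submodule.span_le]
        rintro y (rfl | rfl) <;> assumption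
      · have h := finrank_span_eq_card hli
        rw [Matrix.range_cons, Matrix.range_cons, Matrix.range_empty, Set.union_empty,
          Set.singleton_union, Fintype.card_fin] at h
        omega
    rcases hdich with h | h
    · subst h3; exact Or.inl ⟨le_rfl, h.2⟩
    · refine absurd ?_ h.1
      rw [hspan]
      exact Submodule.span_mono (by intro y; simp only [Set.mem_insert_iff]; tauto)
  · refine Or.inr ?_
    by_cases h4 : n = 4
    -- For $n=4$ the dimension alone does not decide: the three-dimensional space of vectors may or
    -- may not be closed under the cross product.
    · exact hdich.imp (fun h => ⟨h4, h.2⟩) fun h => ⟨h4.ge, h.2⟩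
    · rcases hdich with h | h
      · have := (Submodule.finrank_mono h.1).trans (finrank_span_triple_le u v w)
        omega
      · exact Or.inr ⟨by omega, h.2⟩

theorem single_dotProduct_single_self (a : Fin 7) :
    (Pi.single a 1 : Fin 7 → ℝ) ⬝ᵥ Pi.single a 1 = 1 := by simp

/-- The same for six-dimensional matrices and subspaces that are stable under the last generator. -/
theorem IsAnnihilator.form_six (hX : finrank ℝ X = 8) {B : Fin 7 → X →ₗ[ℝ] X}
    (hB : IsClifford B) {W : Submodule ℝ X} (hWB : ∀ x ∈ W, B 6 x ∈ W)
    {S : Set (Matrix (Fin 6) (Fin 6) ℝ)} (hS : IsAnnihilator B W S) {n : ℕ}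
    (hn : finrank ℝ W = 2 * n) (h0 : n ≠ 0) :
    (n ≤ 2 ∧ HasForm n S) ∨ (3 ≤ n ∧ ∀ F ∈ S, F = 0) := by
  have hW : W ≠ ⊥ := by rintro rfl; simp at hn; omega
  obtain ⟨e, heW, he⟩ := Submodule.exists_mem_ne_zero_of_ne_bot hW
  have hfr := hB.finrank_vectors hX he heW
  let u : Fin 7 → ℝ := Pi.single 6 1
  have huU : u ∈ vectors B e W := by
    rw [mem_vectors, cl_single]; exact hWB e heW
  have hu : u ⬝ᵥ u = 1 := single_dotProduct_single_self 6
  have hu0 : u ≠ 0 := by intro h; rw [h] at hu; simp at hu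
  have hm := hS.mem_iff hX (by norm_num) hB he heW (U := vectors B e W) (by
    refine (sup_eq_left.2 ?_).symm
    rw [Submodule.span_le]
    rintro _ ⟨a, ha, rfl⟩
    have : a = 6 := by omega
    exact this ▸ huU)
  rw [hn] at hfr
  by_cases h1 : n = 1
  · have hspan : vectors B e W = Submodule.span ℝ {u} := by
      symm
      apply Submodule.eq_of_le_of_finrank_le
      · rwa [Submodule.span_singleton_le_iff_mem]
      · rw [finrank_span_singleton hu0]; omega
    obtain ⟨R, hR, h6, h⟩ := hB.stabilizer_one hX he hu hspan
    refine Or.inl ⟨by omega, ?_⟩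
    subst h1
    refine hasForm_of_stabilizer hm hR (fun a ha => ?_) h
    have : a = 6 := by omega
    rw [this, h6]
  obtain ⟨v, hvU, hv, huv⟩ := exists_unit_orthogonal (vectors B e W) ![u] (by omega)
  obtain ⟨w, hw⟩ := hB.exists_cross hX he (huv 0)
  have hdich := hB.stabilizer_dichotomy hX (by norm_num) (by norm_num) he hm hu hv (huv 0) huU hvU
    hw (fun _ => rfl) (by norm_num)
  by_cases h2 : n = 2
  · rcases hdich with h | h
    · exact Or.inl ⟨h2.le, h2 ▸ h.2⟩
    · refine absurd (le_of_eq ?_) h.1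
      symm
      apply Submodule.eq_of_le_of_finrank_le
      · rw [Submodule.span_le]
        rintro y (rfl | rfl | rfl)
        · exact huU
        · exact hvU
        -- Stability under $B_6$ puts $u\times v$ into the space of vectors, so for $n=2$ that space
        -- is exactly $\langle u,v,u\times v\rangle$.
        · rw [SetLike.mem_coe, mem_vectors, ← hw]
          have := hWB _ (mem_vectors.1 hvU)
          rwa [← cl_single B 6] at this
      · rw [hB.finrank_span_cross hX he hu hv (huv 0) hw]; omega
  · rcases hdich with h | h
    · have := (Submodule.finrank_mono h.1).trans (finrank_span_triple_le u v w)
      omega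
    · exact Or.inr ⟨by omega, h.2⟩

/-- The same for five-dimensional matrices. -/
theorem IsAnnihilator.form_five (hX : finrank ℝ X = 8) {B : Fin 7 → X →ₗ[ℝ] X}
    (hB : IsClifford B) {W : Submodule ℝ X} (hWB : ∀ x ∈ W, B 6 x ∈ W)
    {S : Set (Matrix (Fin 5) (Fin 5) ℝ)} (hS : IsAnnihilator B W S) {n : ℕ}
    (hn : finrank ℝ W = 2 * n) (h0 : n ≠ 0) :
    (n ≤ 2 ∧ HasForm 2 S) ∨ (2 ≤ n ∧ ∀ F ∈ S, F = 0) := by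
  have hW : W ≠ ⊥ := by rintro rfl; simp at hn; omega
  obtain ⟨e, heW, he⟩ := Submodule.exists_mem_ne_zero_of_ne_bot hW
  have hfr := hB.finrank_vectors hX he heW
  let u : Fin 7 → ℝ := Pi.single 6 1
  let v : Fin 7 → ℝ := Pi.single 5 1
  have huV : u ∈ vectors B e W := by
    rw [mem_vectors, cl_single]; exact hWB e heW
  have hu : u ⬝ᵥ u = 1 := single_dotProduct_single_self 6
  have hv : v ⬝ᵥ v = 1 := single_dotProduct_single_self 5
  have huv : u ⬝ᵥ v = 0 := by simp [u, v]
  have hu0 : u ≠ 0 := by intro h; rw [h] at hu; simp at hu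
  -- The last unit vector already lies in `vectors B e W` by $B_6$-stability; the one before it
  -- enters only through the padding.
  let U := vectors B e W ⊔
    Submodule.span ℝ {v : Fin 7 → ℝ | ∃ a : Fin 7, 5 ≤ a.val ∧ v = Pi.single a 1}
  have hm := hS.mem_iff hX (by norm_num) hB he heW (U := U) rfl
  have huU : u ∈ U := Submodule.mem_sup_left huV
  have hvU : v ∈ U := Submodule.mem_sup_right (Submodule.subset_span ⟨5, le_rfl, rfl⟩)
  obtain ⟨w, hw⟩ := hB.exists_cross hX he huv
  have hdich := hB.stabilizer_dichotomy hX (by norm_num) (by norm_num) he hm hu hv huv huU hvU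
    hw (fun _ => rfl) (fun _ => rfl)
  rw [hn] at hfr
  rcases hdich with h | h
  · have := (Submodule.finrank_mono (le_sup_left.trans h.1)).trans (finrank_span_triple_le u v w)
    exact Or.inl ⟨by omega, h.2⟩
  · refine Or.inr ⟨?_, h.2⟩
    by_contra hn2
    apply h.1
    have hspan : vectors B e W = Submodule.span ℝ {u} := by
      symm
      apply Submodule.eq_of_le_of_finrank_le
      · rwa [Submodule.span_singleton_le_iff_mem]
      · rw [finrank_span_singleton hu0]; omega
    rw [sup_le_iff, hspan]
    refine ⟨Submodule.span_mono (by simp), ?_⟩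
    rw [Submodule.span_le]
    rintro _ ⟨a, ha, rfl⟩
    obtain h | h : a = 5 ∨ a = 6 := by omega
    · subst h; exact Submodule.subset_span (by simp [v])
    · subst h; exact Submodule.subset_span (by simp [u])

/-! ### Gamma matrices and their transfer to Clifford modules -/

theorem IsGammaSystem.sq {d : ℕ} {Γ : Fin d → SpinorMatrix d} (hΓ : IsGammaSystem Γ) (a : Fin d) :
    Γ a * Γ a = 1 := by
  have h := hΓ.2 a a
  rw [if_pos rfl, ← two_smul ℂ] at h
  have h2 : (2 : ℂ) • (Γ a * Γ a) = (2 : ℂ) • (1 : SpinorMatrix d) := by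
    rw [h, two_smul, one_add_one_eq_two]
  exact smul_right_injective _ (two_ne_zero' ℂ) h2

theorem IsGammaSystem.anti {d : ℕ} {Γ : Fin d → SpinorMatrix d} (hΓ : IsGammaSystem Γ)
    {a b : Fin d} (h : a ≠ b) : Γ a * Γ b = -(Γ b * Γ a) := by
  have := hΓ.2 a b
  rw [if_neg h] at this
  exact eq_neg_of_add_eq_zero_left this

theorem IsGammaSystem.anti_assoc {d : ℕ} {Γ : Fin d → SpinorMatrix d} (hΓ : IsGammaSystem Γ)
    {a b : Fin d} (h : a ≠ b) (M : SpinorMatrix d) : Γ a * (Γ b * M) = -(Γ b * (Γ a * M)) := by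
  rw [← Matrix.mul_assoc, hΓ.anti h, Matrix.neg_mul, Matrix.mul_assoc]

theorem IsGammaSystem.sq_assoc {d : ℕ} {Γ : Fin d → SpinorMatrix d} (hΓ : IsGammaSystem Γ)
    (a : Fin d) (M : SpinorMatrix d) : Γ a * (Γ a * M) = M := by
  rw [← Matrix.mul_assoc, hΓ.sq, Matrix.one_mul]

theorem IsGammaSystem.mulVec_add {d : ℕ} {Γ : Fin d → SpinorMatrix d} (hΓ : IsGammaSystem Γ)
    (a b : Fin d) (x : Spinor d) :
    (Γ a * Γ b) *ᵥ x + (Γ b * Γ a) *ᵥ x = if a = b then (2 : ℝ) • x else 0 := by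
  rw [← add_mulVec, hΓ.2]
  split_ifs
  · have : (2 : SpinorMatrix d) = 1 + 1 := one_add_one_eq_two.symm
    rw [this, add_mulVec, one_mulVec, two_smul]
  · simp

theorem fieldMatrix_mulVec {d : ℕ} (Γ : Fin d → SpinorMatrix d) (F : Matrix (Fin d) (Fin d) ℝ)
    (x : Spinor d) : fieldMatrix Γ F *ᵥ x = ∑ a, ∑ b, F a b • ((Γ a * Γ b) *ᵥ x) := by
  simp only [fieldMatrix, Matrix.sum_mulVec, Matrix.smul_mulVec, Complex.coe_smul]

theorem IsSystem.eq_of_zero {d : ℕ} {S : Set (Matrix (Fin d) (Fin d) ℝ)} (h : IsSystem d 0 S) :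
    S = {F | Fᵀ = -F} := by
  obtain ⟨Γ, hΓ, A, hA, W, hW, hn, rfl⟩ := h
  rw [Submodule.finrank_eq_zero] at hn
  ext F
  simp [annihilator, hn]

theorem mul_prod_ofFn {R : Type*} [Ring R] [Algebra ℂ R] {k : ℕ} (Γ : Fin k → R) (x : R)
    (c : Fin k → ℂ) (h : ∀ i, x * Γ i = c i • (Γ i * x)) :
    x * (List.ofFn Γ).prod = (∏ i, c i) • ((List.ofFn Γ).prod * x) := by
  induction k with
  | zero => simp
  | succ k ih =>
    rw [List.ofFn_succ, List.prod_cons, ← mul_assoc, h, smul_mul_assoc, mul_assoc,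
      ih _ (fun i => c i.succ) fun i => h i.succ, mul_smul_comm, smul_smul, Fin.prod_univ_succ,
      mul_assoc]

theorem prod_ofFn_sq {R : Type*} [Ring R] [Algebra ℂ R] {k : ℕ} (Γ : Fin k → R)
    (h1 : ∀ i, Γ i * Γ i = 1) (h2 : ∀ i j, i ≠ j → Γ i * Γ j = -(Γ j * Γ i)) :
    (List.ofFn Γ).prod * (List.ofFn Γ).prod = (-1 : ℂ) ^ (∑ i ∈ Finset.range k, i) • (1 : R) := by
  induction k with
  | zero => simp
  | succ k ih =>
    let P := (List.ofFn fun i : Fin k => Γ i.succ).prod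
    have h3 : Γ 0 * P = (-1 : ℂ) ^ k • (P * Γ 0) := by
      have := mul_prod_ofFn (fun i : Fin k => Γ i.succ) (Γ 0) (fun _ => -1) fun i => by
        rw [neg_one_smul]; exact h2 _ _ (Fin.succ_ne_zero i).symm
      simpa using this
    have h4 : P * P = _ := ih (fun i => Γ i.succ) (fun i => h1 _) fun i j hij =>
      h2 _ _ fun h => hij (Fin.succ_injective _ h)
    rw [List.ofFn_succ, List.prod_cons]
    change Γ 0 * P * (Γ 0 * P) = _
    calc Γ 0 * P * (Γ 0 * P) = (-1 : ℂ) ^ k • (P * Γ 0) * (Γ 0 * P) := by rw [← h3]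
      _ = (-1 : ℂ) ^ k • (P * (Γ 0 * Γ 0) * P) := by
          rw [smul_mul_assoc]
          simp only [mul_assoc]
      _ = _ := by
          rw [h1, mul_one, h4, smul_smul, ← pow_add, Finset.sum_range_succ, add_comm]

/-- $\Gamma_a$ commutes with itself and anticommutes with the $d-1$ other factors. -/
theorem IsGammaSystem.mul_prod {d : ℕ} {Γ : Fin d → SpinorMatrix d} (hΓ : IsGammaSystem Γ)
    (a : Fin d) :
    Γ a * (List.ofFn Γ).prod = (-1 : ℂ) ^ (d - 1) • ((List.ofFn Γ).prod * Γ a) := by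
  rw [mul_prod_ofFn Γ (Γ a) fun b => if b = a then 1 else -1]
  · congr 1
    rw [Finset.prod_ite, Finset.filter_eq', Finset.filter_ne']
    simp
  · intro b
    split_ifs with h
    · rw [h, one_smul]
    · rw [neg_one_smul]; exact hΓ.anti (Ne.symm h)

theorem IsGammaSystem.prod_sq {d : ℕ} {Γ : Fin d → SpinorMatrix d} (hΓ : IsGammaSystem Γ) :
    (List.ofFn Γ).prod * (List.ofFn Γ).prod =
      (-1 : ℂ) ^ (∑ i ∈ Finset.range d, i) • (1 : SpinorMatrix d) :=
  prod_ofFn_sq Γ hΓ.sq fun _ _ h => hΓ.anti h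

section Embedding

variable {X : Type*} [AddCommGroup X] [Module ℝ X]

theorem act_pad {d : ℕ} (hd : d ≤ 7) (B : Fin 7 → X →ₗ[ℝ] X) (F : Matrix (Fin d) (Fin d) ℝ)
    (x : X) : act B (pad d * F * (pad d)ᵀ) x =
      ∑ c, ∑ e, F c e • B (Fin.castLE hd c) (B (Fin.castLE hd e) x) := by
  have h : ∀ (i : Fin d) (a : Fin 7), a.val = i.val ↔ a = Fin.castLE hd i := fun i a => by
    simp [Fin.ext_iff]
  rw [act, sum_conj_smul]
  refine Finset.sum_congr rfl fun c _ => Finset.sum_congr rfl fun e _ => ?_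
  congr 1
  simp [pad, h]

/-- Only even products of generators occur in the field matrix, so it suffices to realize
$\Gamma_a\Gamma_b$ as $-B_aB_b$; the overall sign does not change kernels. Field matrices are
complex-linear, so a real subspace with complex span $W$ is enough to test on. -/
theorem isAnnihilator_of_embedding {d : ℕ} (hd : d ≤ 7) {Γ : Fin d → SpinorMatrix d}
    {B : Fin 7 → X →ₗ[ℝ] X} (f : X →ₗ[ℝ] Spinor d) (hf : Function.Injective f)
    (h : ∀ a b x, f (B (Fin.castLE hd a) (B (Fin.castLE hd b) x)) = -((Γ a * Γ b) *ᵥ f x))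
    {W : Submodule ℂ (Spinor d)} {U : Submodule ℝ X} (hW : W = Submodule.span ℂ (f '' U)) :
    IsAnnihilator B U (annihilator Γ W) := by
  intro F
  have key : ∀ x, f (act B (pad d * F * (pad d)ᵀ) x) = -(fieldMatrix Γ F *ᵥ f x) := by
    intro x
    rw [act_pad hd, fieldMatrix_mulVec]
    simp only [map_sum, map_smul, h, smul_neg, Finset.sum_neg_distrib]
  refine and_congr_right fun _ => ⟨fun hF x hx => ?_, fun hF x hx => ?_⟩
  · apply hf
    rw [key, hF _ (hW ▸ Submodule.subset_span ⟨x, hx, rfl⟩), neg_zero, map_zero]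
  · rw [hW] at hx
    induction hx using Submodule.span_induction with
    | mem x hx =>
      obtain ⟨y, hy, rfl⟩ := hx
      rw [← neg_eq_zero, ← key, hF y hy, map_zero]
    | zero => simp
    | add x y _ _ hx hy => rw [mulVec_add, hx, hy, add_zero]
    | smul c x _ hx => rw [mulVec_smul, hx, smul_zero]

end Embedding

/-! ### Real structures and Majorana spinors in seven dimensions -/

section RealStructure

variable {V : Type*} [AddCommGroup V] [Module ℂ V]

/-- A real basis of fixed vectors stays independent over $\mathbb C$: adding a relation to its image
under $C$ leaves a relation between the real parts of the coefficients, and the relation multiplied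
by $i$ handles the imaginary parts. -/
theorem finrank_span_of_fixed [FiniteDimensional ℂ V] (C : V →ₛₗ[starRingEnd ℂ] V) (R : Submodule ℝ V)
    (hR : ∀ x ∈ R, C x = x) : finrank ℂ (Submodule.span ℂ (R : Set V)) = finrank ℝ R := by
  have : FiniteDimensional ℝ V := FiniteDimensional.complexToReal V
  let b := finBasis ℝ R
  let v : Fin (finrank ℝ R) → V := fun i => b i
  have hre : ∀ z : Fin (finrank ℝ R) → ℂ, ∑ i, z i • v i = 0 → ∀ i, (z i).re = 0 := by
    intro z hz
    have h2 : ∑ i, (starRingEnd ℂ (z i)) • v i = 0 := by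
      have := congrArg C hz
      rw [map_sum, map_zero] at this
      rw [← this]
      refine Finset.sum_congr rfl fun i _ => ?_
      rw [LinearMap.map_smulₛₗ, hR _ (b i).2]
    have h3 : ∑ i, (2 * (z i).re) • b i = 0 := by
      apply Subtype.ext
      have h4 : ∀ i, (((2 * (z i).re) • b i : R) : V) = z i • v i + starRingEnd ℂ (z i) • v i := by
        intro i
        rw [← add_smul, Complex.add_conj]
        simp only [Complex.coe_smul]
        rfl
      rw [Submodule.coe_sum]
      simp only [h4, Finset.sum_add_distrib, hz, h2, add_zero]
      rfl
    intro i
    have := Fintype.linearIndependent_iff.1 b.linearIndependent _ h3 i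
    linarith
  have hli : LinearIndependent ℂ v := by
    rw [Fintype.linearIndependent_iff]
    intro z hz i
    have h1 := hre z hz i
    have h2 := hre (fun i => Complex.I * z i) (by
      simp only [mul_smul, ← Finset.smul_sum, hz, smul_zero]) i
    apply Complex.ext
    · simpa using h1
    · simpa using h2
  have hspan : Submodule.span ℂ (Set.range v) = Submodule.span ℂ (R : Set V) := by
    apply le_antisymm
    · apply Submodule.span_mono
      rintro _ ⟨i, rfl⟩
      exact (b i).2
    · rw [Submodule.span_le]
      intro x hx
      have h := b.sum_repr ⟨x, hx⟩
      have h2 := congrArg Subtype.val h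
      rw [Submodule.coe_sum] at h2
      change x ∈ _
      change _ = x at h2
      rw [← h2]
      refine Submodule.sum_mem _ fun i _ => ?_
      have : ((b.repr ⟨x, hx⟩ i • b i : R) : V) = ((b.repr ⟨x, hx⟩ i : ℝ) : ℂ) • v i := by
        simp only [Complex.coe_smul]
        rfl
      rw [this]
      exact Submodule.smul_mem _ _ (Submodule.subset_span ⟨i, rfl⟩)
  rw [← hspan, finrank_span_eq_card hli, Fintype.card_fin]

/-- The fixed points of an antilinear map. -/
def fixedPoints (C : V →ₛₗ[starRingEnd ℂ] V) : Submodule ℝ V where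
  carrier := {x | C x = x}
  add_mem' := fun {x y} hx hy => by
    simp only [Set.mem_ofPred_eq] at *
    rw [map_add, hx, hy]
  zero_mem' := map_zero C
  smul_mem' := fun r x hx => by
    simp only [Set.mem_ofPred_eq] at *
    rw [← Complex.coe_smul, LinearMap.map_smulₛₗ, hx, Complex.conj_ofReal]

theorem mem_fixedPoints {C : V →ₛₗ[starRingEnd ℂ] V} {x : V} : x ∈ fixedPoints C ↔ C x = x :=
  Iff.rfl

theorem le_span_fixedPoints {C : V →ₛₗ[starRingEnd ℂ] V} (hC : ∀ x, C (C x) = x)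
    (P : Submodule ℂ V) (hP : ∀ x ∈ P, C x ∈ P) :
    P ≤ Submodule.span ℂ ((fixedPoints C ⊓ P.restrictScalars ℝ : Submodule ℝ V) : Set V) := by
  intro x hx
  have h1 : x + C x ∈ (fixedPoints C ⊓ P.restrictScalars ℝ : Submodule ℝ V) := by
    refine ⟨?_, P.add_mem hx (hP x hx)⟩
    change C _ = _
    rw [map_add, hC, add_comm]
  have h2 : Complex.I • (x - C x) ∈ (fixedPoints C ⊓ P.restrictScalars ℝ : Submodule ℝ V) := by
    refine ⟨?_, P.smul_mem _ (P.sub_mem hx (hP x hx))⟩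
    change C _ = _
    rw [LinearMap.map_smulₛₗ, map_sub, hC, Complex.conj_I]
    module
  -- The decomposition into real and imaginary parts with respect to $C$.
  have h3 : x = (1 / 2 : ℂ) • (x + C x) - (Complex.I / 2) • (Complex.I • (x - C x)) := by
    rw [smul_smul, div_mul_eq_mul_div, Complex.I_mul_I]
    module
  rw [h3]
  exact Submodule.sub_mem _ (Submodule.smul_mem _ _ (Submodule.subset_span h1))
    (Submodule.smul_mem _ _ (Submodule.subset_span h2))

theorem finrank_fixedPoints [FiniteDimensional ℂ V] {C : V →ₛₗ[starRingEnd ℂ] V} (hC : ∀ x, C (C x) = x)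
    (P : Submodule ℂ V) (hP : ∀ x ∈ P, C x ∈ P) :
    finrank ℝ (fixedPoints C ⊓ P.restrictScalars ℝ : Submodule ℝ V) = finrank ℂ P := by
  have : Submodule.span ℂ ((fixedPoints C ⊓ P.restrictScalars ℝ : Submodule ℝ V) : Set V) = P :=
    le_antisymm (Submodule.span_le.2 fun x hx => hx.2) (le_span_fixedPoints hC P hP)
  rw [← finrank_span_of_fixed C _ fun x (hx : x ∈ fixedPoints C ⊓ P.restrictScalars ℝ) => hx.1,
    this]

theorem finrank_fixed_subspace [FiniteDimensional ℂ V] {C : V →ₛₗ[starRingEnd ℂ] V} (M : Submodule ℝ V)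
    (hM : ∀ x ∈ M, C x = x) {W : Submodule ℂ V} (hW : W = Submodule.span ℂ ((M : Set V) ∩ W)) :
    finrank ℝ ((W.restrictScalars ℝ).comap M.subtype) = finrank ℂ W ∧
      W = Submodule.span ℂ (M.subtype '' ((W.restrictScalars ℝ).comap M.subtype)) := by
  have h : (M.subtype '' ((W.restrictScalars ℝ).comap M.subtype) : Set V) = (M : Set V) ∩ W := by
    ext x
    constructor
    · rintro ⟨y, hy, rfl⟩
      exact ⟨y.2, hy⟩
    · rintro ⟨hx, hy⟩
      exact ⟨⟨x, hx⟩, hy, rfl⟩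
  refine ⟨?_, by rw [h]; exact hW⟩
  have h2 := finrank_span_of_fixed C (((W.restrictScalars ℝ).comap M.subtype).map M.subtype) (by
    rintro _ ⟨y, -, rfl⟩
    exact hM y y.2)
  rw [Submodule.map_coe, h, ← hW] at h2
  rw [h2]
  exact (LinearEquiv.finrank_eq (Submodule.equivMapOfInjective _ M.subtype_injective _))

end RealStructure

/-- A matrix as a real-linear operator on spinors. -/
def realMulVec {d : ℕ} (M : SpinorMatrix d) : Spinor d →ₗ[ℝ] Spinor d :=
  M.mulVecLin.restrictScalars ℝ

theorem realMulVec_apply {d : ℕ} (M : SpinorMatrix d) (x : Spinor d) :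
    realMulVec M x = M *ᵥ x := rfl

theorem IsRealStructure.finrank_span_seven {Γ : Fin 7 → SpinorMatrix 7}
    {C : Spinor 7 →ₛₗ[starRingEnd ℂ] Spinor 7} (hC : IsRealStructure Γ C) :
    finrank ℝ (fixedPoints C) = 8 ∧
      finrank ℂ (Submodule.span ℂ (fixedPoints C : Set (Spinor 7))) = 8 := by
  have h := finrank_fixedPoints hC.1 ⊤ (by simp)
  have h1 : (fixedPoints C ⊓ (⊤ : Submodule ℂ (Spinor 7)).restrictScalars ℝ) = fixedPoints C := by
    simp
  rw [h1, finrank_top] at h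
  have h2 : finrank ℂ (Spinor 7) = 8 := by simp [Spinor]
  rw [h2] at h
  exact ⟨h, by rw [finrank_span_of_fixed C _ fun x hx => hx, h]⟩

theorem IsSystem.form_seven {n : ℕ} {S : Set (Matrix (Fin 7) (Fin 7) ℝ)} (h : IsSystem 7 n S)
    (h0 : n ≠ 0) :
    (n ≤ 3 ∧ HasForm (n - 1) S) ∨ (n = 4 ∧ HasForm 2 S) ∨ (4 ≤ n ∧ ∀ F ∈ S, F = 0) := by
  obtain ⟨Γ, hΓ, A, hA, W, hW, hn, rfl⟩ := h
  rw [IsParameterSpace, if_neg (by norm_num), if_pos rfl] at hA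
  obtain ⟨C, hC, rfl⟩ := hA
  let M := fixedPoints C
  let ω := (List.ofFn Γ).prod
  -- A single $\Gamma_a$ need not commute with $C$, but $\omega\Gamma_a$ is a product of four pairs
  -- and does. As $\omega$ commutes with all $\Gamma_a$ and $\omega^2=-1$, the operators
  -- $\omega\Gamma_a$ are the required complex structures on Majorana spinors.
  have hωC : ∀ a x, C ((ω * Γ a) *ᵥ x) = (ω * Γ a) *ᵥ C x := by
    intro a x
    have : ω * Γ a = (Γ 0 * Γ 1) * ((Γ 2 * Γ 3) * ((Γ 4 * Γ 5) * (Γ 6 * Γ a))) := by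
      simp [ω, List.ofFn_succ, Matrix.mul_assoc]
    rw [this]
    simp only [← mulVec_mulVec (M := Γ 0 * Γ 1), ← mulVec_mulVec (M := Γ 2 * Γ 3),
      ← mulVec_mulVec (M := Γ 4 * Γ 5), hC.2]
  have h2 : ω * ω = -1 := by
    refine hΓ.prod_sq.trans ?_
    have : ∑ i ∈ Finset.range 7, i = 21 := rfl
    rw [this, Odd.neg_one_pow (by decide), neg_one_smul]
  have hmul : ∀ a b, (ω * Γ a) * (ω * Γ b) = -(Γ a * Γ b) := by
    intro a b
    have h1 : Γ a * ω = ω * Γ a := by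
      refine (hΓ.mul_prod a).trans ?_
      rw [Even.neg_one_pow (by decide), one_smul]
    rw [Matrix.mul_assoc, ← Matrix.mul_assoc (Γ a), h1, ← Matrix.mul_assoc, ← Matrix.mul_assoc, h2,
      Matrix.mul_assoc, Matrix.neg_mul, Matrix.one_mul]
  let B : Fin 7 → M →ₗ[ℝ] M := fun a => (realMulVec (ω * Γ a)).restrict fun x hx => by
    rw [mem_fixedPoints, realMulVec_apply, hωC, mem_fixedPoints.1 hx]
  have hBB : ∀ a b x, ((B a (B b x) : M) : Spinor 7) = -((Γ a * Γ b) *ᵥ (x : Spinor 7)) := by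
    intro a b x
    change (ω * Γ a) *ᵥ ((ω * Γ b) *ᵥ (x : Spinor 7)) = _
    rw [mulVec_mulVec, hmul, neg_mulVec]
  have hB : IsClifford B := by
    intro a b x
    apply Subtype.ext
    rw [Submodule.coe_add, hBB, hBB, ← neg_add, hΓ.mulVec_add]
    split_ifs
    · rw [Submodule.coe_smul]; module
    · simp
  obtain ⟨h1, h2⟩ := finrank_fixed_subspace M (fun x hx => hx) (W := W) hW
  exact IsAnnihilator.form_seven hC.finrank_span_seven.1 hB
    (isAnnihilator_of_embedding (Γ := Γ) (B := B) le_rfl M.subtype M.subtype_injective hBB h2)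
    (h1.trans hn) h0

/-! ### The quaternionic structure in five dimensions -/

/-- If $x-Px$ vanishes, then $x$ has eigenvalue $1$ and $Gx$ has eigenvalue $-1$. Iterating with
further involutions yields common eigenvectors. -/
theorem exists_neg_eigenvector {K V : Type*} [Field K] [AddCommGroup V] [Module K V]
    {U : Submodule K V} (hU : U ≠ ⊥) {P G : V →ₗ[K] V} (hP : ∀ x, P (P x) = x)
    (hPG : ∀ x, P (G x) = -G (P x)) (hG : Function.Injective G) (hPU : ∀ x ∈ U, P x ∈ U)
    (hGU : ∀ x ∈ U, G x ∈ U) : ∃ W : Submodule K V, W ≠ ⊥ ∧ W ≤ U ∧ ∀ x, x ∈ W ↔ x ∈ U ∧ P x = -x := by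
  let W : Submodule K V := U ⊓ LinearMap.ker (P + LinearMap.id)
  have hW : ∀ x, x ∈ W ↔ x ∈ U ∧ P x = -x := fun x => by
    rw [Submodule.mem_inf, LinearMap.mem_ker, LinearMap.add_apply, LinearMap.id_apply,
      add_eq_zero_iff_eq_neg]
  refine ⟨W, ?_, inf_le_left, hW⟩
  obtain ⟨x, hx, hx0⟩ := Submodule.exists_mem_ne_zero_of_ne_bot hU
  rw [Submodule.ne_bot_iff]
  by_cases h : x - P x = 0
  · refine ⟨G x, (hW _).2 ⟨hGU x hx, ?_⟩, fun h0 => hx0 (hG (by rw [h0, map_zero]))⟩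
    rw [hPG, ← sub_eq_zero.1 h]
  · exact ⟨x - P x, (hW _).2 ⟨U.sub_mem hx (hPU x hx), by rw [map_sub, hP]; abel⟩, h⟩

section Quaternionic

variable {Y : Type*} [AddCommGroup Y] [Module ℂ Y]

/-- Five anticommuting complex-linear complex structures on a complex vector space. -/
def IsComplexClifford (b : Fin 5 → Y →ₗ[ℂ] Y) : Prop :=
  ∀ i j x, b i (b j x) + b j (b i x) = if i = j then (-2 : ℂ) • x else 0

theorem IsComplexClifford.sq {b : Fin 5 → Y →ₗ[ℂ] Y} (hb : IsComplexClifford b) (i : Fin 5)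
    (x : Y) : b i (b i x) = -x := by
  have h := hb i i x
  rw [if_pos rfl] at h
  have : (2 : ℂ) • b i (b i x) = (2 : ℂ) • -x := by
    rw [two_smul, h]; module
  exact smul_right_injective Y (two_ne_zero' ℂ) this

theorem IsComplexClifford.anti {b : Fin 5 → Y →ₗ[ℂ] Y} (hb : IsComplexClifford b) {i j : Fin 5}
    (h : i ≠ j) (x : Y) : b i (b j x) = -b j (b i x) := by
  have := hb i j x
  rw [if_neg h] at this
  exact eq_neg_of_add_eq_zero_left this

theorem IsComplexClifford.exists_eigenvector [Nontrivial Y] {b : Fin 5 → Y →ₗ[ℂ] Y}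
    (hb : IsComplexClifford b) :
    ∃ e : Y, e ≠ 0 ∧ b 0 (b 1 e) = Complex.I • e ∧ b 2 (b 3 e) = Complex.I • e := by
  have hinj : ∀ i, Function.Injective (b i) := fun i => by
    refine (injective_iff_map_eq_zero _).2 fun x hx => ?_
    have := hb.sq i x
    rw [hx, map_zero] at this
    exact neg_eq_zero.1 this.symm
  have a01 := hb.anti (show (0 : Fin 5) ≠ 1 by decide)
  have a23 := hb.anti (show (2 : Fin 5) ≠ 3 by decide)
  have a02 := hb.anti (show (0 : Fin 5) ≠ 2 by decide)
  have a03 := hb.anti (show (0 : Fin 5) ≠ 3 by decide)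
  have a12 := hb.anti (show (1 : Fin 5) ≠ 2 by decide)
  have a13 := hb.anti (show (1 : Fin 5) ≠ 3 by decide)
  have s := hb.sq
  obtain ⟨U, hU, -, hUm⟩ := exists_neg_eigenvector (K := ℂ) (U := (⊤ : Submodule ℂ Y)) top_ne_bot
    (P := Complex.I • (b 0 ∘ₗ b 1)) (G := b 0) (fun x => by
      simp only [LinearMap.smul_apply, LinearMap.comp_apply, map_smul,
        smul_smul, Complex.I_mul_I]
      simp [a01, s]) (fun x => by simp [a01, s]) (hinj 0) (by simp) (by simp)
  obtain ⟨W, hW, -, hWm⟩ := exists_neg_eigenvector (K := ℂ) hU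
    (P := Complex.I • (b 2 ∘ₗ b 3)) (G := b 2) (fun x => by
      simp only [LinearMap.smul_apply, LinearMap.comp_apply, map_smul,
        smul_smul, Complex.I_mul_I]
      simp [a23, s]) (fun x => by simp [a23, s]) (hinj 2) (fun x hx => by
      rw [hUm] at hx ⊢
      refine ⟨trivial, ?_⟩
      have h2 := hx.2
      simp only [LinearMap.smul_apply, LinearMap.comp_apply, map_smul] at h2 ⊢
      have h3 : b 0 (b 1 (b 2 (b 3 x))) = b 2 (b 3 (b 0 (b 1 x))) := by
        simp only [a12, a13, a02, a03, map_neg, neg_neg]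
      rw [h3, ← map_smul (b 2), ← map_smul (b 3), h2, map_neg, map_neg, smul_neg]) (fun x hx => by
      rw [hUm] at hx ⊢
      refine ⟨trivial, ?_⟩
      have h2 := hx.2
      simp only [LinearMap.smul_apply, LinearMap.comp_apply] at h2 ⊢
      rw [a12, map_neg, a02, neg_neg, ← map_neg, ← h2, map_smul])
  obtain ⟨e, he, he0⟩ := Submodule.exists_mem_ne_zero_of_ne_bot hW
  have h1 := ((hUm e).1 ((hWm e).1 he).1).2
  have h2 := ((hWm e).1 he).2
  have key : ∀ y : Y, Complex.I • y = -e → y = Complex.I • e := fun y hy => by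
    have := congrArg (fun z => -Complex.I • z) hy
    simpa [smul_smul] using this
  exact ⟨e, he0, key _ h1, key _ h2⟩

/-- The quaternionic structure of the spinor representation in five dimensions. -/
theorem IsComplexClifford.exists_quaternionic (hY : finrank ℂ Y = 4) {b : Fin 5 → Y →ₗ[ℂ] Y}
    (hb : IsComplexClifford b) :
    ∃ J : Y →ₛₗ[starRingEnd ℂ] Y, (∀ x, J (J x) = -x) ∧ ∀ i x, J (b i x) = -b i (J x) := by
  have : Nontrivial Y := nontrivial_of_finrank_pos (R := ℂ) (by omega)
  have : FiniteDimensional ℂ Y := FiniteDimensional.of_finrank_pos (by omega)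
  obtain ⟨e, he, h01, h23⟩ := hb.exists_eigenvector
  have a20 := hb.anti (show (2 : Fin 5) ≠ 0 by decide)
  have a10 := hb.anti (show (1 : Fin 5) ≠ 0 by decide)
  have a12 := hb.anti (show (1 : Fin 5) ≠ 2 by decide)
  have a30 := hb.anti (show (3 : Fin 5) ≠ 0 by decide)
  have a32 := hb.anti (show (3 : Fin 5) ≠ 2 by decide)
  have a40 := hb.anti (show (4 : Fin 5) ≠ 0 by decide)
  have a42 := hb.anti (show (4 : Fin 5) ≠ 2 by decide)
  have a41 := hb.anti (show (4 : Fin 5) ≠ 1 by decide)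
  have a43 := hb.anti (show (4 : Fin 5) ≠ 3 by decide)
  have s := hb.sq
  have e1 : b 1 e = -Complex.I • b 0 e := by
    have := congrArg (b 0) h01
    rw [s, map_smul] at this
    rw [neg_smul, ← this, neg_neg]
  have e3 : b 3 e = -Complex.I • b 2 e := by
    have := congrArg (b 2) h23
    rw [s, map_smul] at this
    rw [neg_smul, ← this, neg_neg]
  have hne : ∀ i x, x ≠ 0 → b i x ≠ 0 := fun i x hx h => hx (by
    have := s i x
    rw [h, map_zero] at this
    exact neg_eq_zero.1 this.symm)
  -- The weights 1 and 2 make the four eigenvalues $3i,i,-i,-3i$ distinct. So the four vectors `v`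
  -- form a basis, and $b_4$, which commutes with `T`, has $e$ as an eigenvector.
  let T : Module.End ℂ Y := b 0 ∘ₗ b 1 + (2 : ℂ) • (b 2 ∘ₗ b 3)
  let v : Fin 4 → Y := ![e, b 0 e, b 2 e, b 0 (b 2 e)]
  let μ : Fin 4 → ℂ := ![3 * Complex.I, Complex.I, -Complex.I, -(3 * Complex.I)]
  have hμ : Function.Injective μ := by
    intro i j hij
    fin_cases i <;> fin_cases j <;> simp [μ, Complex.ext_iff] at hij ⊢ <;> norm_num at hij
  have hT : ∀ i, T (v i) = μ i • v i := by
    intro i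
    fin_cases i <;> simp [T, v, μ, a10, a12, a30, a32, a20, e1, e3, s, smul_smul] <;> module
  have hv0 : ∀ i, v i ≠ 0 := by
    intro i
    fin_cases i
    exacts [he, hne _ _ he, hne _ _ he, hne _ _ (hne _ _ he)]
  have hli : LinearIndependent ℂ v :=
    Module.End.eigenvectors_linearIndependent' T μ hμ v fun i =>
      ⟨Module.End.mem_eigenspace_iff.2 (hT i), hv0 i⟩
  let bs := basisOfLinearIndependentOfCardEqFinrank hli (by rw [hY]; rfl)
  have hbs : ∀ i, bs i = v i := fun i => by simp [bs]
  obtain ⟨t, ht⟩ : ∃ t : ℂ, b 4 e = t • e := by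
    have h1 : T (b 4 e) = (3 * Complex.I) • b 4 e := by
      have h2 : T (b 4 e) = b 4 (T e) := by
        simp only [T, LinearMap.add_apply, LinearMap.comp_apply, LinearMap.smul_apply, map_add,
          map_smul, a40, a41, a42, a43, map_neg, neg_neg]
      rw [h2]
      have := hT 0
      change T e = (3 * Complex.I) • e at this
      rw [this, map_smul]
    have h2 : b 4 e = ∑ i, bs.repr (b 4 e) i • v i := by
      conv_lhs => rw [← bs.sum_repr (b 4 e)]
      simp only [hbs]
    have h3 : ∑ i, (bs.repr (b 4 e) i * (μ i - 3 * Complex.I)) • v i = 0 := by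
      have : ∀ i, (bs.repr (b 4 e) i * (μ i - 3 * Complex.I)) • v i =
          T (bs.repr (b 4 e) i • v i) - (3 * Complex.I) • (bs.repr (b 4 e) i • v i) := by
        intro i
        rw [map_smul, hT]; module
      simp only [this, Finset.sum_sub_distrib, ← map_sum, ← Finset.smul_sum, ← h2, h1, sub_self]
    have h4 := Fintype.linearIndependent_iff.1 hli _ h3
    have h5 : ∀ i, i ≠ 0 → bs.repr (b 4 e) i = 0 := fun i hi =>
      (mul_eq_zero.1 (h4 i)).resolve_right fun h => hi (hμ (sub_eq_zero.1 h))
    refine ⟨bs.repr (b 4 e) 0, ?_⟩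
    conv_lhs => rw [h2]
    rw [Finset.sum_eq_single 0 (fun i _ hi => by rw [h5 i hi, zero_smul]) (by simp)]
    rfl
  -- From $b_4^2=-1$ one gets $t=\pm i$; that $t$ is imaginary is what lets the antilinear $J$
  -- anticommute with $b_4$.
  have ht2 : starRingEnd ℂ t = -t := by
    have h1 := s 4 e
    rw [ht, map_smul, ht, smul_smul, ← neg_one_smul ℂ e] at h1
    have h2 : t * t = -1 := smul_left_injective ℂ he h1
    have h3 : (t - Complex.I) * (t + Complex.I) = 0 := by
      linear_combination h2 - Complex.I_mul_I
    rcases mul_eq_zero.1 h3 with h | h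
    · rw [sub_eq_zero.1 h, Complex.conj_I]
    · rw [eq_neg_of_add_eq_zero_left h, map_neg, Complex.conj_I]
  -- $Je=b_0b_2e$; the other values are forced by $Jb_i=-b_iJ$.
  let c : Fin 4 → Y := ![b 0 (b 2 e), b 2 e, -b 0 e, -e]
  let J : Y →ₛₗ[starRingEnd ℂ] Y :=
    { toFun := fun x => ∑ i, starRingEnd ℂ (bs.repr x i) • c i
      map_add' := fun x y => by simp [add_smul, Finset.sum_add_distrib]
      map_smul' := fun r x => by simp [mul_smul, Finset.smul_sum] }
  have hJ : ∀ i, J (v i) = c i := by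
    intro i
    change ∑ j, starRingEnd ℂ (bs.repr (v i) j) • c j = c i
    rw [← hbs, Finset.sum_eq_single i]
    · simp
    · intro j _ hj; simp [Ne.symm hj]
    · simp
  have j0 : J e = b 0 (b 2 e) := hJ 0
  have j1 : J (b 0 e) = b 2 e := hJ 1
  have j2 : J (b 2 e) = -b 0 e := hJ 2
  have j3 : J (b 0 (b 2 e)) = -e := hJ 3
  refine ⟨J, fun x => ?_, fun i x => ?_⟩
  · have : (J.comp J : Y →ₗ[ℂ] Y) = -LinearMap.id := by
      refine bs.ext fun i => ?_
      rw [hbs]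
      fin_cases i <;> simp [v, j0, j1, j2, j3]
    exact LinearMap.congr_fun this x
  · have : J.comp (b i) = -(b i).comp J := by
      refine bs.ext fun k => ?_
      rw [hbs]
      fin_cases i <;> fin_cases k <;>
        simp [v, j0, j1, j2, j3, a10, a12, a30, a32, a20, a40, a42, e1, e3, s, ht, ht2]
    exact LinearMap.congr_fun this x

end Quaternionic

/-! ### Chirality and Weyl spinors -/

/-- `G` embeds each of the two eigenspaces of the involution $\chi$ into the other, so they have
equal dimension. Rank-nullity for $\chi-s$, whose kernel and range are these eigenspaces, gives half
of $\dim V$. -/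
theorem finrank_eigenspace_of_anticommute {V : Type*} [AddCommGroup V] [Module ℂ V]
    [FiniteDimensional ℂ V] {χ G : Module.End ℂ V} (hχ : ∀ x, χ (χ x) = x)
    (hG : ∀ x, χ (G x) = -G (χ x)) (hinj : Function.Injective G) {s : ℂ} (hs : s = 1 ∨ s = -1) :
    2 * finrank ℂ (χ.eigenspace s) = finrank ℂ V := by
  have hle : ∀ t : ℂ, finrank ℂ (χ.eigenspace t) ≤ finrank ℂ (χ.eigenspace (-t)) := by
    intro t
    refine LinearMap.finrank_le_finrank_of_injective
      (f := G.restrict (p := χ.eigenspace t) (q := χ.eigenspace (-t)) fun x hx => ?_) ?_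
    · rw [Module.End.mem_eigenspace_iff] at hx ⊢
      rw [hG, hx, map_smul, neg_smul]
    · intro x y h
      exact Subtype.ext (hinj (congrArg Subtype.val h))
  have heq : finrank ℂ (χ.eigenspace (-s)) = finrank ℂ (χ.eigenspace s) :=
    le_antisymm ((hle (-s)).trans (by rw [neg_neg])) (hle s)
  have hss : s * s = 1 := by rcases hs with rfl | rfl <;> norm_num
  have hrange : LinearMap.range (χ - s • LinearMap.id) = χ.eigenspace (-s) := by
    ext x
    rw [Module.End.mem_eigenspace_iff]
    constructor
    · rintro ⟨y, rfl⟩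
      simp only [LinearMap.sub_apply, LinearMap.smul_apply, LinearMap.id_apply, map_sub, hχ,
        map_smul, smul_sub, smul_smul, neg_mul, neg_smul, hss, one_smul]
      abel
    · intro hx
      refine ⟨(-(s / 2)) • x, ?_⟩
      simp only [LinearMap.sub_apply, LinearMap.smul_apply, LinearMap.id_apply, map_smul, hx]
      rw [← sub_smul, smul_smul]
      have : -(s / 2) * (-s - s) = 1 := by linear_combination hss
      rw [this, one_smul]
  have hker : LinearMap.ker (χ - s • LinearMap.id) = χ.eigenspace s := by
    ext x
    rw [Module.End.mem_eigenspace_iff, LinearMap.mem_ker, LinearMap.sub_apply, sub_eq_zero]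
    rfl
  have := LinearMap.finrank_range_add_finrank_ker (χ - s • LinearMap.id)
  rw [hrange, hker, heq] at this
  omega

/-- The Weyl spinors as a subspace. -/
def weyl {d : ℕ} (Γ : Fin d → SpinorMatrix d) (s : ℂ) : Submodule ℂ (Spinor d) :=
  Module.End.eigenspace (chirality Γ).mulVecLin s

theorem mem_weyl {d : ℕ} {Γ : Fin d → SpinorMatrix d} {s : ℂ} {x : Spinor d} :
    x ∈ weyl Γ s ↔ chirality Γ *ᵥ x = s • x := by
  rw [weyl, Module.End.mem_eigenspace_iff, mulVecLin_apply]

theorem coe_weyl {d : ℕ} (Γ : Fin d → SpinorMatrix d) (s : ℂ) :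
    (weyl Γ s : Set (Spinor d)) = weylSpinors Γ s :=
  Set.ext fun _ => mem_weyl

section Chirality

variable {d : ℕ} {Γ : Fin d → SpinorMatrix d}

theorem IsGammaSystem.mul_chirality (hΓ : IsGammaSystem Γ) (hd : Even d) (a : Fin d) :
    Γ a * chirality Γ = -(chirality Γ * Γ a) := by
  have hodd : Odd (d - 1) := Nat.Even.sub_odd (Fin.pos a) hd odd_one
  rw [chirality, Matrix.mul_smul, hΓ.mul_prod, hodd.neg_one_pow, neg_one_smul, Matrix.smul_mul,
    smul_neg]

theorem IsGammaSystem.mul_mul_chirality (hΓ : IsGammaSystem Γ) (hd : Even d) (a b : Fin d) :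
    Γ a * Γ b * chirality Γ = chirality Γ * (Γ a * Γ b) := by
  rw [Matrix.mul_assoc, hΓ.mul_chirality hd, Matrix.mul_neg, ← Matrix.mul_assoc,
    hΓ.mul_chirality hd, Matrix.neg_mul, neg_neg, Matrix.mul_assoc]

theorem IsGammaSystem.chirality_sq (hΓ : IsGammaSystem Γ)
    (hd : ((-Complex.I) ^ (d / 2)) ^ 2 * (-1) ^ (∑ i ∈ Finset.range d, i) = 1) :
    chirality Γ * chirality Γ = 1 := by
  rw [pow_two] at hd
  rw [chirality, smul_mul_smul_comm, hΓ.prod_sq, smul_smul, hd, one_smul]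

theorem IsGammaSystem.mulVec_injective (hΓ : IsGammaSystem Γ) (a : Fin d) :
    Function.Injective (Γ a).mulVecLin := by
  refine (injective_iff_map_eq_zero _).2 fun x hx => ?_
  have := congrArg (Γ a *ᵥ ·) hx
  simpa [hΓ.sq] using this

theorem IsGammaSystem.finrank_weyl (hΓ : IsGammaSystem Γ) (hd : Even d) (a : Fin d)
    (hd2 : ((-Complex.I) ^ (d / 2)) ^ 2 * (-1) ^ (∑ i ∈ Finset.range d, i) = 1) {s : ℂ}
    (hs : s = 1 ∨ s = -1) : 2 * finrank ℂ (weyl Γ s) = 2 ^ (d / 2) := by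
  rw [weyl, finrank_eigenspace_of_anticommute (G := (Γ a).mulVecLin) (fun x => ?_) (fun x => ?_)
    (hΓ.mulVec_injective a) hs]
  · simp
  · rw [mulVecLin_apply, mulVecLin_apply, mulVec_mulVec, hΓ.chirality_sq hd2, one_mulVec]
  · simp only [mulVecLin_apply, mulVec_mulVec]
    rw [hΓ.mul_chirality hd, neg_mulVec, neg_neg]

theorem IsGammaSystem.mul_mulVec_mem_weyl (hΓ : IsGammaSystem Γ) (hd : Even d) (a b : Fin d)
    {s : ℂ} {x : Spinor d} (hx : x ∈ weyl Γ s) : (Γ a * Γ b) *ᵥ x ∈ weyl Γ s := by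
  rw [mem_weyl] at hx ⊢
  rw [mulVec_mulVec, ← hΓ.mul_mul_chirality hd, ← mulVec_mulVec, hx, mulVec_smul]

end Chirality

/-! ### Seven generators from the quaternionic structure; dimensions five and six -/

section Quaternionic

variable {Y : Type*} [AddCommGroup Y] [Module ℂ Y]

/-- An antilinear map as a real-linear map. -/
def realOfAntilinear (J : Y →ₛₗ[starRingEnd ℂ] Y) : Y →ₗ[ℝ] Y where
  toFun := J
  map_add' := map_add J
  map_smul' r x := by
    rw [← Complex.coe_smul, LinearMap.map_smulₛₗ, Complex.conj_ofReal, Complex.coe_smul,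
      RingHom.id_apply]

/-- Seven anticommuting complex structures made from five complex-linear ones and a quaternionic
structure. -/
def extendClifford (b : Fin 5 → Y →ₗ[ℂ] Y) (J : Y →ₛₗ[starRingEnd ℂ] Y) : Fin 7 → Y →ₗ[ℝ] Y :=
  let j := fun i => realOfAntilinear (J.comp (b i))
  ![j 0, j 1, j 2, j 3, j 4, realOfAntilinear J,
    (Complex.I • LinearMap.id : Y →ₗ[ℂ] Y).restrictScalars ℝ]

theorem extendClifford_six (b : Fin 5 → Y →ₗ[ℂ] Y) (J : Y →ₛₗ[starRingEnd ℂ] Y) (x : Y) :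
    extendClifford b J 6 x = Complex.I • x := rfl

theorem extendClifford_five (b : Fin 5 → Y →ₗ[ℂ] Y) (J : Y →ₛₗ[starRingEnd ℂ] Y) (x : Y) :
    extendClifford b J 5 x = J x := rfl

theorem extendClifford_castLE (b : Fin 5 → Y →ₗ[ℂ] Y) (J : Y →ₛₗ[starRingEnd ℂ] Y) (i : Fin 5)
    (x : Y) : extendClifford b J (Fin.castLE (by norm_num) i) x = J (b i x) := by
  fin_cases i <;> rfl

theorem fin_seven_cases (a : Fin 7) :
    (∃ i : Fin 5, a = Fin.castLE (by norm_num) i) ∨ a = 5 ∨ a = 6 := by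
  by_cases h : a.val < 5
  · exact Or.inl ⟨⟨a.val, h⟩, rfl⟩
  · omega

/-- The generators are $Jb_0,\dots,Jb_4,J,i$. Since $J$ is antilinear with $J^2=-1$ and anticommutes
with the $b_i$, one has $(Jb_i)(Jb_k)=b_ib_k$, and $i$ anticommutes with each of the other six. -/
theorem IsComplexClifford.isClifford_extend {b : Fin 5 → Y →ₗ[ℂ] Y} (hb : IsComplexClifford b)
    {J : Y →ₛₗ[starRingEnd ℂ] Y} (hJ : ∀ x, J (J x) = -x) (hJb : ∀ i x, J (b i x) = -b i (J x)) :
    IsClifford (extendClifford b J) := by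
  intro a c x
  have h5 : ∀ i : Fin 5, Fin.castLE (show 5 ≤ 7 by norm_num) i ≠ 5 := fun i h => by
    have := congrArg Fin.val h
    simp at this; omega
  have h6 : ∀ i : Fin 5, Fin.castLE (show 5 ≤ 7 by norm_num) i ≠ 6 := fun i h => by
    have := congrArg Fin.val h
    simp at this; omega
  have hI : ∀ y, J (Complex.I • y) = -(Complex.I • J y) := fun y => by
    rw [LinearMap.map_smulₛₗ, Complex.conj_I, neg_smul]
  obtain ⟨i, rfl⟩ | rfl | rfl := fin_seven_cases a <;>
    obtain ⟨k, rfl⟩ | rfl | rfl := fin_seven_cases c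
  · simp only [extendClifford_castLE, Fin.castLE_inj]
    have h : ∀ i y, J (b i (J y)) = b i y := fun i y => by rw [hJb, hJ, map_neg, neg_neg]
    rw [h, h, hb]
    split_ifs
    · rw [← Complex.coe_smul]; norm_num
    · rfl
  · rw [if_neg (h5 i), extendClifford_castLE, extendClifford_five, extendClifford_five,
      extendClifford_castLE, hJ, hJb, hJ]
    simp
  · rw [if_neg (h6 i), extendClifford_castLE, extendClifford_six, extendClifford_six,
      extendClifford_castLE, map_smul, hI, neg_add_cancel]
  · rw [if_neg (h5 k).symm, extendClifford_castLE, extendClifford_five, extendClifford_five,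
      extendClifford_castLE, hJ, hJb, hJ]
    simp
  · rw [if_pos rfl, extendClifford_five, extendClifford_five, hJ]
    module
  · rw [if_neg (by decide), extendClifford_five, extendClifford_six, extendClifford_six,
      extendClifford_five, hI, neg_add_cancel]
  · rw [if_neg (h6 k).symm, extendClifford_castLE, extendClifford_six, extendClifford_six,
      extendClifford_castLE, map_smul, hI, add_neg_cancel]
  · rw [if_neg (by decide), extendClifford_five, extendClifford_six, extendClifford_six,
      extendClifford_five, hI, add_neg_cancel]
  · rw [if_pos rfl, extendClifford_six, extendClifford_six, smul_smul, Complex.I_mul_I]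
    module

end Quaternionic

theorem finrank_restrictScalars {V : Type*} [AddCommGroup V] [Module ℂ V] (W : Submodule ℂ V) :
    finrank ℝ (W.restrictScalars ℝ) = 2 * finrank ℂ W :=
  finrank_real_of_complex W

theorem IsSystem.form_five {n : ℕ} {S : Set (Matrix (Fin 5) (Fin 5) ℝ)} (h : IsSystem 5 n S)
    (h0 : n ≠ 0) : (n ≤ 2 ∧ HasForm 2 S) ∨ (2 ≤ n ∧ ∀ F ∈ S, F = 0) := by
  obtain ⟨Γ, hΓ, A, -, W, -, hn, rfl⟩ := h
  -- The factor $i$ turns $\Gamma_a^2=1$ into square $-1$.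
  let b : Fin 5 → Spinor 5 →ₗ[ℂ] Spinor 5 := fun i => (Complex.I • Γ i).mulVecLin
  have hbb : ∀ i j x, b i (b j x) = -((Γ i * Γ j) *ᵥ x) := by
    intro i j x
    change (Complex.I • Γ i) *ᵥ ((Complex.I • Γ j) *ᵥ x) = _
    rw [smul_mulVec, smul_mulVec, mulVec_smul, mulVec_mulVec, smul_smul, Complex.I_mul_I,
      neg_one_smul]
  have hb : IsComplexClifford b := by
    intro i j x
    rw [hbb, hbb, ← neg_add, hΓ.mulVec_add]
    split_ifs
    · rw [← Complex.coe_smul]; push_cast; module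
    · exact neg_zero
  have h4 : finrank ℂ (Spinor 5) = 4 := by simp
  obtain ⟨J, hJ, hJb⟩ := hb.exists_quaternionic h4
  have hX : finrank ℝ (Spinor 5) = 8 := by rw [finrank_real_of_complex, h4]
  refine IsAnnihilator.form_five hX (hb.isClifford_extend hJ hJb) (W := W.restrictScalars ℝ)
    (fun x hx => ?_) (isAnnihilator_of_embedding (Γ := Γ) (by norm_num) LinearMap.id
      Function.injective_id (fun i j x => ?_) ?_) ((finrank_restrictScalars W).trans (by rw [hn])) h0
  · rw [extendClifford_six]
    exact W.smul_mem _ hx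
  · rw [LinearMap.id_apply, LinearMap.id_apply, extendClifford_castLE, extendClifford_castLE, hJb,
      hJ, map_neg, neg_neg, hbb]
  · ext x; simp

theorem IsSystem.form_six {n : ℕ} {S : Set (Matrix (Fin 6) (Fin 6) ℝ)} (h : IsSystem 6 n S)
    (h0 : n ≠ 0) : (n ≤ 2 ∧ HasForm n S) ∨ (3 ≤ n ∧ ∀ F ∈ S, F = 0) := by
  obtain ⟨Γ, hΓ, A, hA, W, hW, hn, rfl⟩ := h
  rw [IsParameterSpace, if_neg (by norm_num), if_neg (by norm_num), if_pos (by decide)] at hA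
  obtain ⟨s, hs, rfl⟩ := hA
  have hd : Even 6 := by decide
  have hWY : W ≤ weyl Γ s := by
    rw [hW, Submodule.span_le, coe_weyl]
    exact Set.inter_subset_left
  have h4 : finrank ℂ (weyl Γ s) = 4 := by
    have := hΓ.finrank_weyl hd 0 (by
      have : ∑ i ∈ Finset.range 6, i = 15 := rfl
      rw [this, ← pow_mul, Even.neg_pow (by decide)]
      have : (6 / 2 * 2) = 4 + 2 := rfl
      rw [this, pow_add, Complex.I_pow_four, Complex.I_sq]
      norm_num) hs
    norm_num at this
    omega
  -- The products $\Gamma_5\Gamma_i$, $i<5$, preserve chirality and anticommute. The sixth direction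
  -- is then represented by $J$ itself, since $J\,(Jb_i)=-\Gamma_5\Gamma_i$.
  let b : Fin 5 → weyl Γ s →ₗ[ℂ] weyl Γ s := fun i =>
    (Γ 5 * Γ (Fin.castSucc i)).mulVecLin.restrict fun x hx => hΓ.mul_mulVec_mem_weyl hd _ _ hx
  have hb1 : ∀ i x, ((b i x : weyl Γ s) : Spinor 6) = (Γ 5 * Γ (Fin.castSucc i)) *ᵥ (x : Spinor 6) :=
    fun i x => rfl
  have hne : ∀ i : Fin 5, Fin.castSucc i ≠ 5 := fun i => (Fin.castSucc_lt_last i).ne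
  have hbb : ∀ i j x, ((b i (b j x) : weyl Γ s) : Spinor 6) =
      -((Γ (Fin.castSucc i) * Γ (Fin.castSucc j)) *ᵥ (x : Spinor 6)) := by
    intro i j x
    rw [hb1, hb1, mulVec_mulVec, hΓ.anti (hne i).symm, Matrix.neg_mul, Matrix.mul_assoc,
      hΓ.sq_assoc, neg_mulVec]
  have hb : IsComplexClifford b := by
    intro i j x
    apply Subtype.ext
    rw [Submodule.coe_add, hbb, hbb, ← neg_add, hΓ.mulVec_add]
    simp only [Fin.castSucc_inj]
    split_ifs
    · rw [Submodule.coe_smul, ← Complex.coe_smul]; push_cast; module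
    · simp
  obtain ⟨J, hJ, hJb⟩ := hb.exists_quaternionic h4
  have hX : finrank ℝ (weyl Γ s) = 8 := by rw [finrank_real_of_complex, h4]
  let U : Submodule ℂ (weyl Γ s) := W.comap (weyl Γ s).subtype
  have hU : finrank ℂ U = n := by
    rw [← hn]
    exact (Submodule.comapSubtypeEquivOfLe hWY).finrank_eq
  have hcases : ∀ a : Fin 6, a = 5 ∨ ∃ i : Fin 5, a = Fin.castSucc i := fun a => by
    by_cases h : a.val < 5
    · exact Or.inr ⟨⟨a.val, h⟩, rfl⟩
    · exact Or.inl (by omega)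
  have hc : ∀ (i : Fin 5) (x : weyl Γ s),
      extendClifford b J (Fin.castLE (by norm_num) (Fin.castSucc i)) x = J (b i x) :=
    fun i x => extendClifford_castLE b J i x
  have hc5 : ∀ x : weyl Γ s, extendClifford b J (Fin.castLE (by norm_num) (5 : Fin 6)) x = J x :=
    fun x => rfl
  refine IsAnnihilator.form_six hX (hb.isClifford_extend hJ hJb) (W := U.restrictScalars ℝ)
    (fun x hx => ?_) (isAnnihilator_of_embedding (Γ := Γ) (by norm_num)
      ((weyl Γ s).subtype.restrictScalars ℝ) (weyl Γ s).subtype_injective (fun i j x => ?_) ?_)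
    ((finrank_restrictScalars U).trans (by rw [hU])) h0
  · rw [extendClifford_six]
    exact U.smul_mem _ hx
  · change ((_ : weyl Γ s) : Spinor 6) = -(_ *ᵥ (x : Spinor 6))
    obtain rfl | ⟨i, rfl⟩ := hcases i <;> obtain rfl | ⟨j, rfl⟩ := hcases j
    · rw [hc5, hc5, hJ, hΓ.sq, one_mulVec]; rfl
    · rw [hc5, hc, hJ, Submodule.coe_neg, hb1]
    · rw [hc5, hc, hJb, hJ, map_neg, neg_neg, hb1, hΓ.anti (hne i), neg_mulVec, neg_neg]
    · rw [hc, hc, hJb, hJ, map_neg, neg_neg, hbb]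
  · have : ((weyl Γ s).subtype.restrictScalars ℝ '' (U.restrictScalars ℝ) : Set (Spinor 6)) = W := by
      ext x
      constructor
      · rintro ⟨y, hy, rfl⟩; exact hy
      · intro hx; exact ⟨⟨x, hWY hx⟩, hx, rfl⟩
    rw [this, Submodule.span_eq]

/-! ### Orthonormal bases, and octonion bases for a given set of generators -/

section OrthonormalBasis

variable {X : Type*} [AddCommGroup X] [Module ℝ X] [FiniteDimensional ℝ X]

theorem exists_orthonormal_adapted {g : LinearMap.BilinForm ℝ X} (hsymm : ∀ x y, g x y = g y x)
    (hpos : ∀ x, x ≠ 0 → 0 < g x x) {n : ℕ} (hn : finrank ℝ X = n) (W : Submodule ℝ X) :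
    ∃ ψ : Fin n → X, (∀ i j, g (ψ i) (ψ j) = if i = j then 1 else 0) ∧
      W = Submodule.span ℝ (ψ '' {i | i.val < finrank ℝ W}) := by
  let core : InnerProductSpace.Core ℝ X :=
    { inner := fun x y => g x y
      conj_inner_symm := fun x y => hsymm y x
      re_inner_nonneg := fun x => by
        by_cases h : x = 0
        · simp [h]
        · exact (hpos x h).le
      definite := fun x h => by
        by_contra hx
        exact (hpos x hx).ne' h
      add_left := fun x y z => by simp
      smul_left := fun x y r => by simp }
  let _ : NormedAddCommGroup X := core.toNormedAddCommGroup
  let _ : InnerProductSpace ℝ X := InnerProductSpace.ofCore core.toCore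
  have hinner : ∀ x y : X, inner ℝ x y = g x y := fun x y => rfl
  have hle : finrank ℝ W ≤ n := hn ▸ Submodule.finrank_le W
  let b := stdOrthonormalBasis ℝ W
  let v : Fin n → X := fun i => if h : i.val < finrank ℝ W then (b ⟨i.val, h⟩ : X) else 0
  let s : Set (Fin n) := {i | i.val < finrank ℝ W}
  have hv : ∀ i (h : i ∈ s), v i = b ⟨i.val, h⟩ := fun i h => dif_pos h
  have hon : Orthonormal ℝ (s.domRestrict v) := by
    have h1 := (b.orthonormal.comp_linearIsometry W.subtypeₗᵢ).comp
      (fun i : s => (⟨i.1.val, i.2⟩ : Fin (finrank ℝ W))) fun i j h =>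
        Subtype.ext (Fin.ext (Fin.mk.inj_iff.1 h))
    convert h1 using 1
    funext i
    exact hv i.1 i.2
  obtain ⟨ψ, hψ⟩ := hon.exists_orthonormalBasis_extension_of_card_eq (by simpa using hn)
  refine ⟨ψ, fun i j => ?_, ?_⟩
  · rw [← hinner]
    exact orthonormal_iff_ite.1 ψ.orthonormal i j
  · have himg : ψ '' s = Set.range fun i => (b i : X) := by
      ext x
      constructor
      · rintro ⟨i, hi, rfl⟩
        exact ⟨_, ((hψ i hi).trans (hv i hi)).symm⟩
      · rintro ⟨i, rfl⟩
        have hi : (⟨i.val, i.2.trans_le hle⟩ : Fin n) ∈ s := i.2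
        exact ⟨_, hi, (hψ _ hi).trans (hv _ hi)⟩
    rw [himg]
    have h2 := b.toBasis.span_eq
    have h3 := congrArg (Submodule.map W.subtype) h2
    rw [Submodule.map_span, Submodule.map_subtype_top, ← Set.range_comp] at h3
    refine h3.symm.trans ?_
    congr 2

theorem sum_orthonormal {g : LinearMap.BilinForm ℝ X} {n : ℕ} (hn : finrank ℝ X = n)
    {u : Fin n → X} (hu : ∀ i j, g (u i) (u j) = if i = j then 1 else 0) (x y : X) :
    ∑ c, g (u c) x * g (u c) y = g x y := by
  have hli : LinearIndependent ℝ u := by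
    rw [Fintype.linearIndependent_iff]
    intro t ht i
    have := congrArg (g (u i)) ht
    simpa [map_sum, hu] using this
  let b := basisOfLinearIndependentOfCardEqFinrank' u hli (by simpa using hn.symm)
  have hb : ∀ i, b i = u i := fun i => by simp [b]
  have hx : x = ∑ i, b.repr x i • u i := by
    conv_lhs => rw [← b.sum_repr x]
    simp only [hb]
  have hy : y = ∑ i, b.repr y i • u i := by
    conv_lhs => rw [← b.sum_repr y]
    simp only [hb]
  have h1 : ∀ c, g (u c) x = b.repr x c := fun c => by
    conv_lhs => rw [hx]
    simp [map_sum, hu]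
  have h2 : ∀ c, g (u c) y = b.repr y c := fun c => by
    conv_lhs => rw [hy]
    simp [map_sum, hu]
  conv_rhs => rw [hx]
  simp [map_sum, LinearMap.sum_apply, h1, h2]

end OrthonormalBasis

section FixedGenerators

variable {X : Type*} [AddCommGroup X] [Module ℝ X]

theorem IsClifford.injective {B : Fin 7 → X →ₗ[ℝ] X} (hB : IsClifford B) (i : Fin 7) :
    Function.Injective (B i) := by
  refine (injective_iff_map_eq_zero _).2 fun x hx => ?_
  have := hB.sq i x
  rw [hx, map_zero] at this
  exact neg_eq_zero.1 this.symm

/-- The three relations say that $e$ has eigenvalue $-1$ for the commuting involutions $B_4B_6B_5$,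
$B_2B_6B_3$ and $B_1B_5B_3$. Each of $B_3,B_5,B_6$ flips one of them while commuting with those
already fixed. -/
theorem IsClifford.exists_eigenvector [Nontrivial X] {B : Fin 7 → X →ₗ[ℝ] X} (hB : IsClifford B) :
    ∃ e : X, e ≠ 0 ∧ B 6 (B 5 e) = B 4 e ∧ B 6 (B 3 e) = B 2 e ∧ B 5 (B 3 e) = B 1 e := by
  have a56 := hB.anti (show (5 : Fin 7) ≠ 6 by decide)
  have a46 := hB.anti (show (4 : Fin 7) ≠ 6 by decide)
  have a45 := hB.anti (show (4 : Fin 7) ≠ 5 by decide)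
  have a36 := hB.anti (show (3 : Fin 7) ≠ 6 by decide)
  have a35 := hB.anti (show (3 : Fin 7) ≠ 5 by decide)
  have a34 := hB.anti (show (3 : Fin 7) ≠ 4 by decide)
  have a26 := hB.anti (show (2 : Fin 7) ≠ 6 by decide)
  have a25 := hB.anti (show (2 : Fin 7) ≠ 5 by decide)
  have a24 := hB.anti (show (2 : Fin 7) ≠ 4 by decide)
  have a23 := hB.anti (show (2 : Fin 7) ≠ 3 by decide)
  have a16 := hB.anti (show (1 : Fin 7) ≠ 6 by decide)
  have a15 := hB.anti (show (1 : Fin 7) ≠ 5 by decide)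
  have a14 := hB.anti (show (1 : Fin 7) ≠ 4 by decide)
  have a13 := hB.anti (show (1 : Fin 7) ≠ 3 by decide)
  have a12 := hB.anti (show (1 : Fin 7) ≠ 2 by decide)
  have s := hB.sq
  let P₄ : X →ₗ[ℝ] X := B 4 ∘ₗ B 6 ∘ₗ B 5
  let P₂ : X →ₗ[ℝ] X := B 2 ∘ₗ B 6 ∘ₗ B 3
  let P₁ : X →ₗ[ℝ] X := B 1 ∘ₗ B 5 ∘ₗ B 3
  have c24 : ∀ x, P₄ (P₂ x) = P₂ (P₄ x) := fun x => by
    simp [P₂, P₄, a56, a46, a45, a36, a35, a34, a26, a25, a24, a23, s]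
  have c14 : ∀ x, P₄ (P₁ x) = P₁ (P₄ x) := fun x => by
    simp [P₁, P₄, a56, a46, a45, a36, a35, a34, a16, a15, a14, a13, s]
  have c12 : ∀ x, P₂ (P₁ x) = P₁ (P₂ x) := fun x => by
    simp [P₁, P₂, a56, a36, a35, a26, a25, a23, a16, a15, a12, a13, s]
  have g45 : ∀ x, P₄ (B 5 x) = B 5 (P₄ x) := fun x => by simp [P₄, a56, a46, a45, s]
  have g46 : ∀ x, P₄ (B 6 x) = B 6 (P₄ x) := fun x => by simp [P₄, a56, a46, s]
  have g26 : ∀ x, P₂ (B 6 x) = B 6 (P₂ x) := fun x => by simp [P₂, a36, a26, s]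
  obtain ⟨U, hU, -, hUm⟩ := exists_neg_eigenvector (K := ℝ) (U := (⊤ : Submodule ℝ X)) top_ne_bot
    (P := P₄) (G := B 3) (fun x => by simp [P₄, a56, a46, a45, s])
    (fun x => by simp [P₄, a46, a45, a36, a35, a34]) (hB.injective 3) (by simp) (by simp)
  have hUm' : ∀ x, x ∈ U ↔ P₄ x = -x := fun x => by rw [hUm]; simp
  obtain ⟨V, hV, -, hVm⟩ := exists_neg_eigenvector (K := ℝ) hU
    (P := P₂) (G := B 5) (fun x => by simp [P₂, a36, a26, a23, s])
    (fun x => by simp [P₂, a56, a35, a26, a25, a23]) (hB.injective 5)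
    (fun x hx => by rw [hUm'] at hx ⊢; rw [c24, hx, map_neg])
    (fun x hx => by rw [hUm'] at hx ⊢; rw [g45, hx, map_neg])
  obtain ⟨W, hW, -, hWm⟩ := exists_neg_eigenvector (K := ℝ) hV
    (P := P₁) (G := B 6) (fun x => by simp [P₁, a35, a15, a13, s])
    (fun x => by simp [P₁, a56, a36, a16, a15, a13]) (hB.injective 6)
    (fun x hx => by
      rw [hVm, hUm'] at hx ⊢
      rw [c14, c12, hx.1, hx.2, map_neg]
      exact ⟨rfl, rfl⟩)
    (fun x hx => by
      rw [hVm, hUm'] at hx ⊢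
      rw [g46, g26, hx.1, hx.2, map_neg]
      exact ⟨rfl, rfl⟩)
  obtain ⟨e, heW, he⟩ := Submodule.exists_mem_ne_zero_of_ne_bot hW
  rw [hWm, hVm, hUm'] at heW
  obtain ⟨⟨h4, h2⟩, h1⟩ := heW
  have key : ∀ i x, B i x = -e → x = B i e := fun i x h => by
    have := congrArg (B i) h
    rwa [s, map_neg, neg_inj] at this
  exact ⟨e, he, key 4 _ h4, key 2 _ h2, key 1 _ h1⟩

/-- A Clifford module of dimension eight has a standard basis, up to the sign of one generator. -/
theorem IsClifford.exists_adapted_sign [FiniteDimensional ℝ X] (hX : finrank ℝ X = 8) {B : Fin 7 → X →ₗ[ℝ] X}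
    (hB : IsClifford B) : ∃ e : X, e ≠ 0 ∧ ∃ σ : ℝ, σ * σ = 1 ∧
      Adapted (fun a => if a = 0 then σ • B a else B a) e := by
  have : Nontrivial X := nontrivial_of_finrank_pos (R := ℝ) (by omega)
  obtain ⟨e, he, h4, h2, h1⟩ := hB.exists_eigenvector
  have hd : ∀ a b : Fin 7, (Pi.single a 1 : Fin 7 → ℝ) ⬝ᵥ Pi.single b 1 = if a = b then 1 else 0 :=
    fun a b => by simp [Pi.single_apply, eq_comm]
  obtain ⟨R, hR, r6, r5, r4, r3, had⟩ := hB.exists_adapted hX he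
    (u₆ := Pi.single 6 1) (u₅ := Pi.single 5 1) (u₄ := Pi.single 4 1) (u₃ := Pi.single 3 1)
    (by simp) (by simp) (by simp) (by simp) (by simp) (by simp) (by simpa using h4) (by simp)
  have e6 : rot B R 6 = B 6 := by rw [rot, r6, cl_single]
  have e5 : rot B R 5 = B 5 := by rw [rot, r5, cl_single]
  have e4 : rot B R 4 = B 4 := by rw [rot, r4, cl_single]
  have e3 : rot B R 3 = B 3 := by rw [rot, r3, cl_single]
  have r2 : R 2 = Pi.single 2 1 := hB.cl_injective he (by
    have := had.rel₂
    rw [e6, e3, h2] at this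
    rw [cl_single]; exact this.symm)
  have r1 : R 1 = Pi.single 1 1 := hB.cl_injective he (by
    have := had.rel₁
    rw [e5, e3, h1] at this
    rw [cl_single]; exact this.symm)
  have hdot : ∀ a b, R a ⬝ᵥ R b = if a = b then 1 else 0 := fun a b => by
    rw [← one_apply, ← hR]; rfl
  have hz : ∀ a, a ≠ 0 → R a = Pi.single a 1 → R 0 a = 0 := fun a ha h => by
    have := hdot 0 a
    rw [h, if_neg ha.symm] at this
    simpa using this
  -- An adapted frame extending the given four generators must agree with the standard one except in
  -- the last unit vector, where orthogonality leaves a sign. It distinguishes the two irreducible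
  -- Clifford modules.
  have r0 : R 0 = R 0 0 • Pi.single 0 1 := by
    ext a
    fin_cases a
    · simp
    · simpa using hz 1 (by decide) r1
    · simpa using hz 2 (by decide) r2
    · simpa using hz 3 (by decide) r3
    · simpa using hz 4 (by decide) r4
    · simpa using hz 5 (by decide) r5
    · simpa using hz 6 (by decide) r6
  refine ⟨e, he, R 0 0, ?_, h4, h2, h1, ?_⟩
  · have := hdot 0 0
    rw [r0] at this
    simpa using this
  · have := had.rel₀
    rw [e4, e3, rot, r0, map_smul, cl_single] at this
    exact this

end FixedGenerators

/-! ### Triality and dimension eight -/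

section Triality

variable {X : Type*} [AddCommGroup X] [Module ℝ X]

/-- Clifford multiplication by the basis vectors of `ℝ^8`, where the last one is the identity. -/
def cl8 (B : Fin 7 → X →ₗ[ℝ] X) (a : Fin 8) : X →ₗ[ℝ] X :=
  Fin.lastCases (motive := fun _ => X →ₗ[ℝ] X) LinearMap.id B a

theorem cl8_last (B : Fin 7 → X →ₗ[ℝ] X) : cl8 B (Fin.last 7) = LinearMap.id :=
  Fin.lastCases_last

theorem cl8_castSucc (B : Fin 7 → X →ₗ[ℝ] X) (a : Fin 7) : cl8 B a.castSucc = B a :=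
  Fin.lastCases_castSucc a

/-- The matrix of inner products of Clifford multiples of two spinors. -/
def pairing (B : Fin 7 → X →ₗ[ℝ] X) (g : LinearMap.BilinForm ℝ X) (x y : X) :
    Matrix (Fin 8) (Fin 8) ℝ := of fun a b => g (cl8 B a x) (cl8 B b y)

variable {B : Fin 7 → X →ₗ[ℝ] X} {g : LinearMap.BilinForm ℝ X}

theorem pairing_add_transpose (hB : IsClifford B) (hg : IsInvariantForm B g) (x y : X) :
    pairing B g x y + (pairing B g x y)ᵀ = (2 * g x y) • (1 : Matrix (Fin 8) (Fin 8) ℝ) := by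
  ext a b
  rw [Matrix.add_apply, transpose_apply, Matrix.smul_apply, one_apply, smul_eq_mul]
  change g (cl8 B a x) (cl8 B b y) + g (cl8 B b x) (cl8 B a y) = _
  refine Fin.lastCases ?_ (fun a => ?_) a <;> refine Fin.lastCases ?_ (fun b => ?_) b
  · simp only [cl8_last, LinearMap.id_apply, if_true]; ring
  · rw [if_neg (Fin.castSucc_lt_last b).ne']
    simp only [cl8_last, cl8_castSucc, LinearMap.id_apply, hg.skew]; ring
  · rw [if_neg (Fin.castSucc_lt_last a).ne]
    simp only [cl8_last, cl8_castSucc, LinearMap.id_apply, hg.skew]; ring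
  · have := congrArg (g x) (hB a b y)
    simp only [cl8_castSucc, hg.skew, Fin.castSucc_inj]
    rw [map_add] at this
    split_ifs at this ⊢
    · rw [map_smul, smul_eq_mul] at this; linarith
    · rw [map_zero] at this; linarith

theorem pairing_transpose (hg : IsInvariantForm B g) (x y : X) :
    (pairing B g x y)ᵀ = pairing B g y x := by
  ext a b
  exact hg.symm _ _

theorem pairing_self (hB : IsClifford B) (hg : IsInvariantForm B g) {x : X} (hx : g x x = 1) :
    pairing B g x x = 1 := by
  have h := pairing_add_transpose hB hg x x
  rw [pairing_transpose hg, hx, ← two_smul ℝ, mul_one] at h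
  exact smul_right_injective _ (two_ne_zero' ℝ) h

/-- For a unit spinor $z$ the eight vectors `cl8 B c z` are an orthonormal basis of $X$, so this is
Parseval's identity. It makes the matrices that pair $z$ with spinors orthogonal to it satisfy
Clifford relations on $\mathbb R^8$. -/
theorem pairing_eq_mul [FiniteDimensional ℝ X] (hX : finrank ℝ X = 8) (hB : IsClifford B)
    (hg : IsInvariantForm B g) {z : X} (hz : g z z = 1) (x y : X) :
    pairing B g x y = (pairing B g z x)ᵀ * pairing B g z y := by
  ext a b
  have hu : ∀ i j, g (cl8 B i z) (cl8 B j z) = if i = j then 1 else 0 := fun i j => by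
    have := congrFun (congrFun (pairing_self hB hg hz) i) j
    rwa [one_apply] at this
  exact (sum_orthonormal hX hu (cl8 B a x) (cl8 B b y)).symm

/-- The columns of left multiplication by the units in the standard basis of the octonions. -/
def octMatrix (i : Fin 7) : Matrix (Fin 8) (Fin 8) ℝ :=
  of fun a b => Fin.lastCases (motive := fun _ => ℝ) (if a = i.castSucc then 1 else 0)
    (fun c => if i = c then (if a = Fin.last 7 then -1 else 0) else
      if a = (octThird i c).castSucc then octSign i c else 0) b

theorem Adapted.apply_cl8 (hB : IsClifford B) {e : X} (h : Adapted B e) (i : Fin 7) (b : Fin 8) :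
    B i (cl8 B b e) = ∑ a, octMatrix i a b • cl8 B a e := by
  refine Fin.lastCases ?_ (fun c => ?_) b
  · simp only [octMatrix, of_apply, Fin.lastCases_last, cl8_last, LinearMap.id_apply, ite_smul,
      one_smul, zero_smul]
    rw [Finset.sum_ite_eq', if_pos (Finset.mem_univ _), cl8_castSucc]
  · simp only [octMatrix, of_apply, Fin.lastCases_castSucc, cl8_castSucc]
    by_cases hic : i = c
    · subst hic
      simp only [if_true, ite_smul, zero_smul, neg_smul, one_smul]
      rw [Finset.sum_ite_eq', if_pos (Finset.mem_univ _), cl8_last, hB.sq, LinearMap.id_apply]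
    · simp only [if_neg hic, ite_smul, zero_smul]
      rw [Finset.sum_ite_eq', if_pos (Finset.mem_univ _), cl8_castSucc, h.mul_apply hB hic]

/-- In the orthonormal frame of a normalized adapted spinor and its seven multiples, the generators
have the octonion structure constants as entries. -/
theorem exists_conj_octMatrix {M : Fin 7 → Matrix (Fin 8) (Fin 8) ℝ}
    (hM : IsClifford fun i => (M i).mulVecLin) (hsk : ∀ i, (M i)ᵀ = -M i) {e : Fin 8 → ℝ}
    (he : e ≠ 0) (h : Adapted (fun i => (M i).mulVecLin) e) :
    ∃ R : Matrix (Fin 8) (Fin 8) ℝ, R * Rᵀ = 1 ∧ ∀ i, R * M i * Rᵀ = octMatrix i := by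
  let D : Fin 7 → (Fin 8 → ℝ) →ₗ[ℝ] (Fin 8 → ℝ) := fun i => (M i).mulVecLin
  let g : LinearMap.BilinForm ℝ (Fin 8 → ℝ) := dotProductBilin ℝ ℝ
  have hg : IsInvariantForm D g :=
    { symm := fun x y => dotProduct_comm x y
      pos := fun x hx => by
        change 0 < x ⬝ᵥ x
        refine lt_of_le_of_ne ?_ fun h => hx (dotProduct_self_eq_zero.1 h.symm)
        simpa [dotProduct] using Finset.sum_nonneg fun i _ => mul_self_nonneg (x i)
      skew := fun i x y => by
        change (M i *ᵥ x) ⬝ᵥ y = -(x ⬝ᵥ (M i *ᵥ y))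
        rw [dotProduct_mulVec, ← mulVec_transpose, hsk, neg_mulVec, neg_dotProduct, neg_neg] }
  have hpos : 0 < e ⬝ᵥ e := hg.pos e he
  let f : Fin 8 → ℝ := (Real.sqrt (e ⬝ᵥ e))⁻¹ • e
  have hf : f ⬝ᵥ f = 1 := by
    rw [smul_dotProduct, dotProduct_smul, smul_eq_mul, smul_eq_mul, ← mul_assoc, ← mul_inv,
      Real.mul_self_sqrt hpos.le, inv_mul_cancel₀ hpos.ne']
  have had : Adapted D f := by
    obtain ⟨h4, h2, h1, h0⟩ := h
    constructor <;> simp only [D, f, map_smul, h4, h2, h1, h0]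
  let R : Matrix (Fin 8) (Fin 8) ℝ := of fun a => cl8 D a f
  have hR : R * Rᵀ = 1 := pairing_self hM hg hf
  refine ⟨R, hR, fun i => ?_⟩
  have hcol : M i * Rᵀ = Rᵀ * octMatrix i := by
    ext k b
    have := congrFun (had.apply_cl8 hM i b) k
    rw [Finset.sum_apply] at this
    refine Eq.trans this ?_
    rw [Matrix.mul_apply]
    refine Finset.sum_congr rfl fun a _ => ?_
    rw [Pi.smul_apply, smul_eq_mul, mul_comm]
    rfl
  rw [Matrix.mul_assoc, hcol, ← Matrix.mul_assoc, hR, Matrix.one_mul]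

/-- Left multiplication by octonions in the standard basis. -/
def octMatrix8 (i : Fin 8) : Matrix (Fin 8) (Fin 8) ℝ :=
  Fin.lastCases (motive := fun _ => Matrix (Fin 8) (Fin 8) ℝ) 1 octMatrix i

/-- The skew-symmetric matrices that annihilate the first `k` vectors of a spinor basis. -/
def model8 (k : ℕ) : Set (Matrix (Fin 8) (Fin 8) ℝ) :=
  {F | Fᵀ = -F ∧ ∀ i j : Fin 8, i.val < k → (F * ((octMatrix8 j)ᵀ * octMatrix8 i)ᵀ).trace = 0}

theorem octMatrix8_last : octMatrix8 (Fin.last 7) = 1 :=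
  Fin.lastCases_last

theorem octMatrix8_castSucc (i : Fin 7) : octMatrix8 i.castSucc = octMatrix i :=
  Fin.lastCases_castSucc i

/-- Here the pairings of the last basis spinor with the others serve as generators acting on
vectors. Replacing a basis spinor by its negative absorbs the sign left open by
`exists_adapted_sign`, without changing any span. -/
theorem exists_conj_octMatrix8 [FiniteDimensional ℝ X] (hX : finrank ℝ X = 8)
    (hB : IsClifford B) (hg : IsInvariantForm B g) {ψ : Fin 8 → X}
    (hψ : ∀ i j, g (ψ i) (ψ j) = if i = j then 1 else 0) :
    ∃ R : Matrix (Fin 8) (Fin 8) ℝ, R * Rᵀ = 1 ∧ ∃ σ : Fin 8 → ℝ, (∀ i, σ i * σ i = 1) ∧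
      ∀ i, σ i • (R * pairing B g (ψ (Fin.last 7)) (ψ i) * Rᵀ) = octMatrix8 i := by
  let M : Fin 7 → Matrix (Fin 8) (Fin 8) ℝ := fun i => pairing B g (ψ (Fin.last 7)) (ψ i.castSucc)
  have hz : g (ψ (Fin.last 7)) (ψ (Fin.last 7)) = 1 := by rw [hψ, if_pos rfl]
  have hsk : ∀ i, (M i)ᵀ = -M i := fun i => by
    have := pairing_add_transpose hB hg (ψ (Fin.last 7)) (ψ i.castSucc)
    rw [hψ, if_neg (Fin.castSucc_lt_last i).ne', mul_zero, zero_smul] at this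
    exact (neg_eq_of_add_eq_zero_right this).symm
  have hmul : ∀ i j, pairing B g (ψ i.castSucc) (ψ j.castSucc) = -(M i * M j) := fun i j => by
    rw [pairing_eq_mul hX hB hg hz, ← Matrix.neg_mul, ← hsk]
  have hM : IsClifford fun i => (M i).mulVecLin := by
    intro i j x
    change M i *ᵥ (M j *ᵥ x) + M j *ᵥ (M i *ᵥ x) = _
    have := pairing_add_transpose hB hg (ψ i.castSucc) (ψ j.castSucc)
    rw [pairing_transpose hg, hmul, hmul, ← neg_add, neg_eq_iff_eq_neg, hψ] at this
    rw [mulVec_mulVec, mulVec_mulVec, ← Matrix.add_mulVec, this, Matrix.neg_mulVec,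
      smul_mulVec, one_mulVec]
    simp only [Fin.castSucc_inj]
    split_ifs
    · rw [mul_one, neg_smul]
    · rw [mul_zero, zero_smul, neg_zero]
  obtain ⟨e, he, σ, hσ, had⟩ := hM.exists_adapted_sign (by simp)
  let N : Fin 7 → Matrix (Fin 8) (Fin 8) ℝ := fun i => (if i = 0 then σ else 1) • M i
  have hNM : ∀ i, (N i).mulVecLin = (if i = 0 then σ else 1 : ℝ) • (M i).mulVecLin := fun i =>
    LinearMap.ext fun x => smul_mulVec (_ : ℝ) (M i) x
  have hN : IsClifford fun i => (N i).mulVecLin := by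
    intro i j x
    simp only [hNM, LinearMap.smul_apply, map_smul]
    rw [smul_smul, smul_smul, mul_comm (if j = 0 then σ else 1 : ℝ), ← smul_add]
    refine (congrArg _ (hM i j x)).trans ?_
    split_ifs with h1 h2
    all_goals first
      | exact smul_zero _
      | skip
    all_goals subst_vars
    all_goals simp_all
  have hadN : Adapted (fun i => (N i).mulVecLin) e := by
    convert had using 2 with i
    rw [hNM]
    split_ifs
    · rfl
    · exact one_smul _ _
  obtain ⟨R, hR, h⟩ := exists_conj_octMatrix hN (fun i => by
    rw [transpose_smul, hsk, smul_neg]) he hadN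
  refine ⟨R, hR, fun i => if i = 0 then σ else 1, fun i => ?_, fun i => ?_⟩
  · beta_reduce
    split_ifs
    · exact hσ
    · exact one_mul 1
  · refine Fin.lastCases ?_ (fun i => ?_) i
    · rw [octMatrix8_last, pairing_self hB hg hz, Matrix.mul_one, hR]
      exact one_smul ℝ 1
    · rw [octMatrix8_castSucc, ← h i, Matrix.mul_smul, Matrix.smul_mul]
      congr 1
      exact if_congr Fin.castSucc_eq_zero_iff rfl rfl

theorem trace_conj {F G R : Matrix (Fin 8) (Fin 8) ℝ} (hR : Rᵀ * R = 1) :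
    (R * F * Rᵀ * (R * G * Rᵀ)ᵀ).trace = (F * Gᵀ).trace := by
  rw [transpose_mul, transpose_mul, transpose_transpose,
    show R * F * Rᵀ * (R * (Gᵀ * Rᵀ)) = R * (F * (Rᵀ * R) * Gᵀ * Rᵀ) by
      simp only [Matrix.mul_assoc], Matrix.trace_mul_comm, hR, Matrix.mul_one, Matrix.mul_assoc,
    hR, Matrix.mul_one]

theorem transpose_conj_eq_neg_iff {ι : Type*} [Fintype ι] [DecidableEq ι] {F R : Matrix ι ι ℝ} (hR : Rᵀ * R = 1) :
    (R * F * Rᵀ)ᵀ = -(R * F * Rᵀ) ↔ Fᵀ = -F := by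
  have h1 : (R * F * Rᵀ)ᵀ = R * Fᵀ * Rᵀ := by
    simp only [transpose_mul, transpose_transpose, Matrix.mul_assoc]
  rw [h1]
  constructor
  · intro h
    have := congrArg (fun H => Rᵀ * H * R) h
    have e : ∀ H : Matrix ι ι ℝ, Rᵀ * (R * H * Rᵀ) * R = H := fun H => by
      rw [show Rᵀ * (R * H * Rᵀ) * R = Rᵀ * R * H * (Rᵀ * R) by simp only [Matrix.mul_assoc], hR,
        Matrix.one_mul, Matrix.mul_one]
    simpa only [Matrix.mul_neg, Matrix.neg_mul, e] using this
  · intro h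
    rw [h, Matrix.mul_neg, Matrix.neg_mul]

/-- The basis of spinors is chosen so that its first $\dim W$ members span $W$. In the octonionic
frame the conditions on $F$ then become those of the model, up to the nonzero factors
$\sigma_i\sigma_j$. -/
theorem exists_conj_mem_model8 [FiniteDimensional ℝ X] (hX : finrank ℝ X = 8)
    (hB : IsClifford B) {W : Submodule ℝ X} {S : Set (Matrix (Fin 8) (Fin 8) ℝ)}
    (hS : ∀ g, IsInvariantForm B g → ∀ F, F ∈ S ↔
      Fᵀ = -F ∧ ∀ x ∈ W, ∀ y, (F * (pairing B g y x)ᵀ).trace = 0) :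
    ∃ R ∈ orthogonalGroup (Fin 8) ℝ, ∀ F, F ∈ S ↔ R * F * Rᵀ ∈ model8 (finrank ℝ W) := by
  obtain ⟨g, hg⟩ := hB.exists_invariantForm
  obtain ⟨ψ, hψ, hW⟩ := exists_orthonormal_adapted hg.symm hg.pos hX W
  obtain ⟨R, hR, σ, hσ, hoct⟩ := exists_conj_octMatrix8 hX hB hg hψ
  have hR2 : Rᵀ * R = 1 := mul_eq_one_comm.1 hR
  have hz : g (ψ (Fin.last 7)) (ψ (Fin.last 7)) = 1 := by rw [hψ, if_pos rfl]
  have hli : LinearIndependent ℝ ψ := by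
    rw [Fintype.linearIndependent_iff]
    intro t ht i
    have := congrArg (g (ψ i)) ht
    simpa [map_sum, hψ] using this
  have htop : Submodule.span ℝ (Set.range ψ) = ⊤ :=
    hli.span_eq_top_of_card_eq_finrank' (by simpa using hX.symm)
  refine ⟨R, (mem_orthogonalGroup_iff _ _).2 hR, fun F => ?_⟩
  rw [hS g hg, model8, Set.mem_ofPred_eq, transpose_conj_eq_neg_iff hR2]
  refine and_congr_right fun _ => ?_
  let T : LinearMap.BilinForm ℝ X := LinearMap.mk₂ ℝ
    (fun y x => (F * (pairing B g y x)ᵀ).trace)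
    (fun y y' x => by
      have : pairing B g (y + y') x = pairing B g y x + pairing B g y' x := by
        ext; simp [pairing]
      rw [this, transpose_add, Matrix.mul_add, trace_add])
    (fun c y x => by
      have : pairing B g (c • y) x = c • pairing B g y x := by ext; simp [pairing]
      rw [this, transpose_smul, Matrix.mul_smul, trace_smul])
    (fun y x x' => by
      have : pairing B g y (x + x') = pairing B g y x + pairing B g y x' := by
        ext; simp [pairing]
      rw [this, transpose_add, Matrix.mul_add, trace_add])
    (fun c y x => by
      have : pairing B g y (c • x) = c • pairing B g y x := by ext; simp [pairing]
      rw [this, transpose_smul, Matrix.mul_smul, trace_smul])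
  have hT : ∀ y x, (F * (pairing B g y x)ᵀ).trace = T y x := fun y x => rfl
  have hocT : ∀ i j, (R * F * Rᵀ * ((octMatrix8 j)ᵀ * octMatrix8 i)ᵀ).trace =
      σ j * σ i * T (ψ j) (ψ i) := fun i j => by
    have : (octMatrix8 j)ᵀ * octMatrix8 i =
        (σ j * σ i) • (R * pairing B g (ψ j) (ψ i) * Rᵀ) := by
      rw [← hoct, ← hoct, pairing_eq_mul hX hB hg hz (ψ j) (ψ i), transpose_smul, Matrix.smul_mul,
        Matrix.mul_smul, smul_smul]
      congr 1
      simp only [transpose_mul, transpose_transpose, Matrix.mul_assoc]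
      rw [← Matrix.mul_assoc Rᵀ R, hR2, Matrix.one_mul]
    rw [this, transpose_smul, Matrix.mul_smul, trace_smul, trace_conj hR2, hT, smul_eq_mul]
  have hσ0 : ∀ i, σ i ≠ 0 := fun i h => by
    have := hσ i
    rw [h, mul_zero] at this
    exact zero_ne_one this
  simp only [hT, hocT]
  constructor
  · intro h i j hi
    rw [h (ψ i) (hW ▸ Submodule.subset_span ⟨i, hi, rfl⟩), mul_zero]
  · intro h x hx y
    have h1 : ∀ i : Fin 8, i.val < finrank ℝ W → ∀ y, T y (ψ i) = 0 := fun i hi y => by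
      have hy : y ∈ Submodule.span ℝ (Set.range ψ) := htop ▸ Submodule.mem_top
      induction hy using Submodule.span_induction with
      | mem y hy =>
        obtain ⟨j, rfl⟩ := hy
        have := h i j hi
        simpa [hσ0] using this
      | zero => simp
      | add y z _ _ hy hz => rw [map_add, LinearMap.add_apply, hy, hz, add_zero]
      | smul c y _ hy => rw [map_smul, LinearMap.smul_apply, hy, smul_zero]
    rw [hW] at hx
    induction hx using Submodule.span_induction with
    | mem x hx =>
      obtain ⟨i, hi, rfl⟩ := hx
      exact h1 i hi y
    | zero => simp
    | add y z _ _ hy hz => rw [map_add, hy, hz, add_zero]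
    | smul c y _ hy => rw [map_smul, hy, smul_zero]

end Triality

theorem IsSystem.exists_conj_mem_model8 {n : ℕ} {S : Set (Matrix (Fin 8) (Fin 8) ℝ)}
    (h : IsSystem 8 n S) : ∃ R ∈ orthogonalGroup (Fin 8) ℝ, ∀ F, F ∈ S ↔ R * F * Rᵀ ∈ model8 n := by
  obtain ⟨Γ, hΓ, A, hA, W, hW, hn, rfl⟩ := h
  rw [IsParameterSpace, if_pos rfl] at hA
  obtain ⟨C, hC, s, hs, rfl⟩ := hA
  have hd : Even 8 := by decide
  have hχ : chirality Γ = (Γ 0 * Γ 1) * ((Γ 2 * Γ 3) * ((Γ 4 * Γ 5) * (Γ 6 * Γ 7))) := by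
    have h1 : (-Complex.I) ^ (8 / 2) = 1 := by norm_num
    rw [chirality, h1, one_smul]
    simp [List.ofFn_succ, Matrix.mul_assoc]
  have hχC : ∀ x, C (chirality Γ *ᵥ x) = chirality Γ *ᵥ C x := by
    intro x
    rw [hχ]
    simp only [← mulVec_mulVec (M := Γ 0 * Γ 1), ← mulVec_mulVec (M := Γ 2 * Γ 3),
      ← mulVec_mulVec (M := Γ 4 * Γ 5), hC.2]
  have hCw : ∀ x ∈ weyl Γ s, C x ∈ weyl Γ s := by
    intro x hx
    rw [mem_weyl] at hx ⊢
    rw [← hχC, hx, LinearMap.map_smulₛₗ]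
    rcases hs with rfl | rfl <;> simp
  have h8 : finrank ℂ (weyl Γ s) = 8 := by
    have := hΓ.finrank_weyl hd 0 (by
      have h1 : ∑ i ∈ Finset.range 8, i = 28 := rfl
      rw [h1, show (8 / 2) = 4 from rfl, Even.neg_pow (by decide), Complex.I_pow_four,
        Even.neg_one_pow (by decide), one_pow, one_mul]) hs
    norm_num at this
    omega
  let M : Submodule ℝ (Spinor 8) := fixedPoints C ⊓ (weyl Γ s).restrictScalars ℝ
  have hX : finrank ℝ M = 8 := (finrank_fixedPoints hC.1 _ hCw).trans h8
  have hpair : ∀ a b, ∀ x ∈ M, realMulVec (Γ a * Γ b) x ∈ M := fun a b x hx =>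
    ⟨(hC.2 a b x).trans (congrArg _ hx.1), hΓ.mul_mulVec_mem_weyl hd a b hx.2⟩
  let E : Fin 8 → Fin 8 → M →ₗ[ℝ] M := fun a b => (realMulVec (Γ a * Γ b)).restrict (hpair a b)
  let B : Fin 7 → M →ₗ[ℝ] M := fun a => E (Fin.last 7) a.castSucc
  have hne : ∀ i : Fin 7, Fin.castSucc i ≠ Fin.last 7 := fun i => (Fin.castSucc_lt_last i).ne
  have hE : ∀ a b x, ((E a b x : M) : Spinor 8) = (Γ a * Γ b) *ᵥ (x : Spinor 8) := fun _ _ _ => rfl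
  have hBB : ∀ a b x, B a (B b x) = -E a.castSucc b.castSucc x := by
    intro a b x
    apply Subtype.ext
    rw [Submodule.coe_neg, hE, hE, hE, mulVec_mulVec, hΓ.anti (hne a).symm, Matrix.neg_mul,
      Matrix.mul_assoc, hΓ.sq_assoc, neg_mulVec]
  have hB : IsClifford B := by
    intro a b x
    apply Subtype.ext
    rw [Submodule.coe_add, hBB, hBB, Submodule.coe_neg, Submodule.coe_neg, hE, hE, ← neg_add,
      hΓ.mulVec_add]
    simp only [Fin.castSucc_inj]
    split_ifs
    · rw [Submodule.coe_smul]; module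
    · simp
  have hWM : W = Submodule.span ℂ ((M : Set (Spinor 8)) ∩ W) := by
    have : (M : Set (Spinor 8)) = weylSpinors Γ s ∩ majoranaSpinors C := by
      rw [Set.inter_comm, ← coe_weyl]
      rfl
    rw [this]
    exact hW
  obtain ⟨h1, h2⟩ := finrank_fixed_subspace M (fun x hx => hx.1) hWM
  rw [← hn, ← h1]
  refine BPS.exists_conj_mem_model8 hX hB fun g hg F => and_congr_right fun _ => ?_
  have hgE : ∀ a b (y x : M), g (cl8 B a y) (cl8 B b x) = g y (E a b x) := by
    intro a b y x
    refine Fin.lastCases ?_ (fun a => ?_) a <;> refine Fin.lastCases ?_ (fun b => ?_) b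
    · simp only [cl8_last, LinearMap.id_apply]
      congr 1
      apply Subtype.ext
      rw [hE, hΓ.sq, one_mulVec]
    · simp only [cl8_last, cl8_castSucc, LinearMap.id_apply]
      rfl
    · simp only [cl8_last, cl8_castSucc, LinearMap.id_apply, hg.skew]
      rw [← map_neg]
      congr 1
      apply Subtype.ext
      rw [Submodule.coe_neg, hE, hE, hΓ.anti (hne a), neg_mulVec]
    · simp only [cl8_castSucc, hg.skew]
      rw [hBB, map_neg, neg_neg]
  let T : M →ₗ[ℝ] M := ∑ a, ∑ b, F a b • E a b
  have hT : ∀ x : M, ((T x : M) : Spinor 8) = fieldMatrix Γ F *ᵥ (x : Spinor 8) := by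
    intro x
    rw [fieldMatrix_mulVec]
    simp only [T, LinearMap.sum_apply, LinearMap.smul_apply, Submodule.coe_sum, Submodule.coe_smul,
      hE]
  -- $g(\Gamma_a$-multiple of $y,\Gamma_b$-multiple of $x)=g(y,\Gamma_a\Gamma_bx)$, so the trace is
  -- the matrix element of the field matrix between $y$ and $x$; positivity of $g$ then recovers the
  -- vanishing of the field matrix on $W$.
  have htr : ∀ x y : M, (F * (pairing B g y x)ᵀ).trace = g y (T x) := by
    intro x y
    simp only [T, LinearMap.sum_apply, LinearMap.smul_apply, map_sum, map_smul, smul_eq_mul, ← hgE]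
    rfl
  constructor
  · intro hF x hx y
    have : T x = 0 := Subtype.ext ((hT x).trans (hF x hx))
    rw [htr, this, map_zero]
  · intro hF x hx
    have hF2 : ∀ x : M, (x : Spinor 8) ∈ W → fieldMatrix Γ F *ᵥ (x : Spinor 8) = 0 := by
      intro x hx
      rw [← hT]
      by_contra hne
      have h0 : T x ≠ 0 := fun h => hne (by rw [h]; rfl)
      have h3 := hF x hx (T x)
      rw [htr] at h3
      exact (hg.pos _ h0).ne' h3
    rw [h2] at hx
    induction hx using Submodule.span_induction with
    | mem x hx =>
      obtain ⟨y, hy, rfl⟩ := hx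
      exact hF2 y hy
    | zero => simp
    | add x y _ _ hx hy => rw [mulVec_add, hx, hy, add_zero]
    | smul c x _ hx => rw [mulVec_smul, hx, smul_zero]

theorem IsSystem.equivalent_eight {n : ℕ} {S T : Set (Matrix (Fin 8) (Fin 8) ℝ)}
    (hS : IsSystem 8 n S) (hT : IsSystem 8 n T) : Equivalent S T := by
  obtain ⟨R, hR, hRS⟩ := hS.exists_conj_mem_model8
  obtain ⟨Q, hQ, hQT⟩ := hT.exists_conj_mem_model8
  exact equivalent_of_canonical hR hQ hRS hQT

/-! ### Dimensions at most four -/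

theorem apply_self_eq_zero {d : ℕ} {F : Matrix (Fin d) (Fin d) ℝ} (hF : Fᵀ = -F) (a : Fin d) :
    F a a = 0 := by
  have := congrFun (congrFun hF a) a
  simp only [transpose_apply, Matrix.neg_apply] at this
  linarith

theorem apply_swap {d : ℕ} {F : Matrix (Fin d) (Fin d) ℝ} (hF : Fᵀ = -F) (a b : Fin d) :
    F b a = -F a b :=
  congrFun (congrFun hF a) b

theorem skew_eq_zero_of_le_one {d : ℕ} (hd : d ≤ 1) {F : Matrix (Fin d) (Fin d) ℝ}
    (hF : Fᵀ = -F) : F = 0 := by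
  ext a b
  have : a = b := by omega
  rw [this, apply_self_eq_zero hF]
  rfl

theorem IsSystem.transpose_eq_neg {d n : ℕ} {S : Set (Matrix (Fin d) (Fin d) ℝ)}
    (h : IsSystem d n S) {F : Matrix (Fin d) (Fin d) ℝ} (hF : F ∈ S) : Fᵀ = -F := by
  obtain ⟨Γ, -, A, -, W, -, -, rfl⟩ := h
  exact hF.1

theorem IsSystem.eq_singleton {d n : ℕ} {S : Set (Matrix (Fin d) (Fin d) ℝ)}
    (h : IsSystem d n S) (h0 : ∀ F ∈ S, F = 0) : S = {0} := by
  obtain ⟨Γ, -, A, -, W, -, -, rfl⟩ := h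
  exact Set.Subset.antisymm h0 (Set.singleton_subset_iff.2 (zero_mem_annihilator Γ W))

/-- $(aP+bQ+cR)^2=-(a^2+b^2+c^2)$, so a nonzero real combination of $P,Q,R$ kills no vector. -/
theorem coeff_eq_zero_of_anticommuting {ι : Type*} [Fintype ι] [DecidableEq ι]
    {P Q R : Matrix ι ι ℂ} (hP : P * P = -1) (hQ : Q * Q = -1) (hR : R * R = -1)
    (hPQ : Q * P = -(P * Q)) (hPR : R * P = -(P * R)) (hQR : R * Q = -(Q * R)) {x : ι → ℂ}
    (hx : x ≠ 0) {a b c : ℝ} (h : a • (P *ᵥ x) + b • (Q *ᵥ x) + c • (R *ᵥ x) = 0) :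
    a = 0 ∧ b = 0 ∧ c = 0 := by
  have hM : (a • P + b • Q + c • R) * (a • P + b • Q + c • R) =
      (-(a * a + b * b + c * c)) • (1 : Matrix ι ι ℂ) := by
    simp only [Matrix.add_mul, Matrix.mul_add, smul_mul_smul_comm, hP, hQ, hR, hPQ, hPR, hQR]
    module
  have h1 : (a • P + b • Q + c • R) *ᵥ x = 0 := by
    rw [add_mulVec, add_mulVec, smul_mulVec, smul_mulVec, smul_mulVec, h]
  have h2 := congrArg (· *ᵥ x) hM
  beta_reduce at h2
  rw [← mulVec_mulVec, h1, mulVec_zero, smul_mulVec, one_mulVec] at h2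
  have h3 : a * a + b * b + c * c = 0 := by
    simpa [hx, -neg_add_rev] using h2.symm
  refine ⟨?_, ?_, ?_⟩ <;> refine mul_self_eq_zero.1 ?_ <;>
    linarith [mul_self_nonneg a, mul_self_nonneg b, mul_self_nonneg c]

theorem IsGammaSystem.pair_sq {d : ℕ} {Γ : Fin d → SpinorMatrix d} (hΓ : IsGammaSystem Γ)
    {a b : Fin d} (h : a ≠ b) : Γ a * Γ b * (Γ a * Γ b) = -1 := by
  rw [Matrix.mul_assoc, hΓ.anti_assoc h.symm, Matrix.mul_neg, hΓ.sq_assoc, hΓ.sq]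

theorem IsGammaSystem.pair_anti {d : ℕ} {Γ : Fin d → SpinorMatrix d} (hΓ : IsGammaSystem Γ)
    {a b c : Fin d} (hab : a ≠ b) (hac : a ≠ c) (hbc : b ≠ c) :
    Γ a * Γ c * (Γ a * Γ b) = -(Γ a * Γ b * (Γ a * Γ c)) := by
  rw [Matrix.mul_assoc, Matrix.mul_assoc, hΓ.anti_assoc hac.symm, hΓ.anti_assoc hab.symm,
    Matrix.mul_neg, Matrix.mul_neg, hΓ.sq_assoc, hΓ.sq_assoc, neg_neg, hΓ.anti hbc]

theorem IsSystem.exists_ne_zero {d n : ℕ} {S : Set (Matrix (Fin d) (Fin d) ℝ)}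
    (h : IsSystem d n S) (h0 : n ≠ 0) : ∃ Γ : Fin d → SpinorMatrix d, IsGammaSystem Γ ∧
      ∃ x : Spinor d, x ≠ 0 ∧ ∀ F ∈ S, fieldMatrix Γ F *ᵥ x = 0 := by
  obtain ⟨Γ, hΓ, A, -, W, -, hn, rfl⟩ := h
  obtain ⟨x, hxW, hx⟩ := Submodule.exists_mem_ne_zero_of_ne_bot (p := W) fun h => h0 (by
    rw [← hn, h, finrank_bot])
  exact ⟨Γ, hΓ, x, hx, fun F hF => hF.2 x hxW⟩

theorem IsSystem.eq_zero_two {n : ℕ} {S : Set (Matrix (Fin 2) (Fin 2) ℝ)}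
    (h : IsSystem 2 n S) (h0 : n ≠ 0) : ∀ F ∈ S, F = 0 := by
  obtain ⟨Γ, hΓ, x, hx, hS⟩ := h.exists_ne_zero h0
  intro F hFS
  have hF := h.transpose_eq_neg hFS
  have h1 := hS F hFS
  rw [fieldMatrix_mulVec] at h1
  simp only [Fin.sum_univ_two, apply_self_eq_zero hF, apply_swap hF 0 1,
    hΓ.anti (show (1 : Fin 2) ≠ 0 by decide), neg_mulVec, smul_neg, neg_smul, zero_smul] at h1
  have h2 : F 0 1 • ((Γ 0 * Γ 1) *ᵥ x) = 0 := by
    have : (2 : ℝ) • F 0 1 • ((Γ 0 * Γ 1) *ᵥ x) = 0 := by rw [← h1]; module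
    exact (smul_eq_zero.1 this).resolve_left two_ne_zero
  have hne : (Γ 0 * Γ 1) *ᵥ x ≠ 0 := fun h => hx (by
    have := congrArg ((Γ 0 * Γ 1) *ᵥ ·) h
    beta_reduce at this
    rwa [mulVec_mulVec, hΓ.pair_sq (by decide), neg_mulVec, one_mulVec, mulVec_zero,
      neg_eq_zero] at this)
  have h3 := (smul_eq_zero.1 h2).resolve_right hne
  ext a b
  fin_cases a <;> fin_cases b <;> simp [apply_self_eq_zero hF, apply_swap hF 0 1, h3]

theorem IsSystem.eq_zero_three {n : ℕ} {S : Set (Matrix (Fin 3) (Fin 3) ℝ)}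
    (h : IsSystem 3 n S) (h0 : n ≠ 0) : ∀ F ∈ S, F = 0 := by
  obtain ⟨Γ, hΓ, x, hx, hS⟩ := h.exists_ne_zero h0
  intro F hFS
  have hF := h.transpose_eq_neg hFS
  have h1 := hS F hFS
  rw [fieldMatrix_mulVec] at h1
  simp only [Fin.sum_univ_three, apply_self_eq_zero hF, apply_swap hF 0 1, apply_swap hF 0 2,
    apply_swap hF 1 2, hΓ.anti (show (1 : Fin 3) ≠ 0 by decide),
    hΓ.anti (show (2 : Fin 3) ≠ 0 by decide), hΓ.anti (show (2 : Fin 3) ≠ 1 by decide),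
    neg_mulVec, smul_neg, neg_smul, zero_smul] at h1
  have h2 : F 0 1 • ((Γ 0 * Γ 1) *ᵥ x) + F 0 2 • ((Γ 0 * Γ 2) *ᵥ x) +
      F 1 2 • ((Γ 1 * Γ 2) *ᵥ x) = 0 := by
    have : (2 : ℝ) • (F 0 1 • ((Γ 0 * Γ 1) *ᵥ x) + F 0 2 • ((Γ 0 * Γ 2) *ᵥ x) +
      F 1 2 • ((Γ 1 * Γ 2) *ᵥ x)) = 0 := by rw [← h1]; module
    exact (smul_eq_zero.1 this).resolve_left two_ne_zero
  obtain ⟨h01, h02, h12⟩ := coeff_eq_zero_of_anticommuting (hΓ.pair_sq (by decide))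
    (hΓ.pair_sq (by decide)) (hΓ.pair_sq (by decide))
    (hΓ.pair_anti (by decide) (by decide) (by decide))
    (by
      have := hΓ.pair_anti (a := 1) (b := 0) (c := 2) (by decide) (by decide) (by decide)
      rw [hΓ.anti (show (1 : Fin 3) ≠ 0 by decide)] at this
      simpa using congrArg Neg.neg this)
    (by
      have := hΓ.pair_anti (a := 2) (b := 0) (c := 1) (by decide) (by decide) (by decide)
      rw [hΓ.anti (show (2 : Fin 3) ≠ 0 by decide), hΓ.anti (show (2 : Fin 3) ≠ 1 by decide)] at this
      simpa using this) hx h2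
  ext a b
  fin_cases a <;> fin_cases b <;>
    simp [apply_self_eq_zero hF, apply_swap hF 0 1, apply_swap hF 0 2, apply_swap hF 1 2, h01, h02,
      h12]

/-- The (anti-)self-dual matrices. -/
def selfDual (s : ℝ) : Set (Matrix (Fin 4) (Fin 4) ℝ) :=
  {F | Fᵀ = -F ∧ F 0 1 + s * F 2 3 = 0 ∧ F 0 2 - s * F 1 3 = 0 ∧ F 0 3 + s * F 1 2 = 0}

theorem IsSystem.eq_selfDual {n : ℕ} {S : Set (Matrix (Fin 4) (Fin 4) ℝ)} (h : IsSystem 4 n S)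
    (h0 : n ≠ 0) : ∃ s : ℝ, (s = 1 ∨ s = -1) ∧ S = selfDual s := by
  obtain ⟨Γ, hΓ, A, hA, W, hW, hn, rfl⟩ := h
  rw [IsParameterSpace, if_neg (by norm_num), if_neg (by norm_num), if_pos (by decide)] at hA
  obtain ⟨t, ht, rfl⟩ := hA
  obtain ⟨s, hs, rfl⟩ : ∃ s : ℝ, (s = 1 ∨ s = -1) ∧ t = s := by
    rcases ht with rfl | rfl
    · exact ⟨1, by simp⟩
    · exact ⟨-1, by simp⟩
  refine ⟨s, hs, ?_⟩
  have hWw : ∀ x ∈ W, x ∈ weyl Γ s := by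
    rw [← SetLike.le_def, hW, Submodule.span_le, coe_weyl]
    exact Set.inter_subset_left
  have hχ : chirality Γ = -(Γ 0 * Γ 1 * (Γ 2 * Γ 3)) := by
    have h1 : (-Complex.I) ^ (4 / 2) = -1 := by norm_num
    rw [chirality, h1, neg_one_smul]
    simp [List.ofFn_succ, Matrix.mul_assoc]
  -- On spinors of chirality $s$ complementary pairs agree up to sign. Six components of $F$ thus
  -- collapse to three coefficients of $\Gamma_0\Gamma_1$, $\Gamma_0\Gamma_2$, $\Gamma_0\Gamma_3$.
  have hdual : ∀ a b c e : Fin 4, a ≠ b → ∀ r : ℝ, Γ 0 * Γ 1 * (Γ 2 * Γ 3) =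
      r • (Γ a * Γ b * (Γ c * Γ e)) → r * r = 1 → ∀ x ∈ W,
      (Γ c * Γ e) *ᵥ x = (r * s) • ((Γ a * Γ b) *ᵥ x) := by
    intro a b c e hab r hr hrr x hx
    have h1 := mem_weyl.1 (hWw x hx)
    rw [hχ, hr, neg_mulVec, Complex.coe_smul, smul_mulVec] at h1
    have h2 := congrArg ((Γ a * Γ b) *ᵥ ·) h1
    simp only [mulVec_neg, mulVec_smul, mulVec_mulVec] at h2
    rw [← Matrix.mul_assoc (Γ a * Γ b) (Γ a * Γ b), hΓ.pair_sq hab, Matrix.neg_mul, Matrix.one_mul,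
      neg_mulVec, smul_neg, neg_neg] at h2
    rw [mul_smul, ← h2, smul_smul, hrr, one_smul]
  have h23 : ∀ x ∈ W, (Γ 2 * Γ 3) *ᵥ x = (1 * s) • ((Γ 0 * Γ 1) *ᵥ x) :=
    hdual 0 1 2 3 (by decide) 1 (by rw [one_smul]) (by norm_num)
  have h13 : ∀ x ∈ W, (Γ 1 * Γ 3) *ᵥ x = (-1 * s) • ((Γ 0 * Γ 2) *ᵥ x) :=
    hdual 0 2 1 3 (by decide) (-1) (by
      rw [neg_one_smul, Matrix.mul_assoc, Matrix.mul_assoc,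
        hΓ.anti_assoc (a := 1) (b := 2) (by decide), Matrix.mul_neg]) (by norm_num)
  have h12 : ∀ x ∈ W, (Γ 1 * Γ 2) *ᵥ x = (1 * s) • ((Γ 0 * Γ 3) *ᵥ x) :=
    hdual 0 3 1 2 (by decide) 1 (by
      rw [one_smul, Matrix.mul_assoc, Matrix.mul_assoc, hΓ.anti_assoc (a := 3) (b := 1) (by decide),
        hΓ.anti (a := 3) (b := 2) (by decide), Matrix.mul_neg, Matrix.mul_neg, Matrix.mul_neg,
        neg_neg]) (by norm_num)
  have key : ∀ F : Matrix (Fin 4) (Fin 4) ℝ, Fᵀ = -F → ∀ x ∈ W, fieldMatrix Γ F *ᵥ x =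
      (2 : ℝ) • ((F 0 1 + s * F 2 3) • ((Γ 0 * Γ 1) *ᵥ x) +
        (F 0 2 - s * F 1 3) • ((Γ 0 * Γ 2) *ᵥ x) +
        (F 0 3 + s * F 1 2) • ((Γ 0 * Γ 3) *ᵥ x)) := by
    intro F hF x hx
    rw [fieldMatrix_mulVec]
    simp only [Fin.sum_univ_four, apply_self_eq_zero hF, apply_swap hF 0 1, apply_swap hF 0 2,
      apply_swap hF 0 3, apply_swap hF 1 2, apply_swap hF 1 3, apply_swap hF 2 3,
      hΓ.anti (show (1 : Fin 4) ≠ 0 by decide), hΓ.anti (show (2 : Fin 4) ≠ 0 by decide),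
      hΓ.anti (show (3 : Fin 4) ≠ 0 by decide), hΓ.anti (show (2 : Fin 4) ≠ 1 by decide),
      hΓ.anti (show (3 : Fin 4) ≠ 1 by decide), hΓ.anti (show (3 : Fin 4) ≠ 2 by decide),
      neg_mulVec, h23 x hx, h13 x hx, h12 x hx]
    module
  ext F
  refine and_congr_right fun hF => ⟨fun h => ?_, fun h x hx => ?_⟩
  · obtain ⟨x, hxW, hx⟩ := Submodule.exists_mem_ne_zero_of_ne_bot (p := W) fun h => h0 (by
      rw [← hn, h, finrank_bot])
    have h1 := h x hxW
    rw [key F hF x hxW] at h1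
    exact coeff_eq_zero_of_anticommuting (hΓ.pair_sq (by decide))
      (hΓ.pair_sq (by decide)) (hΓ.pair_sq (by decide))
      (hΓ.pair_anti (by decide) (by decide) (by decide))
      (hΓ.pair_anti (by decide) (by decide) (by decide))
      (hΓ.pair_anti (by decide) (by decide) (by decide)) hx
      ((smul_eq_zero.1 h1).resolve_left two_ne_zero)
  · rw [key F hF x hx, h.1, h.2.1, h.2.2]
    simp

/-- For $s=-1$ the reflection of the last coordinate exchanges self-dual and anti-self-dual
matrices; equivalence under $O(d)$ rather than $SO(d)$ is used here. -/
theorem selfDual_equivalent {S : Set (Matrix (Fin 4) (Fin 4) ℝ)} {s : ℝ} (hs : s = 1 ∨ s = -1)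
    (hS : S = selfDual s) :
    ∃ R ∈ orthogonalGroup (Fin 4) ℝ, ∀ F, F ∈ S ↔ R * F * Rᵀ ∈ selfDual 1 := by
  have hv : (fun i => ![1, 1, 1, s] i * ![1, 1, 1, s] i) = fun _ => 1 := by
    ext i
    fin_cases i <;> rcases hs with rfl | rfl <;> simp
  have hR : diagonal ![1, 1, 1, s] * (diagonal ![1, 1, 1, s])ᵀ = 1 := by
    rw [diagonal_transpose, diagonal_mul_diagonal, hv, diagonal_one]
  refine ⟨diagonal ![1, 1, 1, s], (mem_orthogonalGroup_iff _ _).2 hR, fun F => ?_⟩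
  rw [hS]
  refine and_congr (transpose_conj_eq_neg_iff (mul_eq_one_comm.1 hR)).symm ?_
  simp only [diagonal_transpose, mul_diagonal, diagonal_mul]
  rcases hs with rfl | rfl
  · simp
  · simp only [cons_val]
    constructor <;> rintro ⟨h1, h2, h3⟩ <;> refine ⟨?_, ?_, ?_⟩ <;> linarith

theorem IsSystem.equivalent_four {n : ℕ} {S T : Set (Matrix (Fin 4) (Fin 4) ℝ)}
    (hS : IsSystem 4 n S) (hT : IsSystem 4 n T) (h0 : n ≠ 0) : Equivalent S T := by
  obtain ⟨s, hs, hs'⟩ := hS.eq_selfDual h0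
  obtain ⟨t, ht, ht'⟩ := hT.eq_selfDual h0
  obtain ⟨R, hR, hRS⟩ := selfDual_equivalent hs hs'
  obtain ⟨Q, hQ, hQT⟩ := selfDual_equivalent ht ht'
  exact equivalent_of_canonical hR hQ hRS hQT

/-! ### Comparison of systems of equal dimension -/

theorem IsSystem.equivalent_of_zero {d n : ℕ} {S T : Set (Matrix (Fin d) (Fin d) ℝ)}
    (hS : IsSystem d n S) (hT : IsSystem d n T) (h1 : ∀ F ∈ S, F = 0) (h2 : ∀ F ∈ T, F = 0) :
    Equivalent S T := by
  rw [hS.eq_singleton h1, hT.eq_singleton h2]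
  exact Equivalent.refl _

theorem IsSystem.equivalent_or {d n : ℕ} (hd : d ≤ 8) {S T : Set (Matrix (Fin d) (Fin d) ℝ)}
    (hS : IsSystem d n S) (hT : IsSystem d n T) :
    Equivalent S T ∨ (d = 7 ∧ n = 4 ∨ d = 5 ∧ n = 2) ∧
      ((∀ F ∈ S, F = 0) ∨ ∀ F ∈ T, F = 0) := by
  by_cases h0 : n = 0
  · subst h0
    rw [hS.eq_of_zero, hT.eq_of_zero]
    exact Or.inl (Equivalent.refl _)
  have zero := hS.equivalent_of_zero hT
  obtain h | rfl | rfl | rfl | rfl | rfl | rfl | rfl :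
    d ≤ 1 ∨ d = 2 ∨ d = 3 ∨ d = 4 ∨ d = 5 ∨ d = 6 ∨ d = 7 ∨ d = 8 := by omega
  · exact Or.inl (zero (fun F hF => skew_eq_zero_of_le_one h (hS.transpose_eq_neg hF))
      fun F hF => skew_eq_zero_of_le_one h (hT.transpose_eq_neg hF))
  · exact Or.inl (zero (hS.eq_zero_two h0) (hT.eq_zero_two h0))
  · exact Or.inl (zero (hS.eq_zero_three h0) (hT.eq_zero_three h0))
  · exact Or.inl (hS.equivalent_four hT h0)
  · rcases hS.form_five h0 with ⟨h1, hS⟩ | ⟨h1, hS⟩ <;>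
      rcases hT.form_five h0 with ⟨h2, hT⟩ | ⟨h2, hT⟩
    · exact Or.inl (hS.equivalent (by norm_num) hT)
    · exact Or.inr ⟨Or.inr ⟨rfl, le_antisymm h1 h2⟩, Or.inr hT⟩
    · exact Or.inr ⟨Or.inr ⟨rfl, le_antisymm h2 h1⟩, Or.inl hS⟩
    · exact Or.inl (zero hS hT)
  · rcases hS.form_six h0 with ⟨h1, hS⟩ | ⟨h1, hS⟩ <;>
      rcases hT.form_six h0 with ⟨h2, hT⟩ | ⟨h2, hT⟩
    · exact Or.inl (hS.equivalent (by norm_num) hT)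
    · omega
    · omega
    · exact Or.inl (zero hS hT)
  · rcases hS.form_seven h0 with ⟨h1, hS⟩ | ⟨h1, hS⟩ | ⟨h1, hS⟩ <;>
      rcases hT.form_seven h0 with ⟨h2, hT⟩ | ⟨h2, hT⟩ | ⟨h2, hT⟩
    · exact Or.inl (hS.equivalent le_rfl hT)
    · omega
    · omega
    · omega
    · exact Or.inl (hS.equivalent le_rfl hT)
    · exact Or.inr ⟨Or.inl ⟨rfl, h1⟩, Or.inr hT⟩
    · omega
    · exact Or.inr ⟨Or.inl ⟨rfl, h2⟩, Or.inl hS⟩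
    · exact Or.inl (zero hS hT)
  · exact Or.inl (hS.equivalent_eight hT)

/-- A zero solution set would give $n=\dim\operatorname{span}A$, which is 8 for $d=7$ and 4 for
$d=5$, against $n=4$ and $n=2$. -/
theorem IsBPSSystem.exists_ne_zero {d n : ℕ} {ν : ℝ} {S : Set (Matrix (Fin d) (Fin d) ℝ)}
    (h : IsBPSSystem d ν S) (hn : (n : ℝ) = ν * 2 ^ (d / 2))
    (hd : d = 7 ∧ n = 4 ∨ d = 5 ∧ n = 2) : ∃ F ∈ S, F ≠ 0 := by
  by_contra hS
  obtain ⟨Γ, hΓ, A, hA, hr⟩ := h.exists_span_eq hS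
  rw [← hn, Nat.cast_inj] at hr
  obtain ⟨rfl, rfl⟩ | ⟨rfl, rfl⟩ := hd
  · rw [IsParameterSpace, if_neg (by norm_num), if_pos rfl] at hA
    obtain ⟨C, hC, rfl⟩ := hA
    have h8 := hC.finrank_span_seven.2
    have : (fixedPoints C : Set (Spinor 7)) = majoranaSpinors C := rfl
    rw [this, hr] at h8
    norm_num at h8
  · rw [IsParameterSpace, if_neg (by norm_num), if_neg (by norm_num), if_neg (by decide)] at hA
    subst hA
    rw [Submodule.span_univ, finrank_top] at hr
    norm_num at hr

theorem IsProjectorSystem.equivalent_or {d : ℕ} (hd : d ≤ 8) {ν : ℝ}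
    {S T : Set (Matrix (Fin d) (Fin d) ℝ)} (hS : IsProjectorSystem d ν S)
    (hT : IsProjectorSystem d ν T) :
    Equivalent S T ∨ ((∀ F ∈ S, F = 0) ∨ ∀ F ∈ T, F = 0) ∧
      ∃ n : ℕ, (n : ℝ) = ν * 2 ^ (d / 2) ∧ (d = 7 ∧ n = 4 ∨ d = 5 ∧ n = 2) := by
  obtain ⟨n, hn, hS⟩ := hS.exists_isSystem
  obtain ⟨m, hm, hT⟩ := hT.exists_isSystem
  obtain rfl : m = n := by exact_mod_cast hm.trans hn.symm
  rcases hS.equivalent_or hd hT with h | ⟨h1, h2⟩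
  · exact Or.inl h
  · exact Or.inr ⟨h2, m, hn, h1⟩

end BPS

end

theorem theorem1 (d : ℕ) (hd : d ≤ 8) :
    (∀ ν ∈ BPS.supersymmetryFractions d,
      ∃ S, BPS.IsBPSSystem d ν S ∧ ∀ T, BPS.IsBPSSystem d ν T → BPS.Equivalent S T) ∧
    (∀ (ν : ℝ) (S T : Set (Matrix (Fin d) (Fin d) ℝ)),
      BPS.IsProjectorSystem d ν S → BPS.IsProjectorSystem d ν T →
      (∃ F ∈ S, F ≠ 0) → (∃ F ∈ T, F ≠ 0) → BPS.Equivalent S T) := by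
  have zero : ∀ {U : Set (Matrix (Fin d) (Fin d) ℝ)}, (∃ F ∈ U, F ≠ 0) → ¬∀ F ∈ U, F = 0 :=
    fun ⟨F, hF, hne⟩ h => hne (h F hF)
  refine ⟨fun ν ⟨S, hS⟩ => ⟨S, hS, fun T hT => ?_⟩, fun ν S T hS hT hS0 hT0 => ?_⟩
  · rcases hS.isProjectorSystem.equivalent_or hd hT.isProjectorSystem with h | ⟨h, n, hn, hdn⟩
    · exact h
    · rcases h with h | h
      · exact absurd h (zero (hS.exists_ne_zero hn hdn))
      · exact absurd h (zero (hT.exists_ne_zero hn hdn))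
  · rcases hS.equivalent_or hd hT with h | ⟨h | h, -⟩
    · exact h
    · exact absurd h (zero hS0)
    · exact absurd h (zero hT0)
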